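/- Theorem. All vertex eccentricities of a distance-hereditary graph can be computed in linear time. In detail: let $G=(V,E)$ denote a finite, simple, undirected, connected graph with vertex set $V=\{0,\dots,n-1\}$ and $m$ edges. The eccentricity of a vertex $v$ is $e_G(v)=\max_{u\in V} d_G(v,u)$, and $G$ is distance-hereditary if $d_H(x,y)=d_G(x,y)$ for every connected induced subgraph $H$ of $G$ and all vertices $x,y$ of $H$. There are a program for a random access machine (unit-cost addition, truncated subtraction, comparison, and reading and writing of memory at computed addresses) and a constant $C$ such that for every such graph $G$ that is distance-hereditary, given by adjacency lists in any order, the program halts after at most $C(n+m)$ steps, never writes a value or an address greater than $C(n+m)$ (so that memory words of $O(\log(n+m+2))$ bits suffice), and outputs $e_G(v)$ for every vertex $v$ of $G$. -/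

import Mathlib

/-- A graph is distance-hereditary if each of its connected induced subgraphs is isometric. -/
def IsDistanceHereditary {V : Type*} (G : SimpleGraph V) : Prop :=
  ∀ S : Set V, (G.induce S).Connected →
    ∀ u v : S, (G.induce S).dist u v = G.dist (u : V) (v : V)

/-! ### Random access machine with a step count

Memory consists of integer variables and of arrays of integers; a program refers to finitely many
of them, by fixed names. An array may be read and written at a computed index. The arithmetic
consists of addition, truncated subtraction and comparisons. Control flow is structured. -/

namespace RAM

/-- The contents of the memory: `var x` is the value of the variable `x`, and `arr a i` is the entry
with index `i` of the array `a`. -/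
structure State where
  var : ℕ → ℕ
  arr : ℕ → ℕ → ℕ

/-- Store `k` in the variable `x`. -/
def State.setVar (s : State) (x k : ℕ) : State :=
  { s with var := Function.update s.var x k }

/-- Store `k` in the array `a` at index `i`. -/
def State.setArr (s : State) (a i k : ℕ) : State :=
  { s with arr := Function.update s.arr a (Function.update (s.arr a) i k) }

/-- Expressions. -/
inductive Expr where
  | const (k : ℕ)
  | var (x : ℕ)
  | get (a : ℕ) (i : Expr)
  | add (e f : Expr)
  | sub (e f : Expr)
  | lt (e f : Expr)
  | eq (e f : Expr)

/-- The value of an expression; the truth values of comparisons are `1` and `0`. -/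
def Expr.eval (s : State) : Expr → ℕ
  | .const k => k
  | .var x => s.var x
  | .get a i => s.arr a (i.eval s)
  | .add e f => e.eval s + f.eval s
  | .sub e f => e.eval s - f.eval s
  | .lt e f => if e.eval s < f.eval s then 1 else 0
  | .eq e f => if e.eval s = f.eval s then 1 else 0

/-- The number of elementary operations in the evaluation of an expression. -/
def Expr.cost : Expr → ℕ
  | .const _ => 1
  | .var _ => 1
  | .get _ i => i.cost + 1
  | .add e f => e.cost + f.cost + 1
  | .sub e f => e.cost + f.cost + 1
  | .lt e f => e.cost + f.cost + 1
  | .eq e f => e.cost + f.cost + 1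

/-- Programs. -/
inductive Program where
  | skip
  | assign (x : ℕ) (e : Expr)
  | store (a : ℕ) (i e : Expr)
  | seq (P Q : Program)
  | branch (b : Expr) (P Q : Program)
  | loop (b : Expr) (P : Program)

/-- `Exec W P s t s'`: on a machine with memory words `0, …, W`, the program `P` started in the
state `s` halts in the state `s'` after `t` steps. All values and indices written must be at most
`W`: no rule applies to an overflow, so a program that overflows has no halting run. -/
inductive Exec (W : ℕ) : Program → State → ℕ → State → Prop
  | skip (s : State) : Exec W .skip s 1 s
  | assign (s : State) (x : ℕ) (e : Expr) (he : e.eval s ≤ W) :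
      Exec W (.assign x e) s (e.cost + 1) (s.setVar x (e.eval s))
  | store (s : State) (a : ℕ) (i e : Expr) (hi : i.eval s ≤ W) (he : e.eval s ≤ W) :
      Exec W (.store a i e) s (i.cost + e.cost + 1) (s.setArr a (i.eval s) (e.eval s))
  | seq {P Q : Program} {s s' s'' : State} {t t' : ℕ}
      (hP : Exec W P s t s') (hQ : Exec W Q s' t' s'') :
      Exec W (.seq P Q) s (t + t') s''
  | branch_true {b : Expr} {P Q : Program} {s s' : State} {t : ℕ}
      (hb : b.eval s ≠ 0) (hP : Exec W P s t s') :
      Exec W (.branch b P Q) s (b.cost + 1 + t) s'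
  | branch_false {b : Expr} {P Q : Program} {s s' : State} {t : ℕ}
      (hb : b.eval s = 0) (hQ : Exec W Q s t s') :
      Exec W (.branch b P Q) s (b.cost + 1 + t) s'
  | loop_true {b : Expr} {P : Program} {s s' s'' : State} {t t' : ℕ}
      (hb : b.eval s ≠ 0) (hP : Exec W P s t s') (hL : Exec W (.loop b P) s' t' s'') :
      Exec W (.loop b P) s (b.cost + 1 + t + t') s''
  | loop_false {b : Expr} {P : Program} {s : State} (hb : b.eval s = 0) :
      Exec W (.loop b P) s (b.cost + 1) s

/-- The memory `s` holds the graph `G` by adjacency lists, and nothing else. Variable `0` holds the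
number `n` of vertices. The adjacency lists of the vertices `0, …, n - 1`, each in an arbitrary
order and without repetition, stand one after the other in array `1`; array `0` holds their
boundaries, so that the list of the vertex `v` fills the indices `i` of array `1` with
`s.arr 0 v ≤ i < s.arr 0 (v + 1)`. All other memory cells are `0`. -/
structure HoldsGraph {n : ℕ} (G : SimpleGraph (Fin n)) (s : State) : Prop where
  var_zero : s.var 0 = n
  start : s.arr 0 0 = 0
  mono : ∀ v : Fin n, s.arr 0 v ≤ s.arr 0 (v + 1)
  list : ∀ v : Fin n, Set.BijOn (s.arr 1) (Set.Ico (s.arr 0 v) (s.arr 0 (v + 1)))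
    {u : ℕ | ∃ h : u < n, G.Adj v ⟨u, h⟩}
  var_rest : ∀ x, x ≠ 0 → s.var x = 0
  arr_zero_rest : ∀ i, n < i → s.arr 0 i = 0
  arr_one_rest : ∀ i, s.arr 0 n ≤ i → s.arr 1 i = 0
  arr_rest : ∀ a, 2 ≤ a → ∀ i, s.arr a i = 0

end RAM

/-! ### Program logic for the random access machine -/

namespace RAM

namespace State

/-! Hang `G` from `r = 0` and let N(v) be the set of neighbours of `v` one level closer to `r`
(`downNeighbors`). Isometry of suitable small induced subgraphs shows that two vertices of a level
which are joined without descending below it have the same N (`downNeighbors_eq_of_connected`). In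
particular the elements of one N(v) have equal N. Moreover, sets N(u), N(v) of the same level that
meet are nested (`downNeighbors_subset_or_subset`).

The vertices are eliminated one class at a time. Let U be the set of remaining vertices, where `u`
carries a pendant path of length `w u`; distances are always those of `G`, so the graph itself is
never changed. Let `v` in U have the highest level and, on this level, an inclusion-minimal N(v).
Put S = U ∩ N(v), and let A be the set of vertices of U on the level of `v` with the same N. Every
vertex of U outside S is equidistant from all elements of S (`dist_eq_of_mem_downNeighbors_of_min`),
so S can be contracted to an element `y` of largest weight. Likewise A is contracted to `a`
(`dist_eq_of_min`). After that, d(z,a) = d(z,y) + 1 for all remaining z ≠ a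
(`dist_eq_add_one_of_min`): `a` behaves like a pendant vertex at `y` and is absorbed into the weight
of `y`.

Each of these steps can be undone on the level of eccentricities. `weightedEccent` leaves out the
vertex's own path, and then the value of a contracted vertex is the maximum of the value at its
representative and of its eccentricity inside the contracted set. Inside S or A all distances are 1
or 2, so this inner eccentricity depends only on whether the vertex is adjacent to all other
vertices of largest weight (`weightedEccent_eq_add_ite`). The corrections are logged as `Entry`s and
replayed backwards from the moment when only the root is left (`IsLog.eliminate`, `wp_replayLog`).

For linear time the classes must be found cheaply. Decreasing `key`, the number of non-neighbours on
lower levels, means decreasing level and, on a level, smaller N first; a bucket sort provides this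
order. Inside a bucket the vertices keep the (reversed) order of the breadth-first search, and a
class is a block with a common parent, because the parent is determined by N
(`IsBFS.mem_iff_of_par_eq`). One elimination scans only the adjacency lists of `v`, of S without `y`
and of A without `a`. All these vertices are removed, so the scans sum up to O(n + m) (`wp_step`).
-/

@[simp] theorem setVar_var (s : State) (x k y : ℕ) :
    (s.setVar x k).var y = if y = x then k else s.var y := by
  simp [setVar, Function.update_apply]

@[simp] theorem setVar_arr (s : State) (x k : ℕ) : (s.setVar x k).arr = s.arr := rfl

@[simp] theorem setArr_var (s : State) (a i k : ℕ) : (s.setArr a i k).var = s.var := rfl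

@[simp] theorem setArr_arr (s : State) (a i k b : ℕ) :
    (s.setArr a i k).arr b = if b = a then Function.update (s.arr a) i k else s.arr b := by
  simp only [setArr, Function.update_apply]

end State

/-- `P`, started in `s`, halts after `t` steps in a state `s'` with `Q t s'`. -/
def wp (W : ℕ) (P : Program) (Q : ℕ → State → Prop) (s : State) : Prop :=
  ∃ t s', Exec W P s t s' ∧ Q t s'

section wp

variable {W : ℕ} {P P' : Program} {Q R : ℕ → State → Prop} {s : State}

theorem wp_mono (h : wp W P Q s) (hQ : ∀ t s', Q t s' → R t s') : wp W P R s := by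
  obtain ⟨t, s', he, hq⟩ := h
  exact ⟨t, s', he, hQ _ _ hq⟩

@[simp] theorem wp_skip : wp W .skip Q s ↔ Q 1 s := by
  constructor
  · rintro ⟨t, s', he, hq⟩
    cases he; exact hq
  · exact fun h => ⟨_, _, .skip s, h⟩

@[simp] theorem wp_assign {x : ℕ} {e : Expr} :
    wp W (.assign x e) Q s ↔ e.eval s ≤ W ∧ Q (e.cost + 1) (s.setVar x (e.eval s)) := by
  constructor
  · rintro ⟨t, s', he, hq⟩
    cases he; exact ⟨by assumption, hq⟩
  · exact fun h => ⟨_, _, .assign s x e h.1, h.2⟩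

@[simp] theorem wp_store {a : ℕ} {i e : Expr} :
    wp W (.store a i e) Q s ↔ i.eval s ≤ W ∧ e.eval s ≤ W ∧
      Q (i.cost + e.cost + 1) (s.setArr a (i.eval s) (e.eval s)) := by
  constructor
  · rintro ⟨t, s', he, hq⟩
    cases he; exact ⟨by assumption, by assumption, hq⟩
  · exact fun h => ⟨_, _, .store s a i e h.1 h.2.1, h.2.2⟩

@[simp] theorem wp_seq :
    wp W (.seq P P') Q s ↔ wp W P (fun t s' => wp W P' (fun t' => Q (t + t')) s') s := by
  constructor
  · rintro ⟨t, s', he, hq⟩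
    cases he with
    | seq h h' => exact ⟨_, _, h, _, _, h', hq⟩
  · rintro ⟨t, s', h, t', s'', h', hq⟩
    exact ⟨_, _, .seq h h', hq⟩

@[simp] theorem wp_branch {b : Expr} :
    wp W (.branch b P P') Q s ↔
      (b.eval s ≠ 0 → wp W P (fun t => Q (b.cost + 1 + t)) s) ∧
      (b.eval s = 0 → wp W P' (fun t => Q (b.cost + 1 + t)) s) := by
  constructor
  · rintro ⟨t, s', he, hq⟩
    cases he with
    | branch_true hb h => exact ⟨fun _ => ⟨_, _, h, hq⟩, fun h' => absurd h' hb⟩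
    | branch_false hb h => exact ⟨fun h' => absurd hb h', fun _ => ⟨_, _, h, hq⟩⟩
  · rintro ⟨h, h'⟩
    by_cases hb : b.eval s = 0
    · obtain ⟨t, s', he, hq⟩ := h' hb
      exact ⟨_, _, .branch_false hb he, hq⟩
    · obtain ⟨t, s', he, hq⟩ := h hb
      exact ⟨_, _, .branch_true hb he, hq⟩

end wp

/-- The variables that a program may write. -/
def Program.vars : Program → List ℕ
  | .skip => []
  | .assign x _ => [x]
  | .store _ _ _ => []
  | .seq P Q => P.vars ++ Q.vars
  | .branch _ P Q => P.vars ++ Q.vars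
  | .loop _ P => P.vars

/-- The arrays that a program may write. -/
def Program.arrs : Program → List ℕ
  | .skip => []
  | .assign _ _ => []
  | .store a _ _ => [a]
  | .seq P Q => P.arrs ++ Q.arrs
  | .branch _ P Q => P.arrs ++ Q.arrs
  | .loop _ P => P.arrs

/-- `s'` agrees with `s` outside the memory that `P` may write. -/
structure Frame (P : Program) (s s' : State) : Prop where
  var : ∀ x, x ∉ P.vars → s'.var x = s.var x
  arr : ∀ a, a ∉ P.arrs → s'.arr a = s.arr a

theorem Frame.rfl {P : Program} {s : State} : Frame P s s :=
  ⟨fun _ _ => .refl _, fun _ _ => .refl _⟩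

theorem Frame.trans {P : Program} {s s' s'' : State} (h : Frame P s s') (h' : Frame P s' s'') :
    Frame P s s'' :=
  ⟨fun x hx => (h'.var x hx).trans (h.var x hx), fun a ha => (h'.arr a ha).trans (h.arr a ha)⟩

theorem Exec.frame {W : ℕ} {P : Program} {s s' : State} {t : ℕ} (h : Exec W P s t s') :
    Frame P s s' := by
  induction h with
  | skip s => exact .rfl
  | assign s x e he => exact ⟨fun y hy => by simp_all [Program.vars], fun a _ => rfl⟩
  | store s a i e hi he => exact ⟨fun y hy => rfl, fun b hb => by simp_all [Program.arrs]⟩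
  | seq _ _ ih ih' =>
    refine ⟨fun x hx => ?_, fun x hx => ?_⟩
    · simp only [Program.vars, List.mem_append, not_or] at hx
      rw [ih'.var x hx.2, ih.var x hx.1]
    · simp only [Program.arrs, List.mem_append, not_or] at hx
      rw [ih'.arr x hx.2, ih.arr x hx.1]
  | branch_true _ _ ih =>
    refine ⟨fun x hx => ih.var x ?_, fun x hx => ih.arr x ?_⟩
    · simp only [Program.vars, List.mem_append, not_or] at hx; exact hx.1
    · simp only [Program.arrs, List.mem_append, not_or] at hx; exact hx.1
  | branch_false _ _ ih =>
    refine ⟨fun x hx => ih.var x ?_, fun x hx => ih.arr x ?_⟩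
    · simp only [Program.vars, List.mem_append, not_or] at hx; exact hx.2
    · simp only [Program.arrs, List.mem_append, not_or] at hx; exact hx.2
  | loop_true _ _ _ ih ih' =>
    exact Frame.trans (P := .loop _ _) ⟨ih.var, ih.arr⟩ ih'
  | loop_false _ => exact .rfl

theorem wp_frame {W : ℕ} {P : Program} {Q : ℕ → State → Prop} {s : State} (h : wp W P Q s) :
    wp W P (fun t s' => Q t s' ∧ Frame P s s') s := by
  obtain ⟨t, s', he, hq⟩ := h
  exact ⟨t, s', he, hq, he.frame⟩

/-- Loops, with an invariant `I` that depends on an auxiliary value and with a potential `Φ` of the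
auxiliary value that pays for the steps. -/
theorem wp_loop {α : Type*} {W : ℕ} {b : Expr} {P : Program} {s : State} (I : α → State → Prop)
    (Φ : α → ℕ) (a : α) (h0 : I a s)
    (hstep : ∀ a s', I a s' → Frame P s s' → b.eval s' ≠ 0 →
      wp W P (fun t s'' => ∃ a', I a' s'' ∧ b.cost + 1 + t + Φ a' ≤ Φ a) s') :
    wp W (.loop b P) (fun t s' => ∃ a', I a' s' ∧ Frame P s s' ∧ b.eval s' = 0 ∧
      t + Φ a' ≤ Φ a + b.cost + 1) s := by
  -- The potential also proves termination: each round lowers it by at least `b.cost + 1`, so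
  -- induction on a bound for it suffices.
  suffices H : ∀ N a s', Φ a ≤ N → I a s' → Frame P s s' →
      wp W (.loop b P) (fun t s' => ∃ a', I a' s' ∧ Frame P s s' ∧ b.eval s' = 0 ∧
      t + Φ a' ≤ Φ a + b.cost + 1) s' from H _ a s le_rfl h0 .rfl
  intro N
  induction N with
  | zero =>
    intro a s' hN hI hF
    by_cases hb : b.eval s' = 0
    · exact ⟨_, _, .loop_false hb, a, hI, hF, hb, by omega⟩
    · obtain ⟨t, s'', he, a', hI', ht⟩ := hstep a s' hI hF hb
      omega
  | succ N ih =>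
    intro a s' hN hI hF
    by_cases hb : b.eval s' = 0
    · exact ⟨_, _, .loop_false hb, a, hI, hF, hb, by omega⟩
    · obtain ⟨t, s'', he, a', hI', ht⟩ := hstep a s' hI hF hb
      obtain ⟨t', s3, he', a'', hI'', hF'', hb'', ht''⟩ :=
        ih a' s'' (by omega) hI' (hF.trans he.frame)
      exact ⟨_, _, .loop_true hb he he', a'', hI'', hF'', hb'', by omega⟩

/-- Run `P` for the values of the variable `i` up to the value of the variable `e`. -/
def Program.forUpTo (i e : ℕ) (P : Program) : Program :=
  .loop (.lt (.var i) (.var e)) (.seq P (.assign i (.add (.var i) (.const 1))))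

/-- Loops over the elements of a list, with an invariant that depends on the elements done. -/
theorem wp_forUpTo {α : Type*} {W i e : ℕ} {P : Program} {s : State} (l : List α) (lo : ℕ)
    (I : List α → State → Prop) (T : α → ℕ) (hW : lo + l.length ≤ W)
    (hi : s.var i = lo) (he : s.var e = lo + l.length)
    (hie : e ≠ i) (hiP : i ∉ P.vars) (heP : e ∉ P.vars)
    (h0 : I [] s)
    (hstep : ∀ p x q s', l = p ++ x :: q → s'.var i = lo + p.length →
      Frame (.forUpTo i e P) s s' → I p s' →
      wp W P (fun t s'' => t ≤ T x ∧ I (p ++ [x]) (s''.setVar i (lo + p.length + 1))) s') :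
    wp W (.forUpTo i e P) (fun t s' => I l s' ∧ Frame (.forUpTo i e P) s s' ∧
      t ≤ (l.map fun x => T x + 8).sum + 4) s := by
  -- The auxiliary value is the number of elements done. A round costs 4 for the test and 4 for the
  -- increment besides `P`; the final 4 is the failing test.
  have key := wp_loop (W := W) (b := .lt (.var i) (.var e))
    (P := .seq P (.assign i (.add (.var i) (.const 1)))) (s := s)
    (fun k s' => k ≤ l.length ∧ s'.var i = lo + k ∧ I (l.take k) s')
    (fun k => ((l.drop k).map fun x => T x + 8).sum) 0 (by simpa using ⟨hi, h0⟩) ?_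
  · refine wp_mono key ?_
    rintro t s' ⟨k, ⟨hk, hik, hI⟩, hF, hb, ht⟩
    have hev : s'.var e = s.var e := hF.var e (by
      simp [Program.vars, heP, hie])
    have : k = l.length := by
      simp [Expr.eval, hik, hev, he] at hb
      omega
    subst this
    refine ⟨by simpa using hI, ⟨hF.var, hF.arr⟩, ?_⟩
    simp [Expr.cost] at ht ⊢
    omega
  · rintro k s' ⟨hk, hik, hI⟩ hF hb
    have hev : s'.var e = s.var e := hF.var e (by
      simp [Program.vars, heP, hie])
    have hlt : k < l.length := by
      simp [Expr.eval, hik, hev, he] at hb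
      omega
    have hl : l = l.take k ++ l[k] :: l.drop (k + 1) := by simp
    have hlen : (l.take k).length = k := by simp [hk]
    have := hstep (l.take k) l[k] (l.drop (k + 1)) s' hl (by rw [hik, hlen]) ⟨hF.var, hF.arr⟩ hI
    rw [wp_seq]
    refine wp_mono (wp_frame this) ?_
    rintro t s'' ⟨⟨ht, hI'⟩, hF'⟩
    rw [hlen] at hI'
    have hi'' : s''.var i = lo + k := by rw [hF'.var i hiP, hik]
    simp only [wp_assign, Expr.eval, Expr.cost, hi'']
    refine ⟨by omega, k + 1, ⟨by omega, by simp; omega, ?_⟩, ?_⟩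
    · rw [List.take_add_one, List.getElem?_eq_getElem hlt]
      exact hI'
    · have hd : ((l.drop k).map fun x => T x + 8).sum =
          T l[k] + 8 + ((l.drop (k + 1)).map fun x => T x + 8).sum := by
        rw [List.drop_eq_getElem_cons hlt, List.map_cons, List.sum_cons]
      omega

end RAM

/-! ### Distance-hereditary graphs hung from a vertex -/

namespace SimpleGraph

variable {V : Type*} (G : SimpleGraph V) (r : V)

/-- The neighbours of `v` that are closer to `r` than `v`. -/
def downNeighbors (v : V) : Set V := {u | G.Adj u v ∧ G.dist r u + 1 = G.dist r v}

variable {G r}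

theorem mem_downNeighbors {u v : V} :
    u ∈ G.downNeighbors r v ↔ G.Adj u v ∧ G.dist r u + 1 = G.dist r v := Iff.rfl

theorem Adj.dist_le_add_one (hc : G.Connected) {u v : V} (h : G.Adj u v) (x : V) :
    G.dist x v ≤ G.dist x u + 1 := by
  have := hc.dist_triangle (u := x) (v := u) (w := v)
  rwa [dist_eq_one_iff_adj.2 h] at this

theorem Connected.exists_mem_downNeighbors (hc : G.Connected) {v : V} (hv : G.dist r v ≠ 0) :
    ∃ u, u ∈ G.downNeighbors r v := by
  obtain ⟨p, hp⟩ := hc.exists_walk_length_eq_dist v r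
  cases p with
  | nil => simp at hv
  | cons h q =>
    rename_i u
    have h' : G.Adj v u := h
    refine ⟨u, h'.symm, ?_⟩
    have h1 : G.dist r u ≤ q.length := by rw [dist_comm]; exact dist_le q
    have h2 := h'.symm.dist_le_add_one hc r
    have h3 : q.length + 1 = G.dist r v := by rw [dist_comm]; simpa using hp
    omega

/-- A vertex `v` of a connected induced subgraph of a distance-hereditary graph has a neighbour
within the subgraph that is closer to `z`. -/
theorem _root_.IsDistanceHereditary.exists_adj (hG : IsDistanceHereditary G) {S : Set V}
    (hS : (G.induce S).Connected) {z v : V} (hz : z ∈ S) (hv : v ∈ S) (hzv : z ≠ v) :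
    ∃ x ∈ S, G.Adj x v ∧ G.dist z v = G.dist z x + 1 := by
  have h0 : (G.induce S).dist ⟨z, hz⟩ ⟨v, hv⟩ ≠ 0 := by
    rw [hS.dist_eq_zero_iff.ne]; simpa using hzv
  obtain ⟨⟨x, hx⟩, hx1, hx2⟩ := hS.exists_mem_downNeighbors h0
  rw [hG S hS, hG S hS] at hx2
  exact ⟨x, hx, by simpa using hx1, hx2.symm⟩

theorem connected_induce_of_reachable {S : Set V} {c : V} (hc : c ∈ S)
    (h : ∀ x, ∀ hx : x ∈ S, (G.induce S).Reachable ⟨c, hc⟩ ⟨x, hx⟩) : (G.induce S).Connected := by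
  have : Nonempty S := ⟨⟨c, hc⟩⟩
  exact ⟨fun x y => (h x x.2).symm.trans (h y y.2)⟩

theorem connected_induce_singleton (v : V) : (G.induce {v}).Connected := by
  refine connected_induce_of_reachable (c := v) rfl ?_
  rintro x rfl
  exact .rfl

/-- A connected set may be enlarged by neighbours of its elements. -/
theorem connected_induce_union_of_adj {S T : Set V} (hS : (G.induce S).Connected)
    (hT : ∀ x ∈ T, ∃ y ∈ S, G.Adj y x) : (G.induce (S ∪ T)).Connected := by
  obtain ⟨⟨c, hc⟩⟩ := hS.nonempty
  have h1 : ∀ x (hx : x ∈ S), (G.induce (S ∪ T)).Reachable ⟨c, .inl hc⟩ ⟨x, .inl hx⟩ := by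
    intro x hx
    exact (hS.preconnected ⟨c, hc⟩ ⟨x, hx⟩).map (G.induceHomOfLE Set.subset_union_left).toHom
  refine connected_induce_of_reachable (c := c) (.inl hc) ?_
  rintro x (hx | hx)
  · exact h1 x hx
  · obtain ⟨y, hy, hyx⟩ := hT x hx
    refine (h1 y hy).trans (Adj.reachable ?_)
    simpa using hyx

theorem Connected.connected_induce_ball (hc : G.Connected) (k : ℕ) :
    (G.induce {x | G.dist r x ≤ k}).Connected := by
  refine connected_induce_of_reachable (c := r) (by simp) ?_
  suffices H : ∀ j x, G.dist r x = j → ∀ hx : G.dist r x ≤ k,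
      (G.induce {x | G.dist r x ≤ k}).Reachable ⟨r, by simp⟩ ⟨x, hx⟩ from fun x hx => H _ x rfl hx
  intro j
  induction j with
  | zero =>
    intro x hx _
    obtain rfl := hc.dist_eq_zero_iff.1 hx
    exact .rfl
  | succ j ih =>
    intro x hx hxk
    obtain ⟨u, hu, hux⟩ := hc.exists_mem_downNeighbors (v := x) (r := r) (by omega)
    refine (ih u (by omega) (by omega)).trans (Adj.reachable ?_)
    simpa using hu

/-- This set is the union of the shortest paths from `r` to `x`; with an element other than `r` it
contains the down-neighbours of that element. -/
theorem Connected.connected_induce_interval (hc : G.Connected) (x : V) :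
    (G.induce {y | G.dist r y + G.dist y x = G.dist r x}).Connected := by
  refine connected_induce_of_reachable (c := r) (by simp) ?_
  suffices H : ∀ j y, G.dist r y = j → ∀ hy : G.dist r y + G.dist y x = G.dist r x,
      (G.induce {y | G.dist r y + G.dist y x = G.dist r x}).Reachable ⟨r, by simp⟩ ⟨y, hy⟩ from
    fun x hx => H _ x rfl hx
  intro j
  induction j with
  | zero =>
    intro y hy _
    obtain rfl := hc.dist_eq_zero_iff.1 hy
    exact .rfl
  | succ j ih =>
    intro y hy hyx
    obtain ⟨u, hu, huy⟩ := hc.exists_mem_downNeighbors (v := y) (r := r) (by omega)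
    have h1 := hc.dist_triangle (u := r) (v := u) (w := x)
    have h2 := hu.symm.dist_le_add_one hc x
    rw [dist_comm, dist_comm (u := x)] at h2
    refine (ih u (by omega) (by omega)).trans (Adj.reachable ?_)
    simpa using hu

/-! ### Down-neighbours and distances in distance-hereditary graphs -/

section DistanceHereditary

variable (hc : G.Connected) (hG : IsDistanceHereditary G)

include hc hG

/-- Vertices of one level that are joined by a connected set without vertices of lower levels have
the same down-neighbours. -/
theorem downNeighbors_subset_of_connected {S : Set V} (hS : (G.induce S).Connected) {u v : V}
    (hu : u ∈ S) (hv : v ∈ S) (huv : G.dist r u = G.dist r v)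
    (hlev : ∀ x ∈ S, G.dist r v ≤ G.dist r x) :
    G.downNeighbors r u ⊆ G.downNeighbors r v := by
  rintro x ⟨hxu, hx⟩
  -- In the interval from `r` to `x` only `x` itself lies on the level of `x`, and `S` has no vertex
  -- below `v`. Hence the vertex before `v` on a shortest path from `r` inside the union must be
  -- `x`.
  have hH := induce_union_connected (hc.connected_induce_interval (r := r) x).preconnected
    (connected_induce_union_of_adj hS (T := {x}) (by rintro _ rfl; exact ⟨u, hu, hxu.symm⟩)
      ).preconnected ⟨x, by simp, by simp⟩
  obtain ⟨y, hy, hyv, hd⟩ := hG.exists_adj hH (z := r) (v := v) (by simp) (by simp [hv])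
    (by rintro rfl; rw [dist_self] at huv; omega)
  rcases hy with hy | hy | rfl
  · obtain rfl : y = x := hc.dist_eq_zero_iff.1 (by simp at hy; omega)
    exact ⟨hyv, hd.symm⟩
  · have := hlev y hy
    omega
  · exact ⟨hyv, hd.symm⟩

theorem downNeighbors_eq_of_connected {S : Set V} (hS : (G.induce S).Connected) {u v : V}
    (hu : u ∈ S) (hv : v ∈ S) (huv : G.dist r u = G.dist r v)
    (hlev : ∀ x ∈ S, G.dist r v ≤ G.dist r x) :
    G.downNeighbors r u = G.downNeighbors r v :=
  (downNeighbors_subset_of_connected hc hG hS hu hv huv hlev).antisymm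
    (downNeighbors_subset_of_connected hc hG hS hv hu huv.symm (huv ▸ hlev))

theorem downNeighbors_eq_of_adj {u v : V} (h : G.Adj u v) (huv : G.dist r u = G.dist r v) :
    G.downNeighbors r u = G.downNeighbors r v :=
  downNeighbors_eq_of_connected hc hG (induce_pair_connected_of_adj h) (by simp) (by simp) huv
    (by simp [huv])

/-- The connecting set is `{a, u, v}`, where `a` lies one level above the other two. -/
theorem downNeighbors_eq_of_mem {a u v : V} (hu : u ∈ G.downNeighbors r a)
    (hv : v ∈ G.downNeighbors r a) : G.downNeighbors r u = G.downNeighbors r v := by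
  refine downNeighbors_eq_of_connected hc hG (connected_induce_union_of_adj
    (connected_induce_singleton a) (T := {u, v}) ?_) (by simp) (by simp) ?_ ?_
  · rintro x (rfl | rfl)
    exacts [⟨a, rfl, hu.1.symm⟩, ⟨a, rfl, hv.1.symm⟩]
  · have := hu.2; have := hv.2; omega
  · have := hu.2; have := hv.2
    rintro x (rfl | rfl | rfl) <;> omega

/-- The sets of down-neighbours of the vertices of one level form a laminar family. -/
theorem downNeighbors_subset_or_subset {u v c : V} (huv : G.dist r u = G.dist r v)
    (hcu : c ∈ G.downNeighbors r u) (hcv : c ∈ G.downNeighbors r v) :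
    G.downNeighbors r u ⊆ G.downNeighbors r v ∨ G.downNeighbors r v ⊆ G.downNeighbors r u := by
  by_contra! h
  obtain ⟨⟨a, hau, hav⟩, ⟨b, hbv, hbu⟩⟩ := And.imp Set.not_subset.1 Set.not_subset.1 h
  -- The common element `c` mediates: `a` and `c` lie in one set of down-neighbours, `c` and `b` in
  -- the other.
  have hab : G.downNeighbors r a = G.downNeighbors r b :=
    (downNeighbors_eq_of_mem hc hG hau hcu).trans (downNeighbors_eq_of_mem hc hG hcv hbv)
  have la := hau.2
  have lb := hbv.2
  have ha0 : G.dist r a ≠ 0 := by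
    intro h0
    have h1 := hc.dist_eq_zero_iff.1 h0
    have h2 := hc.dist_eq_zero_iff.1 (show G.dist r b = 0 by omega)
    exact hbu (h2 ▸ h1 ▸ hau)
  obtain ⟨p, hp⟩ := hc.exists_mem_downNeighbors ha0
  have hp' := hab ▸ hp
  have lp := hp.2
  -- In `G` the vertices `u` and `v` have distance at most 2 through `c`, but in the subgraph on `p,
  -- a, b, u, v` no path that short joins them: `a` misses `v`, `b` misses `u`, `p` is two levels
  -- lower, and adjacent `u`, `v` would have equal down-neighbours.
  have hH := connected_induce_union_of_adj (connected_induce_union_of_adj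
    (connected_induce_singleton p) (T := {a, b}) (by
      rintro x (rfl | rfl)
      exacts [⟨p, rfl, hp.1⟩, ⟨p, rfl, hp'.1⟩])) (T := {u, v}) (by
      rintro x (rfl | rfl)
      exacts [⟨a, by simp, hau.1⟩, ⟨b, by simp, hbv.1⟩])
  obtain ⟨x, hx, hxv, hd⟩ := hG.exists_adj hH (z := u) (v := v) (by simp) (by simp)
    (by rintro rfl; exact hav hau)
  have hd2 : G.dist u v ≤ 2 := by
    have := hc.dist_triangle (u := u) (v := c) (w := v)
    rwa [dist_eq_one_iff_adj.2 hcv.1, dist_eq_one_iff_adj.2 hcu.1.symm] at this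
  rcases hx with (rfl | rfl | rfl) | rfl | rfl
  · have := hxv.dist_le_add_one hc r
    omega
  · exact hav ⟨hxv, by omega⟩
  · have h1 : G.dist u x ≠ 0 := fun h0 => by
      have := hc.dist_eq_zero_iff.1 h0
      subst this
      omega
    have h2 : G.Adj u x := dist_eq_one_iff_adj.1 (by omega)
    exact hbu ⟨h2.symm, by omega⟩
  · exact hav (downNeighbors_eq_of_adj hc hG hxv huv ▸ hau)
  · exact hxv.ne rfl

/-- A shortest path between non-adjacent vertices enters the one of higher level from below. -/
theorem exists_mem_downNeighbors_dist_eq {z v : V} (hzv : G.dist r z ≤ G.dist r v) (hne : z ≠ v)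
    (hadj : ¬ G.Adj z v) : ∃ x ∈ G.downNeighbors r v, G.dist z v = G.dist z x + 1 := by
  have hv0 : G.dist r v ≠ 0 := fun h0 => hne <| by
    rw [← hc.dist_eq_zero_iff.1 h0, ← hc.dist_eq_zero_iff.1 (show G.dist r z = 0 by omega)]
  -- The subgraph is the ball of all lower levels together with `v`, and with `z` if it is on the
  -- level of `v`. As `z` and `v` are not adjacent, the vertex before `v` lies in the ball.
  have hH := connected_induce_union_of_adj (hc.connected_induce_ball (r := r) (G.dist r v - 1))
    (T := {x | (x = z ∨ x = v) ∧ G.dist r x = G.dist r v}) (by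
      rintro x ⟨-, hx⟩
      obtain ⟨y, hy⟩ := hc.exists_mem_downNeighbors (show G.dist r x ≠ 0 by omega)
      have := hy.2
      exact ⟨y, by simp; omega, hy.1⟩)
  obtain ⟨x, hx, hxv, hd⟩ := hG.exists_adj hH (z := z) (v := v) (by simp; omega) (by simp) hne
  rcases hx with hx | ⟨rfl | rfl, -⟩
  · have := hxv.dist_le_add_one hc r
    simp at hx
    exact ⟨x, ⟨hxv, by omega⟩, hd⟩
  · exact absurd hxv hadj
  · exact absurd rfl hxv.ne

/-- Since `s` and `s'` have the same down-neighbours, a shortest path that enters `s'` from below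
can be led to `s` instead. If `z` is a neighbour of `s'` on the same level but not of `s`, then with
a common down-neighbour `p` the path `z, p, s, a` is induced and has length 3, although `z, s', a`
has length 2. -/
theorem dist_le_of_mem_downNeighbors {z a s s' : V} (hza : G.dist r z < G.dist r a)
    (hz : z ∉ G.downNeighbors r a) (hs : s ∈ G.downNeighbors r a)
    (hs' : s' ∈ G.downNeighbors r a) : G.dist z s ≤ G.dist z s' := by
  have hN := downNeighbors_eq_of_mem hc hG hs hs'
  have ls := hs.2
  have ls' := hs'.2
  have hzs : z ≠ s := by rintro rfl; exact hz hs
  have hzs' : z ≠ s' := by rintro rfl; exact hz hs'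
  by_cases hadj : G.Adj z s'
  · suffices h : G.Adj z s by rw [dist_eq_one_iff_adj.2 h, dist_eq_one_iff_adj.2 hadj]
    by_cases hl : G.dist r z = G.dist r s'
    · by_contra hzs1
      have hz0 : G.dist r z ≠ 0 := fun h0 => hzs' <| by
        rw [← hc.dist_eq_zero_iff.1 h0, ← hc.dist_eq_zero_iff.1 (show G.dist r s' = 0 by omega)]
      obtain ⟨p, hp⟩ := hc.exists_mem_downNeighbors hz0
      have hp' : p ∈ G.downNeighbors r s := hN ▸ downNeighbors_eq_of_adj hc hG hadj hl ▸ hp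
      have lp := hp.2
      have hH := connected_induce_union_of_adj (connected_induce_union_of_adj
        (connected_induce_singleton p) (T := {z, s}) (by
          rintro x (rfl | rfl)
          exacts [⟨p, rfl, hp.1⟩, ⟨p, rfl, hp'.1⟩])) (T := {a}) (by
          rintro x rfl
          exact ⟨s, by simp, hs.1⟩)
      obtain ⟨x, hx, hxa, hd⟩ := hG.exists_adj hH (z := z) (v := a) (by simp) (by simp)
        (by rintro rfl; omega)
      have hd2 : G.dist z a ≤ 2 := by
        have := hs'.1.dist_le_add_one hc z
        rwa [dist_eq_one_iff_adj.2 hadj] at this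
      rcases hx with (rfl | rfl | rfl) | rfl
      · have := hxa.dist_le_add_one hc r
        omega
      · exact hz ⟨hxa, by omega⟩
      · have := (hc.dist_eq_zero_iff (u := z) (v := x)).not.2 hzs
        exact hzs1 (dist_eq_one_iff_adj.1 (by omega))
      · exact hxa.ne rfl
    · have hd := hadj.dist_le_add_one hc r
      have : z ∈ G.downNeighbors r s' := ⟨hadj, by omega⟩
      rw [← hN] at this
      exact this.1
  · obtain ⟨x, hx, hd⟩ := exists_mem_downNeighbors_dist_eq hc hG (r := r) (by omega) hzs' hadj
    rw [← hN] at hx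
    have := hx.1.dist_le_add_one hc z
    omega

/-- For `z` on the level of `a` there are two cases. If the down-neighbours of `z` and `a` meet,
laminarity and `hza'` make `z` adjacent to all down-neighbours of `a`. If they are disjoint, a
shortest path enters `z` through a vertex one level lower, outside the down-neighbours of `a`, and
the case of lower vertices applies to it. -/
theorem dist_eq_of_mem_downNeighbors {z a s s' : V} (hza : G.dist r z ≤ G.dist r a)
    (hz : z ∉ G.downNeighbors r a)
    (hza' : G.dist r z = G.dist r a → ¬ G.downNeighbors r z ⊆ G.downNeighbors r a)
    (hs : s ∈ G.downNeighbors r a) (hs' : s' ∈ G.downNeighbors r a) :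
    G.dist z s = G.dist z s' := by
  suffices H : ∀ s s' : V, s ∈ G.downNeighbors r a → s' ∈ G.downNeighbors r a →
      G.dist z s ≤ G.dist z s' from (H s s' hs hs').antisymm (H s' s hs' hs)
  intro s s' hs hs'
  rcases hza.lt_or_eq with hlt | heq
  · exact dist_le_of_mem_downNeighbors hc hG hlt hz hs hs'
  by_cases hi : ∃ c, c ∈ G.downNeighbors r z ∧ c ∈ G.downNeighbors r a
  · obtain ⟨c, hcz, hca⟩ := hi
    rcases downNeighbors_subset_or_subset hc hG heq hcz hca with h | h
    · exact absurd h (hza' heq)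
    · rw [dist_eq_one_iff_adj.2 (h hs).1.symm, dist_eq_one_iff_adj.2 (h hs').1.symm]
  · push Not at hi
    have ls' := hs'.2
    obtain ⟨x, hx, hd⟩ := exists_mem_downNeighbors_dist_eq hc hG (r := r) (z := s') (v := z)
      (by omega) (by rintro rfl; omega) (fun h => hi s' ⟨h, by omega⟩ hs')
    have lx := hx.2
    have := dist_le_of_mem_downNeighbors hc hG (by omega) (hi x hx) hs hs'
    have := hx.1.dist_le_add_one hc s
    rw [dist_comm (u := s) (v := z), dist_comm (u := s) (v := x)] at this
    rw [dist_comm (u := s') (v := z), dist_comm (u := s') (v := x)] at hd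
    omega

/-- A shortest path from `z` enters `a` from below, and all down-neighbours of `a` are equally far
from `z`. -/
theorem dist_eq_add_one_of_mem_downNeighbors {z a s : V} (hza : G.dist r z ≤ G.dist r a)
    (hz : z ∉ G.downNeighbors r a)
    (hza' : G.dist r z = G.dist r a → ¬ G.downNeighbors r z ⊆ G.downNeighbors r a)
    (hs : s ∈ G.downNeighbors r a) : G.dist z a = G.dist z s + 1 := by
  obtain ⟨x, hx, hd⟩ := exists_mem_downNeighbors_dist_eq hc hG (r := r) hza
    (by rintro rfl; exact hza' rfl subset_rfl) (fun h => by
      rcases hza.lt_or_eq with hlt | heq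
      · have := h.dist_le_add_one hc r
        exact hz ⟨h, by omega⟩
      · exact hza' heq (downNeighbors_eq_of_adj hc hG h heq).subset)
  rw [hd, dist_eq_of_mem_downNeighbors hc hG hza hz hza' hx hs]

end DistanceHereditary

end SimpleGraph

/-! ### Eccentricities under contractions -/

namespace SimpleGraph

variable {V : Type*} [DecidableEq V] (G : SimpleGraph V)

/-- The eccentricity of `v` in the set `U`, without `v` itself, where each vertex `u` carries a
pendant path of length `w u`. -/
noncomputable def weightedEccent (U : Finset V) (w : V → ℕ) (v : V) : ℕ :=
  (U.erase v).sup fun u => G.dist v u + w u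

variable {G} {U : Finset V} {w : V → ℕ} {v : V}

theorem weightedEccent_le {k : ℕ} (h : ∀ u ∈ U, u ≠ v → G.dist v u + w u ≤ k) :
    G.weightedEccent U w v ≤ k :=
  Finset.sup_le fun u hu => h u (Finset.mem_of_mem_erase hu) (Finset.ne_of_mem_erase hu)

theorem le_weightedEccent {u : V} (hu : u ∈ U) (huv : u ≠ v) :
    G.dist v u + w u ≤ G.weightedEccent U w v :=
  Finset.le_sup (f := fun u => G.dist v u + w u) (Finset.mem_erase.2 ⟨huv, hu⟩)

theorem weightedEccent_mono {U' : Finset V} (h : U' ⊆ U) :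
    G.weightedEccent U' w v ≤ G.weightedEccent U w v :=
  weightedEccent_le fun _ hu huv => le_weightedEccent (h hu) huv

/-- Contraction of a module to a vertex of largest weight, seen from outside. -/
theorem weightedEccent_contract_of_notMem {M : Finset V} {t : V} (hM : M ⊆ U) (ht : t ∈ M)
    (hw : ∀ u ∈ M, w u ≤ w t) (hd : ∀ z ∈ U \ M, ∀ u ∈ M, G.dist z u = G.dist z t)
    (hvU : v ∈ U) (hv : v ∉ M) :
    G.weightedEccent U w v = G.weightedEccent (U \ M.erase t) w v := by
  refine le_antisymm (weightedEccent_le fun u hu huv => ?_)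
    (weightedEccent_mono Finset.sdiff_subset)
  by_cases huM : u ∈ M
  · rw [hd v (by simp [*]) u huM]
    exact (Nat.add_le_add_left (hw u huM) _).trans
      (le_weightedEccent (by simp [hM ht]) (by rintro rfl; exact hv ht))
  · exact le_weightedEccent (by simp [hu, huM]) huv

/-- Contraction of a module to a vertex of largest weight, seen from inside. -/
theorem weightedEccent_contract_of_mem {M : Finset V} {t : V} (hM : M ⊆ U) (ht : t ∈ M)
    (hd : ∀ z ∈ U \ M, ∀ u ∈ M, G.dist z u = G.dist z t) (hv : v ∈ M) :
    G.weightedEccent U w v =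
      max (G.weightedEccent (U \ M.erase t) w t) (G.weightedEccent M w v) := by
  refine le_antisymm (weightedEccent_le fun u hu huv => ?_)
    (max_le (weightedEccent_le fun u hu hut => ?_) (weightedEccent_mono hM))
  · by_cases huM : u ∈ M
    · exact le_max_of_le_right (le_weightedEccent huM huv)
    · rw [dist_comm, hd u (by simp [*]) v hv, dist_comm]
      exact le_max_of_le_left
        (le_weightedEccent (by simp [*]) (by rintro rfl; exact huM ht))
  · have huM : u ∉ M := by simp at hu; tauto
    rw [dist_comm, ← hd u (by simp at hu ⊢; tauto) v hv, dist_comm]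
    exact le_weightedEccent (by simp at hu; tauto) (by rintro rfl; exact huM hv)

/-- A vertex lighter than `t` contributes at most `w t + 1`, and `t` alone contributes that much.
The value is `w t + 2` exactly when some vertex of largest weight other than `u` is not adjacent to
`u`. Comparing two cardinalities detects this, so a scan of the neighbours of `u` is enough. -/
theorem weightedEccent_eq_add_ite {M : Finset V} {t u : V} [DecidableRel G.Adj] (ht : t ∈ M)
    (hu : u ∈ M) (hut : u ≠ t)
    (hw : ∀ x ∈ M, w x ≤ w t)
    (hd : ∀ x ∈ M, ∀ y ∈ M, x ≠ y → G.dist x y = if G.Adj x y then 1 else 2) :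
    G.weightedEccent M w u = w t + 1 +
      if (M.filter fun x => G.Adj u x ∧ w x = w t).card <
        (M.filter fun x => w x = w t).card - (if w u = w t then 1 else 0) then 1 else 0 := by
  have h1 : (M.filter fun x => w x = w t).card - (if w u = w t then 1 else 0) =
      ((M.erase u).filter fun x => w x = w t).card := by
    rw [Finset.filter_erase]
    split_ifs with h
    · rw [Finset.card_erase_of_mem (by simp [*])]
    · rw [Finset.erase_eq_of_notMem (by simp [*])]; simp
  have hsub : (M.filter fun x => G.Adj u x ∧ w x = w t) ⊆
      (M.erase u).filter fun x => w x = w t := by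
    intro x hx
    simp at hx ⊢
    exact ⟨⟨hx.2.1.ne', hx.1⟩, hx.2.2⟩
  rw [h1]
  split_ifs with h
  · obtain ⟨x, hx, hx'⟩ := Finset.exists_mem_notMem_of_card_lt_card h
    simp at hx hx'
    refine le_antisymm (weightedEccent_le fun y hy hyu => ?_) ?_
    · have := hw y hy
      rw [hd u hu y hy hyu.symm]
      split_ifs <;> omega
    · have := le_weightedEccent (G := G) (w := w) hx.1.2 hx.1.1
      rw [hd u hu x hx.1.2 (Ne.symm hx.1.1), if_neg fun h => hx' hx.1.2 h hx.2] at this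
      omega
  · have heq := Finset.eq_of_subset_of_card_le hsub (not_lt.1 h)
    refine le_antisymm (weightedEccent_le fun y hy hyu => ?_) ?_
    · have := hw y hy
      rw [hd u hu y hy hyu.symm]
      split_ifs with hadj
      · omega
      · have : w y ≠ w t := fun hyt => hadj <| by
          have : y ∈ (M.erase u).filter fun x => w x = w t := by simp [*]
          rw [← heq] at this
          simp at this
          exact this.2.1
        omega
    · have := le_weightedEccent (G := G) (w := w) ht hut.symm
      rw [hd u hu t ht hut] at this
      split_ifs at this <;> omega

/-! ### Absorbing a pendant vertex into the weight of its neighbour -/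

section pendant

variable {a y : V} (ha : a ∈ U) (hy : y ∈ U) (hay : a ≠ y)
  (hd : ∀ z ∈ U, z ≠ a → G.dist z a = G.dist z y + 1)

include ha hy hay hd

/-- From elsewhere, the path at `a` is indistinguishable from a path of length `w a + 1` at `y`. -/
theorem weightedEccent_pendant_of_ne (hvU : v ∈ U) (hva : v ≠ a) (hvy : v ≠ y) :
    G.weightedEccent U w v =
      G.weightedEccent (U.erase a) (Function.update w y (max (w y) (w a + 1))) v := by
  refine le_antisymm (weightedEccent_le fun u hu huv => ?_) (weightedEccent_le fun u hu huv => ?_)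
  · by_cases hua : u = a
    · subst hua
      have := le_weightedEccent (G := G) (U := U.erase u)
        (w := Function.update w y (max (w y) (w u + 1))) (v := v) (u := y) (by simp [*, hay.symm])
        hvy.symm
      rw [Function.update_self] at this
      rw [hd v hvU hva]
      omega
    · have := le_weightedEccent (G := G) (U := U.erase a)
        (w := Function.update w y (max (w y) (w a + 1))) (v := v) (u := u) (by simp [*]) huv
      refine le_trans (Nat.add_le_add_left ?_ _) this
      by_cases huy : u = y
      · subst huy; simp
      · simp [huy]
  · simp at hu
    by_cases huy : u = y
    · subst huy
      have h1 := le_weightedEccent (G := G) (w := w) hu.2 huv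
      have h2 := le_weightedEccent (G := G) (w := w) ha hva.symm
      rw [hd v hvU hva] at h2
      rw [Function.update_self]
      omega
    · rw [Function.update_of_ne huy]
      exact le_weightedEccent hu.2 huv

/-- The new weight of `y` is invisible to `y` itself, so the contribution of `a` has to be restored.
-/
theorem weightedEccent_pendant_right :
    G.weightedEccent U w y =
      max (G.weightedEccent (U.erase a) (Function.update w y (max (w y) (w a + 1))) y)
        (w a + 1) := by
  have hya : G.dist y a = 1 := by simpa using hd y hy hay.symm
  refine le_antisymm (weightedEccent_le fun u hu huv => ?_)
    (max_le (weightedEccent_le fun u hu huv => ?_) ?_)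
  · by_cases hua : u = a
    · subst hua
      rw [hya]
      omega
    · have := le_weightedEccent (G := G) (U := U.erase a)
        (w := Function.update w y (max (w y) (w a + 1))) (v := y) (u := u) (by simp [*]) huv
      rw [Function.update_of_ne huv] at this
      omega
  · rw [Function.update_of_ne huv]
    exact le_weightedEccent (Finset.mem_of_mem_erase hu) huv
  · have := le_weightedEccent (G := G) (w := w) ha hay
    omega

-- From `a` everything is seen through `y`, one step further away. The path at `y` is missing from
-- the value at `y` and enters with its old length: the new weight may stem from the path at `a`
-- itself.
omit ha in
theorem weightedEccent_pendant_left :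
    G.weightedEccent U w a =
      max (G.weightedEccent (U.erase a) (Function.update w y (max (w y) (w a + 1))) y + 1)
        (w y + 1) := by
  have hya : G.dist y a = 1 := by simpa using hd y hy hay.symm
  refine le_antisymm (weightedEccent_le fun u hu hua => ?_) (max_le ?_ ?_)
  · by_cases huy : u = y
    · subst huy
      rw [dist_comm, hya]
      omega
    · have := le_weightedEccent (G := G) (U := U.erase a)
        (w := Function.update w y (max (w y) (w a + 1))) (v := y) (u := u) (by simp [*]) huy
      rw [Function.update_of_ne huy] at this
      rw [dist_comm, hd u hu hua, dist_comm]
      omega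
  · have h1 := le_weightedEccent (G := G) (w := w) hy hay.symm
    rw [dist_comm, hya] at h1
    suffices h : G.weightedEccent (U.erase a) (Function.update w y (max (w y) (w a + 1))) y ≤
        G.weightedEccent U w a - 1 by omega
    refine weightedEccent_le fun u hu huy => ?_
    rw [Function.update_of_ne huy]
    have h2 := le_weightedEccent (G := G) (w := w) (Finset.mem_of_mem_erase hu)
      (Finset.ne_of_mem_erase hu)
    rw [dist_comm, hd u (Finset.mem_of_mem_erase hu) (Finset.ne_of_mem_erase hu), dist_comm] at h2
    omega
  · have h1 := le_weightedEccent (G := G) (w := w) hy hay.symm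
    rw [dist_comm, hya] at h1
    omega

end pendant

/-- The instruction to set the value at `target` to the value at `source` plus `offset`, or to
`value` if this is larger. -/
structure Entry (V : Type*) where
  target : V
  source : V
  offset : ℕ
  value : ℕ

/-- Execute an instruction. -/
def Entry.apply (e : Entry V) (E : V → ℕ) : V → ℕ :=
  Function.update E e.target (max (E e.source + e.offset) e.value)

/-- Execute a list of instructions, the last one first. -/
def replay (L : List (Entry V)) (E : V → ℕ) : V → ℕ := L.foldr Entry.apply E

@[simp] theorem replay_append (L L' : List (Entry V)) (E : V → ℕ) :
    replay (L ++ L') E = replay L (replay L' E) := by simp [replay]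

/-- The entries for the contraction of the vertices of `l` and of `t` to `t`. -/
noncomputable def contractEntries (G : SimpleGraph V) (M : Finset V) (w : V → ℕ) (t : V)
    (l : List V) : List (Entry V) :=
  ⟨t, t, 0, G.weightedEccent M w t⟩ :: l.map fun u => ⟨u, t, 0, G.weightedEccent M w u⟩

/-- The entry of `t` stands first and is executed last, so all others still read the value at `t`
from before the contraction is undone. -/
theorem replay_contractEntries {M : Finset V} {t : V} {l : List V} (hl : t ∉ l)
    (E : V → ℕ) (v : V) :
    replay (contractEntries G M w t l) E v =
      if v = t ∨ v ∈ l then max (E t) (G.weightedEccent M w v) else E v := by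
  have key : ∀ v, replay (l.map fun u => ⟨u, t, 0, G.weightedEccent M w u⟩) E v =
      if v ∈ l then max (E t) (G.weightedEccent M w v) else E v := by
    induction l with
    | nil => simp [replay]
    | cons x l ih =>
      intro v
      simp only [List.mem_cons, not_or] at hl
      specialize ih hl.2
      have ht : replay (l.map fun u => ⟨u, t, 0, G.weightedEccent M w u⟩) E t = E t := by
        rw [ih, if_neg hl.2]
      simp only [replay, List.map_cons, List.foldr_cons] at ih ht ⊢
      rw [Entry.apply]
      by_cases hv : v = x
      · subst hv
        simp [ht]
      · simp [hv, ih]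
  have ht := key t
  rw [if_neg hl] at ht
  simp only [replay, contractEntries, List.foldr_cons] at key ht ⊢
  rw [Entry.apply]
  by_cases hv : v = t
  · subst hv
    simp [ht]
  · simp [hv, key]

variable (G) in
/-- `E` holds the weighted eccentricities on `U`. -/
def IsEccentOn (U : Finset V) (w : V → ℕ) (E : V → ℕ) : Prop :=
  ∀ v ∈ U, E v = G.weightedEccent U w v

variable (G) in
/-- The entries of `L` lead from the weighted eccentricities on `U` to the eccentricities. -/
def IsLog [Fintype V] (L : List (Entry V)) (U : Finset V) (w : V → ℕ) : Prop :=
  ∀ E, G.IsEccentOn U w E → G.IsEccentOn Finset.univ 0 (replay L E)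

theorem IsLog.append [Fintype V] {L L' : List (Entry V)} {U' : Finset V} {w' : V → ℕ}
    (hL : G.IsLog L U w) (hL' : ∀ E, G.IsEccentOn U' w' E → G.IsEccentOn U w (replay L' E)) :
    G.IsLog (L ++ L') U' w' := fun E hE => by
  rw [replay_append]
  exact hL _ (hL' E hE)

theorem IsLog.contract [Fintype V] {L : List (Entry V)} (hL : G.IsLog L U w) {M : Finset V} {t : V}
    {l : List V} (hM : M ⊆ U) (ht : t ∈ M)
    (hw : ∀ u ∈ M, w u ≤ w t) (hd : ∀ z ∈ U \ M, ∀ u ∈ M, G.dist z u = G.dist z t)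
    (hl : ∀ v, v ∈ l ↔ v ∈ M.erase t) :
    G.IsLog (L ++ contractEntries G M w t l) (U \ M.erase t) w := by
  refine hL.append fun E hE v hv => ?_
  rw [replay_contractEntries (by simp [hl])]
  by_cases hvM : v ∈ M
  · rw [if_pos (by simp [hl, hvM]; tauto), hE t (by simp [hM ht]),
      weightedEccent_contract_of_mem hM ht hd hvM]
  · rw [if_neg (by simp [hl, hvM]; rintro rfl; exact hvM ht), hE v (by simp [hv, hvM]),
      weightedEccent_contract_of_notMem hM ht hw hd hv hvM]

/-- The order of the two entries matters: that of `a` is executed first, because it needs the value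
at `y` before the other entry raises it. -/
theorem IsLog.pendant [Fintype V] {L : List (Entry V)} (hL : G.IsLog L U w) {a y : V} (ha : a ∈ U)
    (hy : y ∈ U) (hay : a ≠ y) (hd : ∀ z ∈ U, z ≠ a → G.dist z a = G.dist z y + 1) :
    G.IsLog (L ++ [⟨y, y, 0, w a + 1⟩, ⟨a, y, 1, w y + 1⟩]) (U.erase a)
      (Function.update w y (max (w y) (w a + 1))) := by
  refine hL.append fun E hE v hv => ?_
  simp only [replay, List.foldr_cons, List.foldr_nil, Entry.apply, Function.update_apply]
  by_cases hvy : v = y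
  · subst hvy
    simp only [↓reduceIte, hay.symm]
    rw [hE v (Finset.mem_erase.2 ⟨hay.symm, hy⟩), weightedEccent_pendant_right ha hy hay hd]
    rfl
  by_cases hva : v = a
  · subst hva
    simp only [↓reduceIte, hay]
    rw [hE y (Finset.mem_erase.2 ⟨hay.symm, hy⟩), weightedEccent_pendant_left hy hay hd]
  · simp only [↓reduceIte, hvy, hva]
    rw [hE v (by simp [*]), weightedEccent_pendant_of_ne ha hy hay hd hv hva hvy]

theorem IsEccentOn.eq_eccent [Fintype V] (hc : G.Connected) {E : V → ℕ}
    (h : G.IsEccentOn Finset.univ 0 E) (v : V) : (E v : ℕ∞) = G.eccent v := by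
  rw [h v (Finset.mem_univ v)]
  have hed : ∀ u, G.edist v u = G.dist v u := fun u =>
    (hc.preconnected v u).coe_dist_eq_edist.symm
  refine le_antisymm ?_ ?_
  -- The supremum is attained, possibly at `v` itself when the graph has one vertex: if all
  -- distances were smaller, the bound could be lowered by 1.
  · obtain ⟨u, hu⟩ : ∃ u, G.weightedEccent Finset.univ 0 v ≤ G.dist v u := by
      by_contra! h
      have hlt : G.weightedEccent Finset.univ 0 v ≤ G.weightedEccent Finset.univ 0 v - 1 :=
        weightedEccent_le fun u _ _ => by
          have := h u
          simp
          omega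
      have := h v
      omega
    calc (G.weightedEccent Finset.univ 0 v : ℕ∞) ≤ G.dist v u := by exact_mod_cast hu
      _ = G.edist v u := (hed u).symm
      _ ≤ _ := edist_le_eccent
  · refine (eccent_le_iff _ _).2 fun u => ?_
    rw [hed]
    by_cases huv : u = v
    · subst huv; simp
    · exact_mod_cast le_weightedEccent (w := 0) (Finset.mem_univ u) huv

/-! ### Modules below and around a vertex of highest level with minimal down-neighbours -/

section levels

variable {r : V} (hc : G.Connected) (hG : IsDistanceHereditary G)
  (hlev : ∀ z ∈ U, G.dist r z ≤ G.dist r v)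
  (hmin : ∀ z ∈ U, G.dist r z = G.dist r v → G.downNeighbors r z ⊆ G.downNeighbors r v →
    G.downNeighbors r z = G.downNeighbors r v)

omit [DecidableEq V] in
theorem dist_eq_ite_of_adj (hc : G.Connected) [DecidableRel G.Adj] {x y c : V} (hx : G.Adj c x)
    (hy : G.Adj c y) (hxy : x ≠ y) : G.dist x y = if G.Adj x y then 1 else 2 := by
  split_ifs with h
  · exact dist_eq_one_iff_adj.2 h
  · have h0 := hc.dist_eq_zero_iff (u := x) (v := y)
    have h1 := dist_eq_one_iff_adj (G := G) (u := x) (v := y)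
    have h2 := hy.dist_le_add_one hc x
    rw [dist_eq_one_iff_adj.2 hx.symm] at h2
    have h0' := h0.not.2 hxy
    have h1' := h1.not.2 h
    omega

include hc hG hlev hmin

-- If `z` is on the level of `v` with down-neighbours among those of `v`, then `hmin` makes the two
-- sets equal and both distances are 1; all other `z` fall under `dist_eq_of_mem_downNeighbors`.
omit [DecidableEq V] in
theorem dist_eq_of_mem_downNeighbors_of_min {z s s' : V} (hz : z ∈ U)
    (hzv : z ∉ G.downNeighbors r v) (hs : s ∈ G.downNeighbors r v)
    (hs' : s' ∈ G.downNeighbors r v) : G.dist z s = G.dist z s' := by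
  by_cases h : G.dist r z = G.dist r v ∧ G.downNeighbors r z ⊆ G.downNeighbors r v
  · have hN := hmin z hz h.1 h.2
    rw [← hN] at hs hs'
    rw [dist_eq_one_iff_adj.2 hs.1.symm, dist_eq_one_iff_adj.2 hs'.1.symm]
  · exact dist_eq_of_mem_downNeighbors hc hG (hlev z hz) hzv (by tauto) hs hs'

-- Here `a` becomes pendant: `hzs` expresses that the other down-neighbours have been contracted to
-- `s`. For `z = s` the distances are 1 and 0.
omit [DecidableEq V] in
theorem dist_eq_add_one_of_min {z a s : V} (hz : z ∈ U)
    (hzv : ¬ (G.dist r z = G.dist r v ∧ G.downNeighbors r z = G.downNeighbors r v))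
    (hzs : z ∈ G.downNeighbors r v → z = s) (ha : G.dist r a = G.dist r v)
    (haN : G.downNeighbors r a = G.downNeighbors r v) (hs : s ∈ G.downNeighbors r v) :
    G.dist z a = G.dist z s + 1 := by
  rw [← ha, ← haN] at hzv
  rw [← haN] at hzs hs
  by_cases hza : z ∈ G.downNeighbors r a
  · rw [hzs hza, dist_self, dist_eq_one_iff_adj.2 hs.1]
  · exact dist_eq_add_one_of_mem_downNeighbors hc hG (ha ▸ hlev z hz) hza
      (fun h h' => hzv ⟨h, haN ▸ hmin z hz (h.trans ha) (haN ▸ h')⟩) hs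

-- For `z` outside the down-neighbours both distances exceed that to an arbitrary down-neighbour `s`
-- by 1; `s` need not be among the remaining vertices.
omit [DecidableEq V] in
theorem dist_eq_of_min {z a a' : V} (hz : z ∈ U)
    (hzv : ¬ (G.dist r z = G.dist r v ∧ G.downNeighbors r z = G.downNeighbors r v))
    (ha : G.dist r a = G.dist r v) (haN : G.downNeighbors r a = G.downNeighbors r v)
    (ha' : G.dist r a' = G.dist r v) (haN' : G.downNeighbors r a' = G.downNeighbors r v)
    (h0 : G.dist r v ≠ 0) : G.dist z a = G.dist z a' := by
  by_cases hzN : z ∈ G.downNeighbors r v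
  · have h1 := haN ▸ hzN
    have h2 := haN' ▸ hzN
    rw [dist_eq_one_iff_adj.2 h1.1, dist_eq_one_iff_adj.2 h2.1]
  · obtain ⟨s, hs⟩ := hc.exists_mem_downNeighbors h0
    rw [dist_eq_add_one_of_min hc hG hlev hmin hz hzv (fun h => absurd h hzN) ha haN hs,
      dist_eq_add_one_of_min hc hG hlev hmin hz hzv (fun h => absurd h hzN) ha' haN' hs]

end levels

end SimpleGraph

/-! ### The program -/

namespace RAM

open Program SimpleGraph

/-- The entries of the array `a` at the vertices of a graph. -/
def State.read {n : ℕ} (s : State) (a : ℕ) : Fin n → ℕ := fun v => s.arr a v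

theorem State.read_apply {n : ℕ} (s : State) (a : ℕ) (v : Fin n) : s.read a v = s.arr a v := rfl

@[simp] theorem State.read_setVar {n : ℕ} (s : State) (a x k : ℕ) :
    ((s.setVar x k).read a : Fin n → ℕ) = s.read a := rfl

@[simp] theorem State.read_setArr {n : ℕ} (s : State) (a b k : ℕ) (v : Fin n) :
    ((s.setArr b v k).read a : Fin n → ℕ) =
      if a = b then Function.update (s.read b) v k else s.read a := by
  ext u
  simp only [State.read, State.setArr_arr]
  split_ifs with h <;> simp [Function.update_apply, Fin.ext_iff, State.read]

theorem State.read_setArr_of_ne {n : ℕ} (s : State) (a b i k : ℕ) (h : a ≠ b) :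
    ((s.setArr b i k).read a : Fin n → ℕ) = s.read a := by
  ext u
  simp [State.read, h]

/-- The entries of the array `f` from the index `0` on are the values of `g` on the list `l`. -/
def Holds {α : Type*} (f : ℕ → ℕ) (g : α → ℕ) (l : List α) : Prop :=
  ∀ (j : ℕ) (x : α), l[j]? = some x → f j = g x

theorem Holds.nil {α : Type*} {f : ℕ → ℕ} {g : α → ℕ} : Holds f g [] := by
  intro j x hj
  simp at hj

theorem Holds.push {α : Type*} {f : ℕ → ℕ} {g : α → ℕ} {l : List α} (h : Holds f g l) (x : α) :
    Holds (Function.update f l.length (g x)) g (l ++ [x]) := by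
  intro j y hj
  rcases lt_or_ge j l.length with h1 | h1
  · rw [List.getElem?_append_left h1] at hj
    rw [Function.update_of_ne h1.ne, h j y hj]
  · rw [List.getElem?_append_right h1] at hj
    have := List.getElem?_eq_some_iff.1 hj
    simp at this
    obtain ⟨h2, rfl⟩ := this
    obtain rfl : j = l.length := by omega
    simp

/-- Each array of the log sees one field only, so the three arrays of the other fields survive when
a placeholder value is replaced. -/
theorem Holds.congr {α : Type*} {f : ℕ → ℕ} {g : α → ℕ} {l l' : List α} (h : Holds f g l)
    (hl : l.map g = l'.map g) : Holds f g l' := by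
  intro j y hj
  have h1 : (l.map g)[j]? = some (g y) := by rw [hl, List.getElem?_map, hj]; rfl
  rw [List.getElem?_map, Option.map_eq_some_iff] at h1
  obtain ⟨x, hx, hxy⟩ := h1
  rw [h j x hx, hxy]

theorem Holds.replace {α : Type*} {f : ℕ → ℕ} {g : α → ℕ} {l l' : List α} {x : α}
    (h : Holds f g (l ++ x :: l')) (y : α) :
    Holds (Function.update f l.length (g y)) g (l ++ y :: l') := by
  intro j z hj
  rcases eq_or_ne j l.length with rfl | hne
  · simp at hj
    rw [Function.update_self, hj]
  · rw [Function.update_of_ne hne]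
    refine h j z ?_
    rw [← hj, List.getElem?_append, List.getElem?_append]
    split_ifs with h1
    · rfl
    · rw [List.getElem?_cons, List.getElem?_cons, if_neg (by omega), if_neg (by omega)]

/-- Run `P` with `u` set to the entries of the array `a` with indices from `lo` to `hi - 1`. -/
def Program.forSeg (a i e u : ℕ) (lo hi : Expr) (P : Program) : Program :=
  .seq (.assign i lo) (.seq (.assign e hi)
    (.forUpTo i e (.seq (.assign u (.get a (.var i))) P)))

/-- The list `l` exists in the proof only; the machine sees the values `f x`. The constant 11 is 8
for the loop and 3 for loading the entry. -/
theorem wp_forSeg {α : Type*} {W a i e u : ℕ} {lo hi : Expr} {P : Program} {s : State}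
    (l : List α) (f : α → ℕ) (k : ℕ) (I : List α → State → Prop) (T : α → ℕ)
    (hlo : lo.eval s = k) (hhi : hi.eval (s.setVar i k) = k + l.length)
    (harr : ∀ j x, l[j]? = some x → s.arr a (k + j) = f x)
    (hW : k + l.length ≤ W) (hf : ∀ x ∈ l, f x ≤ W)
    (hvar : e ≠ i ∧ u ≠ i ∧ u ≠ e ∧ i ∉ P.vars ∧ e ∉ P.vars ∧ a ∉ P.arrs)
    (h0 : ∀ x y, I [] ((s.setVar i x).setVar e y))
    (hstep : ∀ p x q s', l = p ++ x :: q → s'.var i = k + p.length →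
      Frame (.forSeg a i e u lo hi P) s s' → I p s' →
      wp W P (fun t s'' => t ≤ T x ∧ ∀ j, I (p ++ [x]) (s''.setVar i j)) (s'.setVar u (f x))) :
    wp W (.forSeg a i e u lo hi P) (fun t s' => I l s' ∧ Frame (.forSeg a i e u lo hi P) s s' ∧
      t ≤ (l.map fun x => T x + 11).sum + (lo.cost + hi.cost + 6)) s := by
  obtain ⟨hei, hui, hue, hi', he', ha'⟩ := hvar
  have hfr : ∀ s', Frame (.forUpTo i e (.seq (.assign u (.get a (.var i))) P))
      ((s.setVar i k).setVar e (k + l.length)) s' → Frame (.forSeg a i e u lo hi P) s s' := by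
    refine fun s' h => ⟨fun x hx => ?_, fun x hx => ?_⟩
    · simp only [forSeg, Program.vars, List.cons_append, List.nil_append, List.mem_cons,
        not_or] at hx
      rw [h.var x hx.2.2]
      simp [hx.1, hx.2.1]
    · simp only [forSeg, Program.arrs, List.nil_append] at hx
      rw [h.arr x hx]
      rfl
  rw [forSeg, wp_seq, wp_assign, hlo]
  refine ⟨by omega, ?_⟩
  rw [wp_seq, wp_assign, hhi]
  refine ⟨hW, ?_⟩
  refine wp_mono (wp_forUpTo l k I (fun x => T x + 3) hW (by simp [hei.symm]) (by simp) hei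
    (by simp [Program.vars, hui.symm, hi']) (by simp [Program.vars, hue.symm, he']) (h0 _ _) ?_) ?_
  · intro p x q s' hl hik hF hI
    have hx : s'.arr a (k + p.length) = f x := by
      rw [← harr p.length x (by simp [hl]), hF.arr a (by simpa [forUpTo, Program.arrs] using ha')]
      rfl
    rw [wp_seq, wp_assign]
    simp only [Expr.eval, Expr.cost, hik, hx]
    refine ⟨hf x (by simp [hl]), wp_mono (hstep p x q s' hl hik (hfr s' hF) hI) ?_⟩
    rintro t s'' ⟨ht, hI'⟩
    exact ⟨by omega, hI' _⟩
  · rintro t s' ⟨hI, hF, ht⟩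
    refine ⟨hI, hfr s' hF, ?_⟩
    simp only [add_assoc, Nat.reduceAdd] at ht ⊢
    omega

/-- The list of neighbours of each vertex, as given by the arrays `st` and `ad`. -/
structure Input {n : ℕ} (G : SimpleGraph (Fin n)) (st ad : ℕ → ℕ) (nb : Fin n → List (Fin n)) :
    Prop where
  start : ∀ v : Fin n, st (v + 1) = st v + (nb v).length
  get : ∀ (v : Fin n) (j : ℕ) (x : Fin n), (nb v)[j]? = some x → ad (st v + j) = (x : ℕ)
  mem : ∀ v u, u ∈ nb v ↔ G.Adj v u
  nodup : ∀ v : Fin n, (nb v).Nodup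
  bound : ∀ v : Fin n, st v + (nb v).length ≤ 2 * G.edgeSet.ncard
  sum : ∑ v : Fin n, (nb v).length = 2 * G.edgeSet.ncard

theorem HoldsGraph.exists_input {n : ℕ} {G : SimpleGraph (Fin n)} {s : State}
    (h : HoldsGraph G s) : ∃ nb, Input G (s.arr 0) (s.arr 1) nb := by
  classical
  have hlt : ∀ (v : Fin n) (j : ℕ), j < s.arr 0 (v + 1) - s.arr 0 v →
      ∃ hu : s.arr 1 (s.arr 0 v + j) < n, G.Adj v ⟨s.arr 1 (s.arr 0 v + j), hu⟩ := fun v j hj =>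
    (h.list v).mapsTo ⟨by omega, by omega⟩
  let nb : Fin n → List (Fin n) := fun v =>
    List.ofFn fun j : Fin (s.arr 0 (v + 1) - s.arr 0 v) => ⟨_, (hlt v j j.2).1⟩
  have hlen : ∀ v, (nb v).length = s.arr 0 (v + 1) - s.arr 0 v := fun v => by simp [nb]
  have hstart : ∀ v : Fin n, s.arr 0 (v + 1) = s.arr 0 v + (nb v).length := fun v => by
    have := h.mono v
    have := hlen v
    omega
  have hmem : ∀ v u, u ∈ nb v ↔ G.Adj v u := by
    intro v u
    simp only [nb, List.mem_ofFn]
    constructor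
    · rintro ⟨j, rfl⟩
      exact (hlt v j j.2).2
    · intro hvu
      obtain ⟨i, hi, hiu⟩ := (h.list v).surjOn ⟨u.2, hvu⟩
      simp only [Set.mem_Ico] at hi
      exact ⟨⟨i - s.arr 0 v, by omega⟩, Fin.ext (by simp [← hiu, Nat.add_sub_cancel' hi.1])⟩
  have hnodup : ∀ v : Fin n, (nb v).Nodup := by
    intro v
    refine List.nodup_ofFn_ofInjective fun i j hij => ?_
    have := (h.list v).injOn (x₁ := s.arr 0 v + i) (x₂ := s.arr 0 v + j) ⟨by omega, by omega⟩
      ⟨by omega, by omega⟩ (by simpa using hij)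
    exact Fin.ext (by omega)
  have hdeg : ∀ v, (nb v).length = G.degree v := by
    intro v
    rw [← List.toFinset_card_of_nodup (hnodup v), ← SimpleGraph.card_neighborFinset_eq_degree]
    congr 1
    ext u
    simp [hmem]
  have hsum : ∑ v : Fin n, (nb v).length = 2 * G.edgeSet.ncard := by
    simp only [hdeg]
    rw [SimpleGraph.sum_degrees_eq_twice_card_edges, ← Set.ncard_coe_finset,
      SimpleGraph.coe_edgeFinset]
  -- The boundaries are partial sums of degrees, which bounds every index into the adjacency array
  -- by `2 * m`.
  have hacc : ∀ k, ∀ hk : k ≤ n, s.arr 0 k = ∑ i : Fin k, (nb (i.castLE hk)).length := by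
    intro k
    induction k with
    | zero => intro _; simp [h.start]
    | succ k ih =>
      intro hk
      rw [Fin.sum_univ_castSucc]
      have := hstart ⟨k, hk⟩
      simp only at this
      rw [this, ih (by omega)]
      rfl
  have hn := hacc n le_rfl
  have hmono : ∀ k, k ≤ n → ∀ j, j ≤ k → s.arr 0 j ≤ s.arr 0 k := by
    intro k
    induction k with
    | zero => intro _ j hj; simp [Nat.le_zero.1 hj]
    | succ k ih =>
      intro hk j hj
      rcases hj.lt_or_eq with h1 | rfl
      · exact (ih (by omega) j (by omega)).trans (h.mono ⟨k, hk⟩)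
      · exact le_rfl
  refine ⟨nb, hstart, ?_, hmem, hnodup, ?_, hsum⟩
  · intro v j x hx
    simp only [nb, List.getElem?_ofFn] at hx
    split_ifs at hx with hj
    simp only [Option.some.injEq] at hx
    rw [← hx]
  · intro v
    rw [← hstart, ← hsum]
    exact (hmono n le_rfl _ v.2).trans hn.le

/-! ### Names of variables and arrays -/

notation "xHead" => (1 : ℕ)
notation "xTail" => (2 : ℕ)
notation "xI" => (3 : ℕ)
notation "xE" => (4 : ℕ)
notation "xU" => (5 : ℕ)
notation "xV" => (6 : ℕ)
notation "xJ" => (7 : ℕ)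
notation "xF" => (8 : ℕ)
notation "xKey" => (9 : ℕ)
notation "xCur" => (10 : ℕ)
notation "xPar" => (11 : ℕ)
notation "xSize" => (12 : ℕ)
notation "xTop" => (13 : ℕ)
notation "xCount" => (14 : ℕ)
notation "xAdj" => (15 : ℕ)
notation "xFlag" => (16 : ℕ)
notation "xVal" => (17 : ℕ)
notation "xBase" => (18 : ℕ)
notation "xLog" => (19 : ℕ)
notation "xMax" => (20 : ℕ)
notation "xLow" => (21 : ℕ)
notation "aOut" => (2 : ℕ)
notation "aQueue" => (3 : ℕ)
notation "aDepth" => (4 : ℕ)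
notation "aPar" => (5 : ℕ)
notation "aStart" => (6 : ℕ)
notation "aBucket" => (7 : ℕ)
notation "aNext" => (8 : ℕ)
notation "aDead" => (9 : ℕ)
notation "aWeight" => (10 : ℕ)
notation "aList" => (11 : ℕ)
notation "aMark" => (12 : ℕ)
notation "aTarget" => (13 : ℕ)
notation "aSource" => (14 : ℕ)
notation "aOffset" => (15 : ℕ)
notation "aValue" => (16 : ℕ)

/-- Run `P` with `xU` set to the neighbours of the vertex in the variable `x`. -/
def Program.scan (x : ℕ) (P : Program) : Program :=
  .forSeg 1 xI xE xU (.get 0 (.var x)) (.get 0 (.add (.var x) (.const 1))) P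

section

variable {n : ℕ} {G : SimpleGraph (Fin n)} {st ad : ℕ → ℕ} {nb : Fin n → List (Fin n)}

/-- All time bounds come down to this one: a scan costs a constant times the degree. -/
theorem wp_scan (hIn : Input G st ad nb) {W x : ℕ} {P : Program} {s : State} (v : Fin n)
    (I : List (Fin n) → State → Prop) (T : ℕ) (hs0 : s.arr 0 = st) (hs1 : s.arr 1 = ad)
    (hv : s.var x = v) (hvar : x ≠ xI ∧ xI ∉ P.vars ∧ xE ∉ P.vars ∧ 1 ∉ P.arrs)
    (hW : n + 2 * G.edgeSet.ncard ≤ W)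
    (h0 : ∀ i j, I [] ((s.setVar xI i).setVar xE j))
    (hstep : ∀ (p : List (Fin n)) (u : Fin n) (q : List (Fin n)) (s' : State),
      nb v = p ++ u :: q → Frame (.scan x P) s s' → I p s' →
      wp W P (fun t s'' => t ≤ T ∧ ∀ j, I (p ++ [u]) (s''.setVar xI j)) (s'.setVar xU u)) :
    wp W (.scan x P) (fun t s' => I (nb v) s' ∧ Frame (.scan x P) s s' ∧
      t ≤ (T + 11) * (nb v).length + 12) s := by
  refine wp_mono (wp_forSeg (nb v) (fun u => (u : ℕ)) (st v) I (fun _ => T) (by simp [Expr.eval, *])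
    (by simp [Expr.eval, hIn.start, *]) (fun j u hj => by rw [hs1, hIn.get v j u hj])
    (by have := hIn.bound v; omega) (fun u _ => by have := u.2; omega) (by simp; tauto) h0
    (fun p u q s' hl _ hF hI => hstep p u q s' hl hF hI)) ?_
  rintro t s' ⟨hI, hF, ht⟩
  refine ⟨hI, hF, ?_⟩
  simp only [List.map_const', List.sum_replicate, Expr.cost, smul_eq_mul, mul_comm] at ht ⊢
  omega

/-! ### Breadth-first search -/

/-- Visit the neighbour `xU` of the first vertex `xV` of the queue. -/
def visit : Program :=
  .branch (.eq (.get aDepth (.var xU)) (.const 0))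
    (.seq (.store aDepth (.var xU) (.add (.get aDepth (.var xV)) (.const 1)))
    (.seq (.store aPar (.var xU) (.var xHead))
    (.seq (.store aQueue (.var xTail) (.var xU))
    (.assign xTail (.add (.var xTail) (.const 1))))))
    .skip

/-- Breadth-first search from the vertex `0`. The depth of this vertex is `1`. -/
def bfs : Program :=
  .seq (.store aDepth (.const 0) (.const 1))
  (.seq (.assign xTail (.const 1))
  (.loop (.lt (.var xHead) (.var xTail))
    (.seq (.assign xV (.get aQueue (.var xHead)))
    (.seq (.scan xV visit)
    (.assign xHead (.add (.var xHead) (.const 1)))))))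

/-- The state of a breadth-first search from `r` with queue `q`, after the neighbours of the first
`h` vertices have been visited: `par v` is the position of the parent of `v`. -/
structure IsBFS (G : SimpleGraph (Fin n)) (r : Fin n) (q : List (Fin n)) (dep par : Fin n → ℕ)
    (h : ℕ) : Prop where
  nodup : q.Nodup
  zero : q[0]? = some r
  dep_zero : ∀ v, dep v = 0 ↔ v ∉ q
  dep_root : dep r = 1
  parent : ∀ j v, q[j]? = some v → 0 < j → par v < j ∧ par v ≤ h ∧
    ∃ p, q[par v]? = some p ∧ G.Adj p v ∧ dep v = dep p + 1
  par_le : ∀ i p v, q[i]? = some p → v ∈ q → v ≠ r → G.Adj p v → par v ≤ i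
  mono : ∀ i j u v, 0 < i → i ≤ j → q[i]? = some u → q[j]? = some v → par u ≤ par v
  closed : ∀ i p u, i < h → q[i]? = some p → G.Adj p u → u ∈ q

namespace IsBFS

variable {r : Fin n} {q : List (Fin n)} {dep par : Fin n → ℕ} {h : ℕ}

theorem pos_of_ne (hB : IsBFS G r q dep par h) {j : ℕ} {v : Fin n} (hj : q[j]? = some v)
    (hv : v ≠ r) : 0 < j := by
  rcases Nat.eq_zero_or_pos j with rfl | hj'
  · rw [hB.zero] at hj
    simp at hj
    exact absurd hj.symm hv
  · exact hj'

theorem dep_le (hB : IsBFS G r q dep par h) {j : ℕ} {v : Fin n} (hj : q[j]? = some v) :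
    dep v ≤ j + 1 := by
  induction j using Nat.strong_induction_on generalizing v with
  | _ j ih =>
    rcases Nat.eq_zero_or_pos j with rfl | hj0
    · rw [hB.zero] at hj
      simp at hj
      rw [← hj, hB.dep_root]
    · obtain ⟨h1, -, p, h2, -, h3⟩ := hB.parent j v hj hj0
      have := ih _ h1 h2
      omega

theorem push (hB : IsBFS G r q dep par h) {p v : Fin n} (hp : q[h]? = some p) (hpv : G.Adj p v)
    (hv : v ∉ q) : IsBFS G r (q ++ [v]) (Function.update dep v (dep p + 1))
      (Function.update par v h) h := by
  have hlt : ∀ {j u}, q[j]? = some u → j < q.length := fun hj => (List.getElem?_eq_some_iff.1 hj).1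
  have hne : ∀ {j u}, q[j]? = some u → u ≠ v := fun hj h =>
    hv (h ▸ List.mem_of_getElem? hj)
  have hcase : ∀ {j u}, (q ++ [v])[j]? = some u → q[j]? = some u ∨ j = q.length ∧ u = v := by
    intro j u hj
    rcases lt_or_ge j q.length with h1 | h1
    · rw [List.getElem?_append_left h1] at hj
      exact .inl hj
    · rw [List.getElem?_append_right h1] at hj
      have := List.getElem?_eq_some_iff.1 hj
      simp at this
      exact .inr ⟨by omega, this.2.symm⟩
  have hl : ∀ {j u}, q[j]? = some u → (q ++ [v])[j]? = some u := fun hj => by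
    rw [List.getElem?_append_left (hlt hj), hj]
  refine ⟨?_, hl hB.zero, ?_, ?_, ?_, ?_, ?_, ?_⟩
  · simpa [List.nodup_append, hB.nodup] using fun a ha (h : a = v) => hv (h ▸ ha)
  · intro u
    rw [Function.update_apply]
    split_ifs with h
    · simp [h]
    · simp [hB.dep_zero, h]
  · rw [Function.update_of_ne (hne hB.zero), hB.dep_root]
  · intro j u hj hj0
    rcases hcase hj with hj | ⟨rfl, rfl⟩
    · obtain ⟨h1, h2, p', h3, h4, h5⟩ := hB.parent j u hj hj0
      rw [Function.update_of_ne (hne hj), Function.update_of_ne (hne hj)]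
      exact ⟨h1, h2, p', hl h3, h4, by rw [Function.update_of_ne (hne h3), h5]⟩
    · rw [Function.update_self, Function.update_self]
      exact ⟨hlt hp, le_rfl, p, hl hp, hpv, by rw [Function.update_of_ne (hne hp)]⟩
  · intro i p' u hi hu hur hadj
    rw [List.mem_append, List.mem_singleton] at hu
    rcases hcase hi with hi' | ⟨hi', rfl⟩
    · rcases hu with hu | rfl
      · rw [Function.update_of_ne (by rintro rfl; exact hv hu)]
        exact hB.par_le i p' u hi' hu hur hadj
      · rw [Function.update_self]
        -- A neighbour at a position before `h` would already have put the new vertex into the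
        -- queue.
        by_contra! hlt
        exact hv (hB.closed i p' u hlt hi' hadj)
    · rcases hu with hu | rfl
      · rw [Function.update_of_ne (by rintro rfl; exact hv hu)]
        obtain ⟨j, hj⟩ := List.mem_iff_getElem?.1 hu
        have := (hB.parent j u hj (hB.pos_of_ne hj hur)).1
        have := hlt hj
        omega
      · exact absurd rfl hadj.ne
  · intro i j u u' hi hij hu hu'
    rcases hcase hu' with hu1 | ⟨hu1, rfl⟩
    · have hu : q[i]? = some u := by
        rcases hcase hu with hu | ⟨hu2, -⟩
        · exact hu
        · have := hlt hu1; omega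
      rw [Function.update_of_ne (hne hu), Function.update_of_ne (hne hu1)]
      exact hB.mono i j u u' hi hij hu hu1
    · rw [Function.update_self]
      rcases hcase hu with hu2 | ⟨-, rfl⟩
      · rw [Function.update_of_ne (hne hu2)]
        exact (hB.parent i u hu2 hi).2.1
      · rw [Function.update_self]
  · intro i p' u hi hp' hadj
    rcases hcase hp' with hp1 | ⟨hp1, -⟩
    · exact List.mem_append_left _ (hB.closed i p' u hi hp1 hadj)
    · have := hlt hp
      omega

theorem succ (hB : IsBFS G r q dep par h) {p : Fin n} (hp : q[h]? = some p)
    (hcl : ∀ u, G.Adj p u → u ∈ q) : IsBFS G r q dep par (h + 1) := by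
  refine ⟨hB.nodup, hB.zero, hB.dep_zero, hB.dep_root, fun j v hj hj0 => ?_, hB.par_le, hB.mono,
    fun i p' u hi hp' hadj => ?_⟩
  · obtain ⟨h1, h2, h3⟩ := hB.parent j v hj hj0
    exact ⟨h1, by omega, h3⟩
  · rcases (Nat.lt_succ_iff_lt_or_eq.1 hi) with hi' | rfl
    · exact hB.closed i p' u hi' hp' hadj
    · rw [hp] at hp'
      simp at hp'
      subst hp'
      exact hcl u hadj

theorem mem_of_length (hB : IsBFS G r q dep par q.length) (hc : G.Connected) (v : Fin n) :
    v ∈ q := by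
  obtain ⟨p⟩ := hc.preconnected r v
  suffices H : ∀ u v, G.Walk u v → u ∈ q → v ∈ q from H r v p (List.mem_of_getElem? hB.zero)
  intro u v p
  induction p with
  | nil => exact id
  | cons h _ ih =>
    intro hu
    obtain ⟨i, hi⟩ := List.mem_iff_getElem?.1 hu
    exact ih (hB.closed i _ _ (List.getElem?_eq_some_iff.1 hi).1 hi h)

end IsBFS

theorem wp_bfs (hIn : Input G st ad nb) (hc : G.Connected) (r : Fin n) (hr : (r : ℕ) = 0) {W : ℕ}
    {s : State} (hs0 : s.arr 0 = st) (hs1 : s.arr 1 = ad) (hW : 10 * n + 2 * G.edgeSet.ncard ≤ W)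
    (hq : ∀ i, s.arr aQueue i = 0) (hd : ∀ i, s.arr aDepth i = 0) (hh : s.var xHead = 0) :
    wp W bfs (fun t s' => Frame bfs s s' ∧ t ≤ 60 * n + 100 * G.edgeSet.ncard + 100 ∧
      ∃ q : List (Fin n), IsBFS G r q (s'.read aDepth) (s'.read aPar) n ∧ q.length = n ∧
        Holds (s'.arr aQueue) (fun u : Fin n => (u : ℕ)) q) s := by
  have hn : 0 < n := r.pos
  have hqlen : ∀ {q : List (Fin n)}, q.Nodup → q.length ≤ n := fun h => by
    simpa using h.length_le_card
  rw [bfs, ← hr]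
  simp only [wp_seq, wp_assign, wp_store, Expr.eval, Expr.cost]
  refine ⟨by omega, by omega, by omega, ?_⟩
  have hI0 : IsBFS G r [r] ((((s.setArr aDepth r 1).setVar xTail 1)).read aDepth)
      ((((s.setArr aDepth r 1).setVar xTail 1)).read aPar) 0 := by
    have h0 : (s.read aDepth : Fin n → ℕ) = 0 := funext fun v => hd v
    simp only [State.read_setVar, State.read_setArr, ↓reduceIte, h0]
    refine ⟨by simp, by simp, fun v => ?_, by simp, ?_, ?_, ?_, by simp⟩
    · by_cases hv : v = r <;> simp [hv]
    · intro j v hj hj0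
      have := (List.getElem?_eq_some_iff.1 hj).1
      simp at this
      omega
    · intro i p v _ hv hvr
      exact absurd (by simpa using hv) hvr
    · intro i j u v hi hij hu hv
      have := (List.getElem?_eq_some_iff.1 hu).1
      simp at this
      omega
  refine wp_mono (wp_frame (wp_loop
    (fun (a : List (Fin n) × ℕ) s' => s'.var xHead = a.2 ∧ s'.var xTail = a.1.length ∧
      a.2 ≤ a.1.length ∧ Holds (s'.arr aQueue) (fun u : Fin n => (u : ℕ)) a.1 ∧
      IsBFS G r a.1 (s'.read aDepth) (s'.read aPar) a.2)
    -- A vertex whose neighbours have not been visited yet still owns the cost of its scan; a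
    -- neighbour takes at most 27 + 11 steps.
    (fun a => ∑ v with v ∉ a.1.take a.2, (40 * (nb v).length + 40)) ([r], 0)
    ⟨by simpa using hh, by simp, by simp, ?_, hI0⟩ ?_)) ?_
  · intro j u hj
    have := (List.getElem?_eq_some_iff.1 hj).1
    simp at this
    subst this
    simp at hj
    simp [hq, ← hj, hr]
  · rintro ⟨q, h⟩ s' ⟨hhead, htail, hle, hrep, hB⟩ hF hb
    simp only at hhead htail hle hrep hB
    have hlt : h < q.length := by
      simpa [Expr.eval, hhead, htail] using hb
    have hql := hqlen hB.nodup
    obtain ⟨p, hp⟩ : ∃ p, q[h]? = some p := ⟨_, List.getElem?_eq_getElem hlt⟩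
    have hpn := p.2
    simp only [wp_seq, wp_assign, Expr.eval, Expr.cost, hhead, hrep h p hp]
    refine ⟨by omega, ?_⟩
    refine wp_mono (wp_scan hIn p (fun l s'' => ∃ q', s''.var xTail = q'.length ∧
      Holds (s''.arr aQueue) (fun u : Fin n => (u : ℕ)) q' ∧
      IsBFS G r q' (s''.read aDepth) (s''.read aPar) h ∧ q <+: q' ∧ ∀ u ∈ l, u ∈ q') 27
      ?_ ?_ (by simp) (by decide) (by omega) ?_ ?_) ?_
    · rw [← hs0, State.setVar_arr, hF.arr 0 (by decide)]; rfl
    · rw [← hs1, State.setVar_arr, hF.arr 1 (by decide)]; rfl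
    · intro i j
      exact ⟨q, by simp [htail], by simpa using hrep, by simpa using hB, List.prefix_rfl, by simp⟩
    · rintro l u l' s'' hl hF' ⟨q', htail', hrep', hB', hpre, hmem⟩
      have hv : s''.var xV = p := by rw [hF'.var xV (by decide)]; simp
      have hhd : s''.var xHead = h := by rw [hF'.var xHead (by decide)]; simp [hhead]
      have hq'l := hqlen hB'.nodup
      have hp' : q'[h]? = some p := by
        obtain ⟨e, rfl⟩ := hpre
        rw [List.getElem?_append_left hlt, hp]
      have hdep : s''.arr aDepth u = 0 ↔ u ∉ q' := hB'.dep_zero u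
      have hun := u.2
      have hbd : s''.arr aDepth p ≤ h + 1 := hB'.dep_le hp'
      simp only [visit, wp_branch, wp_seq, wp_assign, wp_store, wp_skip, Expr.eval, Expr.cost]
      simp only [State.setVar_var, State.setVar_arr, State.setArr_var, State.setArr_arr, hv, hhd,
        htail', State.read_setVar, Nat.reduceEqDiff, ↓reduceIte, hdep]
      constructor
      · intro hu
        have hu : u ∉ q' := by simpa using hu
        have hpu : G.Adj p u := (hIn.mem p u).1 (by simp [hl])
        have hB3 := hB'.push hp' hpu hu
        have := hqlen hB3.nodup
        simp at this
        refine ⟨by omega, by omega, by omega, by omega, by omega, by omega, by omega, by norm_num,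
          fun j => ⟨q' ++ [u], by simp, hrep'.push u, ?_, hpre.trans (List.prefix_append _ _), ?_⟩⟩
        · simpa [State.read_setArr_of_ne, State.read] using hB3
        · intro v hv
          rw [List.mem_append] at hv ⊢
          exact hv.imp_left (hmem v)
      · intro hu
        have hu : u ∈ q' := by simpa using hu
        refine ⟨by norm_num, fun j => ⟨q', rfl, hrep', hB', hpre, ?_⟩⟩
        rintro v hv
        rw [List.mem_append, List.mem_singleton] at hv
        exact hv.elim (hmem v) (fun h => h ▸ hu)
    · rintro t s'' ⟨⟨q', htail', hrep', hB', hpre, hmem⟩, hF', ht⟩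
      have hhd : s''.var xHead = h := by rw [hF'.var xHead (by decide)]; simp [hhead]
      have hp' : q'[h]? = some p := by
        obtain ⟨e, rfl⟩ := hpre
        rw [List.getElem?_append_left hlt, hp]
      have hlt' := (List.getElem?_eq_some_iff.1 hp').1
      have hq'l := hqlen hB'.nodup
      refine ⟨by omega, (q', h + 1), ⟨by simp [hhd], by simpa using htail', hlt', hrep',
        hB'.succ hp' fun u hu => hmem u ((hIn.mem p u).2 hu)⟩, ?_⟩
      have htake : q'.take (h + 1) = q.take h ++ [p] := by
        obtain ⟨e, rfl⟩ := hpre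
        rw [List.take_add_one, hp', List.take_append_of_le_length hle]
        rfl
      have hpmem : p ∉ q.take h := by
        intro hmem
        obtain ⟨i, hi⟩ := List.mem_iff_getElem?.1 hmem
        have hi' := (List.getElem?_eq_some_iff.1 hi).1
        simp at hi'
        rw [List.getElem?_take_of_lt (by omega)] at hi
        have := (List.getElem?_inj (by omega) hB.nodup).1 (hi.trans hp.symm)
        omega
      have hsum : ∑ v with v ∉ q.take h, (40 * (nb v).length + 40) =
          ∑ v with v ∉ q'.take (h + 1), (40 * (nb v).length + 40) + (40 * (nb p).length + 40) := by
        rw [← Finset.sum_erase_add (a := p) _ _ (by simpa using hpmem)]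
        congr 2
        ext v
        simp [htake, and_comm]
      simp only [hsum]
      omega
  · rintro t s' ⟨⟨⟨q, h⟩, ⟨hhead, htail, hle, hrep, hB⟩, hF, hb, ht⟩, hF'⟩
    simp only at hhead htail hle hrep hB ht
    have hlt : ¬ h < q.length := by
      simpa [Expr.eval, hhead, htail] using hb
    obtain rfl : h = q.length := by omega
    have hq : q.length = n := by
      have : q.toFinset = Finset.univ := by
        ext v
        simpa using hB.mem_of_length hc v
      rw [← List.toFinset_card_of_nodup hB.nodup, this]
      simp
    rw [hq] at hB
    refine ⟨⟨fun x hx => ?_, fun a ha => ?_⟩, ?_, q, hB, hq, hrep⟩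
    · simp only [Program.vars, List.mem_append, not_or, List.mem_cons, List.nil_append] at hx
      rw [hF.var x (by simpa only [Program.vars, List.mem_append, not_or, List.mem_cons] using hx.2)]
      simp [hx.1]
    · simp only [Program.arrs, List.mem_append, not_or, List.mem_cons, List.nil_append] at ha
      rw [hF.arr a (by simpa only [Program.arrs, List.mem_append, not_or, List.mem_cons, List.nil_append] using ha.2)]
      simp [ha.1]
    · have : ∑ v with v ∉ ([r] : List (Fin n)).take 0, (40 * (nb v).length + 40) =
          80 * G.edgeSet.ncard + 40 * n := by
        simp only [List.take_zero, List.not_mem_nil, not_false_eq_true, Finset.filter_true,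
          Finset.sum_add_distrib, ← Finset.mul_sum, hIn.sum]
        simp
        ring
      simp only [this, Expr.cost] at ht
      omega

theorem sum_map_le_of_nodup {l : List (Fin n)} (hl : l.Nodup) (f : Fin n → ℕ) :
    (l.map f).sum ≤ ∑ v, f v := by
  rw [← List.sum_toFinset f hl]
  exact Finset.sum_le_sum_of_subset (Finset.subset_univ _)

/-! ### The levels of a breadth-first search -/

namespace IsBFS

variable {r : Fin n} {q : List (Fin n)} {dep par : Fin n → ℕ}

/-- Parents appear in the queue in the same order as their children, and each child is one deeper
than its parent. -/
theorem dep_mono {h : ℕ} (hB : IsBFS G r q dep par h) {i j : ℕ} {u v : Fin n} (hij : i ≤ j)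
    (hu : q[i]? = some u) (hv : q[j]? = some v) : dep u ≤ dep v := by
  induction j using Nat.strong_induction_on generalizing i u v with
  | _ j ih =>
    rcases Nat.eq_zero_or_pos j with rfl | hj0
    · obtain rfl : i = 0 := by omega
      rw [hu] at hv
      simp at hv
      rw [hv]
    obtain ⟨h1, -, p, h2, -, h3⟩ := hB.parent j v hv hj0
    rcases Nat.eq_zero_or_pos i with rfl | hi0
    · rw [hB.zero] at hu
      simp at hu
      rw [← hu, hB.dep_root]
      omega
    · obtain ⟨h4, -, p', h5, -, h6⟩ := hB.parent i u hu hi0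
      have := ih _ h1 (hB.mono i j u v hi0 hij hu hv) h5 h2
      omega

theorem pairwise_dep {h : ℕ} (hB : IsBFS G r q dep par h) :
    q.Pairwise fun u v => dep u ≤ dep v := by
  rw [List.pairwise_iff_getElem]
  intro i j hi hj hij
  exact hB.dep_mono hij.le (List.getElem?_eq_getElem hi) (List.getElem?_eq_getElem hj)

theorem pairwise_par {h : ℕ} (hB : IsBFS G r q dep par h) :
    q.tail.Pairwise fun u v => par u ≤ par v := by
  rw [List.pairwise_iff_getElem]
  intro i j hi hj hij
  simp at hi hj
  rw [List.getElem_tail, List.getElem_tail]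
  exact hB.mono (i + 1) (j + 1) _ _ (by omega) (by omega) (List.getElem?_eq_getElem (by omega))
    (List.getElem?_eq_getElem (by omega))

variable (hB : IsBFS G r q dep par q.length) (hc : G.Connected)

include hB hc

theorem dep_eq (v : Fin n) : dep v = G.dist r v + 1 := by
  -- The parent of `v` stands no later in the queue than any neighbour of `v`, hence is no deeper.
  -- So depth grows by at most 1 along an edge, which gives the upper bound; following parents gives
  -- the lower one.
  have hadj : ∀ u v, G.Adj u v → dep v ≤ dep u + 1 := by
    intro u v huv
    by_cases hv : v = r
    · rw [hv, hB.dep_root]; omega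
    obtain ⟨i, hi⟩ := List.mem_iff_getElem?.1 (hB.mem_of_length hc u)
    obtain ⟨j, hj⟩ := List.mem_iff_getElem?.1 (hB.mem_of_length hc v)
    obtain ⟨-, -, p, h2, -, h3⟩ := hB.parent j v hj (hB.pos_of_ne hj hv)
    have := hB.dep_mono (hB.par_le i u v hi (hB.mem_of_length hc v) hv huv) h2 hi
    omega
  refine le_antisymm ?_ ?_
  · obtain ⟨p, hp⟩ := hc.exists_walk_length_eq_dist v r
    rw [dist_comm, ← hp, ← hB.dep_root]
    suffices H : ∀ a b (p : G.Walk a b), dep a ≤ p.length + dep b by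
      have := H v r p
      rw [hB.dep_root] at this ⊢
      exact this
    intro a b p
    induction p with
    | nil => simp
    | cons h p ih =>
      have := hadj _ _ (SimpleGraph.Adj.symm h)
      simp
      omega
  · obtain ⟨j, hj⟩ := List.mem_iff_getElem?.1 (hB.mem_of_length hc v)
    induction j using Nat.strong_induction_on generalizing v with
    | _ j ih =>
      rcases Nat.eq_zero_or_pos j with rfl | hj0
      · rw [hB.zero] at hj
        simp at hj
        subst hj
        simp [hB.dep_root]
      · obtain ⟨h1, -, p, h2, h3, h4⟩ := hB.parent j v hj hj0
        have := ih _ h1 p h2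
        have := h3.dist_le_add_one hc r
        omega

theorem exists_parent {v : Fin n} (hv : v ≠ r) :
    ∃ p, q[par v]? = some p ∧ p ∈ G.downNeighbors r v := by
  obtain ⟨j, hj⟩ := List.mem_iff_getElem?.1 (hB.mem_of_length hc v)
  obtain ⟨-, -, p, h2, h3, h4⟩ := hB.parent j v hj (hB.pos_of_ne hj hv)
  rw [hB.dep_eq hc, hB.dep_eq hc] at h4
  exact ⟨p, h2, h3, by omega⟩

/-- The parent is the first neighbour in the queue and it is a down-neighbour, so the set of
down-neighbours determines it. -/
theorem par_eq {u v : Fin n} (hu : u ≠ r) (hv : v ≠ r)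
    (h : G.downNeighbors r u = G.downNeighbors r v) : par u = par v := by
  obtain ⟨p, hp, hpu⟩ := hB.exists_parent hc hu
  obtain ⟨p', hp', hpv⟩ := hB.exists_parent hc hv
  exact le_antisymm
    (hB.par_le _ p' u hp' (hB.mem_of_length hc u) hu (h ▸ hpv).1)
    (hB.par_le _ p v hp (hB.mem_of_length hc v) hv (h ▸ hpu).1)

end IsBFS

end

/-! ### The order of elimination -/

section key

variable {V : Type*} [Fintype V] (G : SimpleGraph V) (r : V)

open Classical in
/-- The number of vertices that are closer to `r` than `v` and not adjacent to `v`. The vertices are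
eliminated in the order of decreasing keys. -/
noncomputable def key (v : V) : ℕ :=
  (Finset.univ.filter fun z => G.dist r z < G.dist r v ∧ ¬ G.Adj z v).card

variable {G r}

/-- What is counted for `u` is counted for `v`, whose neighbours are at most one level lower; a
down-neighbour of `u` is counted for `v` only. The root has none, and its key 0 also occurs on level
1. -/
theorem key_lt_key_of_dist_lt (hc : G.Connected) {u v : V} (hu : u ≠ r)
    (h : G.dist r u < G.dist r v) : key G r u < key G r v := by
  classical
  obtain ⟨p, hp⟩ := hc.exists_mem_downNeighbors
    (hc.dist_eq_zero_iff.not.2 hu.symm : G.dist r u ≠ 0)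
  refine Finset.card_lt_card (Finset.ssubset_iff_of_subset ?_ |>.2 ⟨p, ?_, ?_⟩)
  · intro z hz
    simp at hz ⊢
    refine ⟨by omega, fun hzv => ?_⟩
    have := hzv.dist_le_add_one hc r
    omega
  · have := hp.2
    simp
    refine ⟨by omega, fun hzv => ?_⟩
    have := hzv.dist_le_add_one hc r
    omega
  · simp [hp.1]

/-- On one level the closer vertices are the same, so fewer neighbours among them means a larger
key. -/
theorem key_lt_key_of_ssubset (hc : G.Connected) {u v : V} (h : G.dist r u = G.dist r v)
    (hN : G.downNeighbors r u ⊂ G.downNeighbors r v) : key G r v < key G r u := by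
  classical
  obtain ⟨hsub, p, hp, hpu⟩ := Set.ssubset_iff_exists.1 hN
  have hp2 := hp.2
  refine Finset.card_lt_card (Finset.ssubset_iff_of_subset ?_ |>.2 ⟨p, ?_, ?_⟩)
  · intro z hz
    simp at hz ⊢
    refine ⟨by omega, fun hzu => hz.2 (hsub ⟨hzu, ?_⟩).1⟩
    have := hzu.dist_le_add_one hc r
    omega
  · simp
    exact ⟨by omega, fun h' => hpu ⟨h', by omega⟩⟩
  · simp [hp.1]

theorem dist_eq_of_key_eq (hc : G.Connected) {u v : V} (hu : u ≠ r) (hv : v ≠ r)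
    (h : key G r u = key G r v) : G.dist r u = G.dist r v := by
  by_contra hne
  rcases Nat.lt_or_gt_of_ne hne with h' | h'
  · exact (key_lt_key_of_dist_lt hc hu h').ne h
  · exact (key_lt_key_of_dist_lt hc hv h').ne' h

/-- The common element makes the two sets comparable, and a strict inclusion would separate the
keys. -/
theorem downNeighbors_eq_of_key_eq (hc : G.Connected) (hG : IsDistanceHereditary G) {u v c : V}
    (hu : u ≠ r) (hv : v ≠ r) (h : key G r u = key G r v) (hcu : c ∈ G.downNeighbors r u)
    (hcv : c ∈ G.downNeighbors r v) : G.downNeighbors r u = G.downNeighbors r v := by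
  have hd := dist_eq_of_key_eq hc hu hv h
  by_contra hne
  rcases downNeighbors_subset_or_subset hc hG hd hcu hcv with h' | h'
  · exact (key_lt_key_of_ssubset hc hd (h'.ssubset_of_ne hne)).ne' h
  · exact (key_lt_key_of_ssubset hc hd.symm (h'.ssubset_of_ne (Ne.symm hne))).ne h

theorem key_eq_of_downNeighbors_eq (hc : G.Connected) {u v : V} (h : G.dist r u = G.dist r v)
    (hN : G.downNeighbors r u = G.downNeighbors r v) : key G r u = key G r v := by
  classical
  unfold key
  congr 1
  ext z
  simp only [Finset.mem_filter, Finset.mem_univ, true_and, h]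
  refine and_congr_right fun hz => not_congr ⟨fun hzu => ?_, fun hzv => ?_⟩
  · have := hzu.dist_le_add_one hc r
    have h' : z ∈ G.downNeighbors r u := ⟨hzu, by omega⟩
    exact (hN ▸ h').1
  · have := hzv.dist_le_add_one hc r
    have h' : z ∈ G.downNeighbors r v := ⟨hzv, by omega⟩
    exact (hN.symm ▸ h').1

theorem key_lt_card (v : V) : key G r v < Fintype.card V := by
  classical
  exact Finset.card_lt_univ_of_notMem (x := v) (by simp)

end key

section

variable {n : ℕ} {G : SimpleGraph (Fin n)} {st ad : ℕ → ℕ} {nb : Fin n → List (Fin n)}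

/-- Neighbours closer to `r` are exactly one level closer, so a count per level and a scan of the
neighbours suffice to compute the key. -/
theorem Input.key_eq (hIn : Input G st ad nb) (hc : G.Connected) (r v : Fin n) :
    key G r v = (Finset.univ.filter fun z => G.dist r z < G.dist r v).card -
      (nb v).countP fun u => G.dist r u + 1 = G.dist r v := by
  classical
  have h1 : (nb v).countP (fun u => G.dist r u + 1 = G.dist r v) =
      (Finset.univ.filter fun z => G.dist r z < G.dist r v ∧ G.Adj z v).card := by
    rw [List.countP_eq_length_filter, ← List.toFinset_card_of_nodup ((hIn.nodup v).filter _)]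
    congr 1
    ext u
    simp only [List.mem_toFinset, List.mem_filter, hIn.mem, decide_eq_true_eq, Finset.mem_filter,
      Finset.mem_univ, true_and]
    constructor
    · rintro ⟨h1, h2⟩
      exact ⟨by omega, h1.symm⟩
    · rintro ⟨h1, h2⟩
      have := h2.dist_le_add_one hc r
      exact ⟨h2.symm, by omega⟩
  rw [h1, ← Finset.filter_filter, ← Finset.card_filter_add_card_filter_not (s :=
    Finset.univ.filter fun z => G.dist r z < G.dist r v) (fun z => G.Adj z v)]
  simp only [key, Finset.filter_filter, Nat.add_sub_cancel_left]

/-- Count the vertices of small depth. -/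
def levels : Program :=
  .forSeg aQueue xI xE xU (.const 0) (.var 0)
    (.store aStart (.add (.get aDepth (.var xU)) (.const 1)) (.add (.var xI) (.const 1)))

/-- The queue is sorted by depth, so the last write for a depth leaves the number of vertices up to
that depth. It is stored one index higher and is thus found under the depth of `v` as the number of
vertices strictly closer than `v`. -/
theorem wp_levels (hc : G.Connected) {r : Fin n} {q : List (Fin n)} {W : ℕ} {s : State}
    (hB : IsBFS G r q (s.read aDepth) (s.read aPar) q.length) (hq : q.length = n)
    (hW : 10 * n ≤ W) (hv : s.var 0 = n) (hrep : Holds (s.arr aQueue) (fun u : Fin n => (u : ℕ)) q) :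
    wp W levels (fun t s' => Frame levels s s' ∧ t ≤ 30 * n + 30 ∧
      ∀ v : Fin n, v ≠ r →
        s'.arr aStart (s.arr aDepth v) = (Finset.univ.filter fun z => G.dist r z < G.dist r v).card)
      s := by
  have hdep : ∀ v : Fin n, s.arr aDepth v = G.dist r v + 1 := hB.dep_eq hc
  have hdn : ∀ v : Fin n, s.arr aDepth v ≤ n := by
    intro v
    obtain ⟨j, hj⟩ := List.mem_iff_getElem?.1 (hB.mem_of_length hc v)
    have := (List.getElem?_eq_some_iff.1 hj).1
    have := hB.dep_le hj
    exact this.trans (by omega)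
  refine wp_mono (wp_frame (wp_forSeg q (fun u => (u : ℕ)) 0 (fun p s' => ∀ v ∈ p,
    s'.arr aStart (s.arr aDepth v + 1) = p.countP fun z : Fin n => s.arr aDepth z ≤ s.arr aDepth v)
    (fun _ => 8) rfl (by simp [Expr.eval, hv, hq])
    (fun j x hj => by rw [zero_add]; exact hrep j x hj) (by omega)
    (fun v _ => by have := v.2; omega) (by decide) (by simp) ?_)) ?_
  · intro p x l s' hl hi hF hI
    have hdx : s'.arr aDepth = s.arr aDepth := hF.arr _ (by decide)
    have hxn := hdn x
    have hlen : p.length < n := by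
      have := congrArg List.length hl
      simp at this
      omega
    simp only [wp_store, Expr.eval, Expr.cost, State.setVar_var, State.setVar_arr, ↓reduceIte,
      Nat.reduceEqDiff, hdx, hi, State.setArr_arr]
    refine ⟨by omega, by omega, by norm_num, fun _ v hv => ?_⟩
    have hsort : ∀ z ∈ p, s.arr aDepth z ≤ s.arr aDepth x := by
      have := hB.pairwise_dep
      rw [hl, List.pairwise_append] at this
      exact fun z hz => this.2.2 z hz x (by simp)
    by_cases hvx : s.arr aDepth v = s.arr aDepth x
    · rw [hvx, Function.update_self, List.countP_eq_length.2]
      · simp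
      · intro z hz
        rw [List.mem_append, List.mem_singleton] at hz
        rcases hz with hz | rfl
        · simpa using hsort z hz
        · simp
    · have hvp : v ∈ p := by
        rw [List.mem_append, List.mem_singleton] at hv
        exact hv.resolve_right fun h => hvx (h ▸ rfl)
      have := hsort v hvp
      rw [Function.update_of_ne (by omega), hI v hvp, List.countP_append]
      simp
      omega
  · rintro t s' ⟨⟨hI, -, ht⟩, hF⟩
    refine ⟨hF, ?_, fun v hv => ?_⟩
    · simp only [List.map_const', List.sum_replicate, Expr.cost, smul_eq_mul, hq] at ht
      omega
    · obtain ⟨p, -, hp⟩ := hB.exists_parent hc hv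
      have h1 := hI p (hB.mem_of_length hc p)
      have h2 := hp.2
      have h3 : s.arr aDepth p + 1 = s.arr aDepth v := by rw [hdep, hdep]; omega
      rw [h3] at h1
      rw [h1, List.countP_eq_length_filter, ← List.toFinset_card_of_nodup (hB.nodup.filter _)]
      congr 1
      ext z
      have := hB.mem_of_length hc z
      simp [hdep, this]
      omega

/-! ### Buckets -/

/-- The list that starts with the node `x`, with links `next`. The node `0` marks the end. -/
def IsChain (next : ℕ → ℕ) : ℕ → List (Fin n) → Prop
  | x, [] => x = 0
  | x, v :: l => x = v ∧ IsChain next (next v) l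

theorem IsChain.congr {next next' : ℕ → ℕ} {x : ℕ} {l : List (Fin n)} (h : IsChain next x l)
    (hl : ∀ v ∈ l, next' v = next v) : IsChain next' x l := by
  induction l generalizing x with
  | nil => exact h
  | cons v l ih =>
    refine ⟨h.1, ?_⟩
    rw [hl v (by simp)]
    exact ih h.2 fun u hu => hl u (by simp [hu])

theorem IsChain.cons {next : ℕ → ℕ} {x : ℕ} {l : List (Fin n)} (h : IsChain next x l) {v : Fin n}
    (hv : v ∉ l) : IsChain (Function.update next v x) v (v :: l) := by
  refine ⟨rfl, ?_⟩
  rw [Function.update_self]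
  refine h.congr fun u hu => Function.update_of_ne ?_ _ _
  intro huv
  exact hv (Fin.ext huv ▸ hu)

/-- Put each vertex other than the first one into the bucket of its key. -/
def buckets : Program :=
  .forSeg aQueue xJ xF xV (.const 1) (.var 0)
    (.seq (.assign xKey (.get aStart (.get aDepth (.var xV))))
    (.seq (.scan xV (.assign xKey (.sub (.var xKey)
      (.eq (.add (.get aDepth (.var xU)) (.const 1)) (.get aDepth (.var xV))))))
    (.seq (.store aNext (.var xV) (.get aBucket (.var xKey)))
    (.store aBucket (.var xKey) (.var xV)))))

/-- Prepending reverses the order of the queue inside a bucket. The root stays out, which frees the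
number 0 to mark the end of a list. -/
theorem wp_buckets (hIn : Input G st ad nb) (hc : G.Connected) {r : Fin n} {q : List (Fin n)}
    {W : ℕ} {s : State} (hs0 : s.arr 0 = st) (hs1 : s.arr 1 = ad)
    (hB : IsBFS G r q (s.read aDepth) (s.read aPar) q.length) (hq : q.length = n)
    (hW : 10 * n + 2 * G.edgeSet.ncard ≤ W) (hv : s.var 0 = n)
    (hrep : Holds (s.arr aQueue) (fun u : Fin n => (u : ℕ)) q)
    (hst : ∀ v : Fin n, v ≠ r →
        s.arr aStart (s.arr aDepth v) = (Finset.univ.filter fun z => G.dist r z < G.dist r v).card)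
    (hbk : ∀ k, s.arr aBucket k = 0) :
    wp W buckets (fun t s' => Frame buckets s s' ∧ t ≤ 60 * n + 60 * G.edgeSet.ncard + 30 ∧
      ∀ k, IsChain (s'.arr aNext) (s'.arr aBucket k)
        ((q.tail.filter fun v => key G r v = k).reverse : List (Fin n))) s := by
  have hdep : ∀ v : Fin n, s.arr aDepth v = G.dist r v + 1 := hB.dep_eq hc
  have hqt : q = r :: q.tail := by
    have := hB.zero
    cases q with
    | nil => simp at this
    | cons x l => simpa using this
  have hnd : (r :: q.tail).Nodup := hqt ▸ hB.nodup
  refine wp_mono (wp_frame (wp_forSeg q.tail (fun u => (u : ℕ)) 1 (fun p s' => ∀ k,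
      IsChain (s'.arr aNext) (s'.arr aBucket k)
        ((p.filter fun v => key G r v = k).reverse : List (Fin n)))
    (fun v => 21 * (nb v).length + 30) rfl ?_ ?_ ?_
    (fun v _ => by have := v.2; omega) (by decide) (by simp [hbk, IsChain]) ?_)) ?_
  · simp [Expr.eval, hv, hq]
    have := r.2
    omega
  · intro j x hj
    rw [List.getElem?_tail] at hj
    rw [add_comm]
    exact hrep _ _ hj
  · have := r.2
    simp [hq]
    omega
  · intro p x l s' hl hi hF hI
    have hdx : s'.arr aDepth = s.arr aDepth := hF.arr _ (by decide)
    have hsx : s'.arr aStart = s.arr aStart := hF.arr _ (by decide)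
    have hxr : x ≠ r := by
      rintro rfl
      simp [hl] at hnd
    have hxp : x ∉ p := by
      rw [hl] at hnd
      have := (List.nodup_cons.1 hnd).2
      rw [List.nodup_append] at this
      exact fun h => this.2.2 x h x (by simp) rfl
    have hxn := x.2
    have hcard : (Finset.univ.filter fun z => G.dist r z < G.dist r x).card ≤ n :=
      (Finset.card_le_univ _).trans (by simp)
    simp only [wp_seq, wp_assign, Expr.eval, Expr.cost, State.setVar_var, State.setVar_arr,
      ↓reduceIte, hdx, hsx, hst x hxr]
    refine ⟨by omega, ?_⟩
    refine wp_mono (wp_scan hIn x (fun l' s'' => s''.var xKey =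
      (Finset.univ.filter fun z => G.dist r z < G.dist r x).card -
        l'.countP fun u => G.dist r u + 1 = G.dist r x) 10 ?_ ?_ (by simp) (by decide) (by omega)
      (by simp) ?_) ?_
    · rw [← hs0, State.setVar_arr, State.setVar_arr, hF.arr 0 (by decide)]
    · rw [← hs1, State.setVar_arr, State.setVar_arr, hF.arr 1 (by decide)]
    · intro p' u l'' s'' hl' hF' hI'
      have hdx' : s''.arr aDepth = s.arr aDepth := by
        rw [hF'.arr _ (by decide), State.setVar_arr, State.setVar_arr, hdx]
      have hv' : s''.var xV = x := by
        rw [hF'.var _ (by decide)]; simp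
      simp only [wp_assign, Expr.eval, Expr.cost, State.setVar_var, State.setVar_arr,
        ↓reduceIte, Nat.reduceEqDiff, hI', hdx', hv', hdep, List.countP_append]
      refine ⟨by omega, by norm_num, fun _ => ?_⟩
      simp only [List.countP_cons, List.countP_nil, decide_eq_true_eq, zero_add, Nat.sub_sub]
    · rintro t s'' ⟨hk, hF', ht⟩
      rw [← hIn.key_eq hc] at hk
      have hkn : key G r x < n := by simpa using key_lt_card (G := G) (r := r) x
      have hv' : s''.var xV = x := by
        rw [hF'.var _ (by decide)]; simp
      have hnx : s''.arr aNext = s'.arr aNext := hF'.arr _ (by decide)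
      have hbx : s''.arr aBucket = s'.arr aBucket := hF'.arr _ (by decide)
      have hbd : s'.arr aBucket (key G r x) < n := by
        have := hI (key G r x)
        rcases h : ((p.filter fun v => key G r v = key G r x).reverse : List (Fin n)) with _ | ⟨u, l'⟩
        · rw [h] at this
          rw [this]
          omega
        · rw [h] at this
          rw [this.1]
          exact u.2
      simp only [wp_store, Expr.eval, Expr.cost, State.setArr_var, State.setArr_arr, ↓reduceIte,
        Nat.reduceEqDiff, hk, hv', hnx, hbx]
      refine ⟨by omega, by omega, by omega, by omega, by omega, fun _ k => ?_⟩
      by_cases hkx : key G r x = k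
      · subst hkx
        simp only [Function.update_self, List.filter_append, List.reverse_append]
        simp only [decide_true, List.filter_cons_of_pos, List.filter_nil, List.reverse_singleton,
          List.singleton_append]
        exact (hI _).cons (by simp [hxp])
      · rw [Function.update_of_ne (Ne.symm hkx), List.filter_append,
          List.filter_cons_of_neg (by simpa using hkx)]
        rw [List.filter_nil, List.append_nil]
        refine (hI k).congr fun v hv => Function.update_of_ne ?_ _ _
        intro hvx
        simp at hv
        exact hxp (Fin.ext hvx ▸ hv.1)
  · rintro t s' ⟨⟨hI, -, ht⟩, hF⟩
    refine ⟨hF, ?_, hI⟩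
    have h1 := sum_map_le_of_nodup (List.nodup_cons.1 hnd).2
      (fun v => 21 * (nb v).length + 30 + 11)
    simp only [Finset.sum_add_distrib, ← Finset.mul_sum, hIn.sum, Finset.sum_const,
      Finset.card_univ, Fintype.card_fin, smul_eq_mul] at h1
    simp only [Expr.cost] at ht
    omega

/-! ### The log -/

/-- The log in the memory consists of the entries in `L`. -/
structure HoldsLog (s : State) (L : List (Entry (Fin n))) : Prop where
  length : s.var xLog = L.length
  target : Holds (s.arr aTarget) (fun e : Entry (Fin n) => (e.target : ℕ)) L
  source : Holds (s.arr aSource) (fun e : Entry (Fin n) => (e.source : ℕ)) L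
  offset : Holds (s.arr aOffset) (fun e : Entry (Fin n) => e.offset) L
  value : Holds (s.arr aValue) (fun e : Entry (Fin n) => e.value) L

theorem HoldsLog.congr {s s' : State} {L : List (Entry (Fin n))} (h : HoldsLog s L) {P : Program}
    (hF : Frame P s s') (hP : xLog ∉ P.vars ∧ aTarget ∉ P.arrs ∧ aSource ∉ P.arrs ∧
      aOffset ∉ P.arrs ∧ aValue ∉ P.arrs) : HoldsLog s' L := by
  obtain ⟨h1, h2, h3, h4, h5⟩ := hP
  exact ⟨by rw [hF.var _ h1, h.length], by rw [hF.arr _ h2]; exact h.target,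
    by rw [hF.arr _ h3]; exact h.source, by rw [hF.arr _ h4]; exact h.offset,
    by rw [hF.arr _ h5]; exact h.value⟩

/-- Append an entry to the log. -/
def record (t src o v : Expr) : Program :=
  .seq (.store aTarget (.var xLog) t)
  (.seq (.store aSource (.var xLog) src)
  (.seq (.store aOffset (.var xLog) o)
  (.seq (.store aValue (.var xLog) v)
  (.assign xLog (.add (.var xLog) (.const 1))))))

/-- The four expressions are evaluated while the arrays of the log, numbered from 13 on, are being
changed; `he` asks that their values do not depend on those arrays. -/
theorem wp_record {W : ℕ} {s : State} {L : List (Entry (Fin n))} (hL : HoldsLog s L)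
    (e : Entry (Fin n)) {t src o v : Expr}
    (he : ∀ s' : State, s'.var = s.var → (∀ a, a < 13 → s'.arr a = s.arr a) →
      t.eval s' = e.target ∧ src.eval s' = e.source ∧ o.eval s' = e.offset ∧ v.eval s' = e.value)
    (hn : n ≤ W) (hLW : L.length + 1 ≤ W) (ho : e.offset ≤ W) (hv : e.value ≤ W) :
    wp W (record t src o v) (fun k s' => HoldsLog s' (L ++ [e]) ∧ Frame (record t src o v) s s' ∧
      k ≤ t.cost + src.cost + o.cost + v.cost + 12) s := by
  have ht := e.target.2
  have hs := e.source.2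
  refine wp_mono (wp_frame (Q := fun k s' => HoldsLog s' (L ++ [e]) ∧
    k ≤ t.cost + src.cost + o.cost + v.cost + 12) ?_) (fun k s' h => ⟨h.1.1, h.2, h.1.2⟩)
  simp only [record, wp_seq, wp_store, wp_assign, Expr.eval, Expr.cost, State.setArr_var]
  rw [(he s rfl fun _ _ => rfl).1, (he _ ?_ ?_).2.1, (he _ ?_ ?_).2.2.1, (he _ ?_ ?_).2.2.2,
    hL.length]
  · refine ⟨by omega, by omega, by omega, by omega, by omega, by omega, by omega, by omega,
      by omega, ⟨by simp, ?_, ?_, ?_, ?_⟩, by omega⟩ <;>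
      simp only [State.setVar_arr, State.setArr_arr, ↓reduceIte, Nat.reduceEqDiff]
    · exact hL.target.push e
    · exact hL.source.push e
    · exact hL.offset.push e
    · exact hL.value.push e
  all_goals first
    | rfl
    | (intro a ha
       simp only [State.setArr_arr]
       repeat rw [if_neg (by omega)])

/-! ### Contractions -/

/-- Remove the vertex `xV` of the list of vertices that are contracted to `xTop`. -/
def remove : Program :=
  .seq (.assign xAdj (.const 0))
  (.seq (.assign xFlag (.const 0))
  (.seq (.scan xV
    (.seq (.assign xAdj (.add (.var xAdj) (.lt (.const 1) (.add
      (.eq (.get aMark (.var xU)) (.add (.var xBase) (.const 1)))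
      (.eq (.get aWeight (.var xU)) (.get aWeight (.var xTop)))))))
    (.assign xFlag (.add (.var xFlag) (.eq (.var xU) (.var xTop))))))
  (.seq (record (.var xV) (.var xTop) (.const 0)
    (.add (.add (.get aWeight (.var xTop)) (.const 1)) (.lt (.var xAdj)
      (.sub (.var xCount) (.eq (.get aWeight (.var xV)) (.get aWeight (.var xTop)))))))
  (.seq (.store aDead (.var xV) (.const 1))
  (.seq (.assign xVal (.sub (.add (.get aWeight (.var xV)) (.const 2)) (.var xFlag)))
  (.branch (.lt (.var xMax) (.var xVal)) (.assign xMax (.var xVal)) .skip))))))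

/-- A single scan of the neighbours of `x` gives both the number of adjacent vertices of largest
weight, for the entry of `x`, and the adjacency to `t`, hence the distance to `t`. The list of `t`
is never read, since `t` may stay in the graph; its eccentricity inside `M` is accumulated in `xMax`
instead. -/
theorem wp_remove (hIn : Input G st ad nb) {W : ℕ} {s : State}
    (hs0 : s.arr 0 = st) (hs1 : s.arr 1 = ad)
    {M : List (Fin n)} (hM : M.Nodup) {L : List (Entry (Fin n))} (hL : HoldsLog s L) {t x : Fin n}
    (ht : t ∈ M) (hx : x ∈ M) (hxt : x ≠ t) (hxV : s.var xV = x) (hxTop : s.var xTop = t)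
    (hmark : ∀ v : Fin n, s.arr aMark v = s.var xBase + 1 ↔ v ∈ M)
    (hw : ∀ u ∈ M, s.arr aWeight u ≤ s.arr aWeight t)
    (hd : ∀ x ∈ M, ∀ y ∈ M, x ≠ y → G.dist x y = 1 ∨ G.dist x y = 2)
    (hcount : s.var xCount = M.countP fun u : Fin n => s.arr aWeight u = s.arr aWeight t)
    (hW : 10 * n + 2 * G.edgeSet.ncard ≤ W) (hLn : L.length < 5 * n) (hwn : s.arr aWeight t ≤ n)
    (hbase : s.var xBase < 5 * n) :
    wp W remove (fun k s' => Frame remove s s' ∧ k ≤ 41 * (nb x).length + 120 ∧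
      HoldsLog s' (L ++ [⟨x, t, 0, G.weightedEccent M.toFinset (s.read aWeight) x⟩]) ∧
      s'.arr aDead = Function.update (s.arr aDead) x 1 ∧
      s'.var xMax = max (s.var xMax) (G.dist t x + s.arr aWeight x)) s := by
  classical
  have hn := x.2
  refine wp_mono (wp_frame (Q := fun k s' => k ≤ 41 * (nb x).length + 120 ∧
      HoldsLog s' (L ++ [⟨x, t, 0, G.weightedEccent M.toFinset (s.read aWeight) x⟩]) ∧
      s'.arr aDead = Function.update (s.arr aDead) x 1 ∧
      s'.var xMax = max (s.var xMax) (G.dist t x + s.arr aWeight x)) ?_)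
    (fun k s' h => ⟨h.2, h.1⟩)
  have hval := weightedEccent_eq_add_ite (G := G) (M := M.toFinset) (w := s.read aWeight)
    (t := t) (u := x) (by simpa) (by simpa) hxt (by simpa [State.read_apply] using hw) (by
      intro x hx y hy hxy
      rw [List.mem_toFinset] at hx hy
      split_ifs with hadj
      · exact dist_eq_one_iff_adj.2 hadj
      · exact (hd x hx y hy hxy).resolve_left (mt dist_eq_one_iff_adj.1 hadj))
  have hcnt : (M.toFinset.filter fun u => s.read aWeight u = s.read aWeight t).card =
      s.var xCount := by
    rw [hcount, List.countP_eq_length_filter, ← List.toFinset_card_of_nodup (hM.filter _)]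
    congr 1
    ext u
    rw [Finset.mem_filter]
    simp only [List.mem_toFinset, List.mem_filter, decide_eq_true_eq, State.read_apply]
  have hadjc : (nb x).countP (fun u : Fin n => u ∈ M ∧ s.arr aWeight u = s.arr aWeight t) =
      (M.toFinset.filter fun u => G.Adj x u ∧ s.read aWeight u = s.read aWeight t).card := by
    rw [List.countP_eq_length_filter, ← List.toFinset_card_of_nodup ((hIn.nodup x).filter _)]
    congr 1
    ext u
    rw [Finset.mem_filter]
    simp only [List.mem_toFinset, List.mem_filter, decide_eq_true_eq, State.read_apply, hIn.mem]
    tauto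
  have hflag : (nb x).countP (fun u : Fin n => u = t) = if G.Adj x t then 1 else 0 := by
    have h1 : (nb x).countP (fun u : Fin n => u = t) = (nb x).count t := by
      rw [List.count]
      congr 1
    rw [h1, (hIn.nodup x).count]
    simp [hIn.mem]
  have hdtx : G.dist t x = 2 - (if G.Adj x t then 1 else 0) := by
    rcases hd x hx t ht hxt with h | h
    · rw [SimpleGraph.dist_comm, h, if_pos (dist_eq_one_iff_adj.1 h)]
    · rw [SimpleGraph.dist_comm, h, if_neg fun h' => by rw [dist_eq_one_iff_adj.2 h'] at h; omega]
  have hdeg : (nb x).length ≤ n := by simpa using (hIn.nodup x).length_le_card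
  simp only [remove, wp_seq, wp_assign, Expr.eval, Expr.cost]
  refine ⟨by omega, by omega, ?_⟩
  refine wp_mono (wp_scan hIn x (fun l s' =>
    s'.var xAdj = l.countP (fun u : Fin n => u ∈ M ∧ s.arr aWeight u = s.arr aWeight t) ∧
    s'.var xFlag = l.countP (fun u : Fin n => u = t)) 28 (by simpa using hs0) (by simpa using hs1)
    (by simpa using hxV) (by decide) (by omega) (by simp) ?_) ?_
  · rintro l u l' s' hl hF ⟨hA, hf⟩
    have h1 : s'.arr aMark = s.arr aMark := hF.arr _ (by decide)
    have h2 : s'.arr aWeight = s.arr aWeight := hF.arr _ (by decide)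
    have h3 : s'.var xTop = t := by rw [hF.var _ (by decide)]; simpa using hxTop
    have h4 : s'.var xBase = s.var xBase := by rw [hF.var _ (by decide)]; simp
    have hlen : l.length + 1 ≤ n := by
      have := congrArg List.length hl
      simp at this
      omega
    have hc1 := List.countP_le_length (l := l)
      (p := fun u : Fin n => u ∈ M ∧ s.arr aWeight u = s.arr aWeight t)
    have hc2 := List.countP_le_length (l := l) (p := fun u : Fin n => u = t)
    simp only [wp_seq, wp_assign, Expr.eval, Expr.cost, State.setVar_var, State.setVar_arr,
      ↓reduceIte, Nat.reduceEqDiff, h1, h2, h3, h4, hA, hf, hmark, List.countP_append,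
      List.countP_singleton, decide_eq_true_eq, Fin.val_inj]
    refine ⟨?_, ?_, by norm_num, fun _ => ⟨?_, trivial⟩⟩
    · split_ifs <;> omega
    · split_ifs <;> omega
    · by_cases hu1 : u ∈ M <;> by_cases hu2 : s.arr aWeight u = s.arr aWeight t <;>
        simp [hu1, hu2]
  · rintro k s' ⟨⟨hA, hf⟩, hF, hk⟩
    have h2 : s'.arr aWeight = s.arr aWeight := hF.arr _ (by decide)
    have h3 : s'.var xTop = t := by rw [hF.var _ (by decide)]; simpa using hxTop
    have h5 : s'.var xV = x := by rw [hF.var _ (by decide)]; simpa using hxV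
    have h6 : s'.var xCount = s.var xCount := by rw [hF.var _ (by decide)]; simp
    have h7 : s'.var xMax = s.var xMax := by rw [hF.var _ (by decide)]; simp
    have h8 : s'.arr aDead = s.arr aDead := hF.arr _ (by decide)
    have hL' : HoldsLog s' L := by
      refine HoldsLog.congr (P := .scan xV _) ?_ hF (by decide)
      exact ⟨by simpa using hL.length, hL.target, hL.source, hL.offset, hL.value⟩
    rw [hadjc] at hA
    rw [hflag] at hf
    rw [hcnt] at hval
    have hwx := hw x hx
    refine wp_mono (wp_record hL' ⟨x, t, 0, G.weightedEccent M.toFinset (s.read aWeight) x⟩ ?_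
      (by omega) (by omega) (by simp) ?_) ?_
    · intro s'' hv ha
      refine ⟨by simp [Expr.eval, hv, h5], by simp [Expr.eval, hv, h3], rfl, ?_⟩
      simp only [hval, Expr.eval, hv, ha aWeight (by omega), h2, h3, h5, h6, hA,
        ← State.read_apply s aWeight]
    · have h1 : s.read aWeight t ≤ n := hwn
      have h2 : ∀ (p : Prop) [Decidable p], (if p then 1 else 0) ≤ 1 := fun p _ => by
        split_ifs <;> omega
      simp only [hval]
      exact (Nat.add_le_add_left (h2 _) _).trans (by omega)
    · rintro k' s'' ⟨hL'', hF'', hk'⟩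
      have e2 : s''.arr aWeight = s.arr aWeight := by rw [hF''.arr _ (by decide), h2]
      have e5 : s''.var xV = x := by rw [hF''.var _ (by decide), h5]
      have e7 : s''.var xMax = s.var xMax := by rw [hF''.var _ (by decide), h7]
      have e8 : s''.arr aDead = s.arr aDead := by rw [hF''.arr _ (by decide), h8]
      have e9 : s''.var xFlag = if G.Adj x t then 1 else 0 := by rw [hF''.var _ (by decide), hf]
      simp only [Expr.cost] at hk'
      simp only [wp_assign, wp_store, wp_branch, wp_skip, Expr.eval, Expr.cost,
        State.setVar_var, State.setVar_arr, State.setArr_var, State.setArr_arr,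
        ↓reduceIte, Nat.reduceEqDiff, e2, e5, e7, e8, e9]
      refine ⟨by omega, by omega, by split_ifs <;> omega, fun hlt => ⟨by split_ifs <;> omega,
        by omega, ⟨by simpa using hL''.length, hL''.target, hL''.source, hL''.offset, hL''.value⟩,
        trivial, ?_⟩, fun hlt => ⟨by omega,
        ⟨by simpa using hL''.length, hL''.target, hL''.source, hL''.offset, hL''.value⟩, trivial, ?_⟩⟩
      · rw [hdtx]
        split_ifs at hlt ⊢ <;> omega
      · rw [hdtx]
        split_ifs at hlt ⊢ <;> omega

theorem weightedEccent_append_singleton {V : Type*} [DecidableEq V] (G : SimpleGraph V) (w : V → ℕ)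
    (p : List V) {t x : V} (h : x ≠ t) : G.weightedEccent (p ++ [x]).toFinset w t =
      max (G.weightedEccent p.toFinset w t) (G.dist t x + w x) := by
  have : (p ++ [x]).toFinset.erase t = insert x (p.toFinset.erase t) := by
    ext y
    simp
    grind
  rw [weightedEccent, this, Finset.sup_insert, max_comm]
  rfl

theorem weightedEccent_append_self {V : Type*} [DecidableEq V] (G : SimpleGraph V) (w : V → ℕ)
    (p : List V) (t : V) : G.weightedEccent (p ++ [t]).toFinset w t =
      G.weightedEccent p.toFinset w t := by
  have : (p ++ [t]).toFinset.erase t = p.toFinset.erase t := by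
    ext y
    simp
  rw [weightedEccent, this]
  rfl

/-- Contract the vertices of the list in `aList` to one of largest weight, `xTop`. -/
def contract : Program :=
  .seq (.assign xTop (.get aList (.const 0)))
  (.seq (.forSeg aList xJ xF xV (.const 0) (.var xSize)
    (.seq (.store aMark (.var xV) (.add (.var xLog) (.const 1)))
    (.branch (.lt (.get aWeight (.var xTop)) (.get aWeight (.var xV)))
      (.assign xTop (.var xV)) .skip)))
  (.seq (.assign xCount (.const 0))
  (.seq (.forSeg aList xJ xF xV (.const 0) (.var xSize)
    (.assign xCount (.add (.var xCount) (.eq (.get aWeight (.var xV)) (.get aWeight (.var xTop))))))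
  (.seq (.assign xBase (.var xLog))
  (.seq (record (.var xTop) (.var xTop) (.const 0) (.const 0))
  (.seq (.assign xMax (.const 0))
  (.seq (.forSeg aList xJ xF xV (.const 0) (.var xSize)
    (.branch (.eq (.var xV) (.var xTop)) .skip remove))
  (.store aValue (.var xBase) (.var xMax)))))))))

/-- Time is charged to the degrees of the contracted vertices without `t`. Membership in `M` is
marked by the stamp `L.length + 1`: by `hmark` it is larger than all earlier marks, so marks never
have to be cleared. -/
theorem wp_contract (hIn : Input G st ad nb) {W : ℕ} {s : State}
    (hs0 : s.arr 0 = st) (hs1 : s.arr 1 = ad)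
    {M : List (Fin n)} (hM : M.Nodup) (hM0 : M ≠ []) {L : List (Entry (Fin n))} (hL : HoldsLog s L)
    (hsize : s.var xSize = M.length) (hlist : Holds (s.arr aList) (fun u : Fin n => (u : ℕ)) M)
    (hmark : ∀ v : Fin n, s.arr aMark v ≤ L.length)
    (hd : ∀ x ∈ M, ∀ y ∈ M, x ≠ y → G.dist x y = 1 ∨ G.dist x y = 2)
    (hW : 10 * n + 2 * G.edgeSet.ncard ≤ W) (hLn : L.length + M.length < 5 * n)
    (hwn : ∀ v : Fin n, s.arr aWeight v ≤ n) :
    wp W contract (fun k s' => Frame contract s s' ∧ ∃ t ∈ M, s'.var xTop = t ∧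
      (∀ u ∈ M, s.arr aWeight u ≤ s.arr aWeight t) ∧
      k ≤ 250 * M.length + (∑ u ∈ M.toFinset.erase t, 41 * (nb u).length) + 100 ∧
      HoldsLog s' (L ++ contractEntries G M.toFinset (s.read aWeight) t (M.filter (· ≠ t))) ∧
      (∀ v : Fin n, s'.arr aMark v ≤ L.length + 1) ∧
      ∀ v : Fin n, s'.arr aDead v = if v ∈ M ∧ v ≠ t then 1 else s.arr aDead v) s := by
  have hn : 0 < n := (M.head hM0).pos
  obtain ⟨x0, M', hM'⟩ := List.exists_cons_of_ne_nil hM0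
  have hx0 : s.arr aList 0 = x0 := hlist 0 x0 (by simp [hM'])
  have hMn : M.length ≤ n := by simpa using hM.length_le_card
  have hlt : ∀ v : Fin n, (v : ℕ) < n := fun v => v.2
  refine wp_mono (wp_frame (Q := fun k s' => ∃ t ∈ M, s'.var xTop = t ∧
      (∀ u ∈ M, s.arr aWeight u ≤ s.arr aWeight t) ∧
      k ≤ 250 * M.length + (∑ u ∈ M.toFinset.erase t, 41 * (nb u).length) + 100 ∧
      HoldsLog s' (L ++ contractEntries G M.toFinset (s.read aWeight) t (M.filter (· ≠ t))) ∧
      (∀ v : Fin n, s'.arr aMark v ≤ L.length + 1) ∧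
      ∀ v : Fin n, s'.arr aDead v = if v ∈ M ∧ v ≠ t then 1 else s.arr aDead v) ?_)
    (fun k s' h => ⟨h.2, h.1⟩)
  rw [contract, wp_seq, wp_assign]
  simp only [Expr.eval, Expr.cost, hx0]
  refine ⟨by have := hlt x0; omega, ?_⟩
  -- the vertex of largest weight, and the marks
  rw [wp_seq]
  refine wp_mono (wp_forSeg M (fun u => (u : ℕ)) 0 (fun p s' =>
    (∃ t ∈ M, s'.var xTop = t ∧ (∀ u ∈ p, s.arr aWeight u ≤ s.arr aWeight t)) ∧
    ∀ v : Fin n, s'.arr aMark v = if v ∈ p then L.length + 1 else s.arr aMark v)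
    (fun _ => 20) rfl (by simp [Expr.eval, hsize]) (fun j x hj => by
      rw [zero_add]; exact hlist j x hj) (by omega) (fun v _ => by have := hlt v; omega) (by decide)
    (fun _ _ => ⟨⟨x0, by simp [hM'], by simp⟩, by simp⟩) ?_) ?_
  · rintro p x q s' hl - hF ⟨⟨t, ht, hst, hmax⟩, hmk⟩
    have hxn := hlt x
    have htn := hlt t
    have e1 : s'.arr aWeight = s.arr aWeight := by rw [hF.arr _ (by decide)]; rfl
    have e2 : s'.var xLog = L.length := by rw [hF.var _ (by decide)]; simpa using hL.length
    have hmk' : ∀ v : Fin n, Function.update (s'.arr aMark) x (L.length + 1) v =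
        if v ∈ p ++ [x] then L.length + 1 else s.arr aMark v := by
      intro v
      simp only [Function.update_apply, Fin.val_inj, List.mem_append, List.mem_singleton, hmk]
      split_ifs <;> tauto
    simp only [wp_seq, wp_assign, wp_store, wp_branch, wp_skip, Expr.eval, Expr.cost,
      State.setVar_var, State.setVar_arr, State.setArr_var, State.setArr_arr,
      ↓reduceIte, Nat.reduceEqDiff, e1, e2, hst]
    refine ⟨by omega, by omega, fun hx => ⟨by omega, by norm_num, fun _ => ⟨⟨x, by simp [hl], rfl,
      ?_⟩, hmk'⟩⟩, fun hx => ⟨by norm_num, fun _ => ⟨⟨t, ht, rfl, ?_⟩, hmk'⟩⟩⟩ <;>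
      simp only [ne_eq, ite_eq_right_iff, one_ne_zero, imp_false, not_not] at hx <;>
      intro u hu <;> rw [List.mem_append, List.mem_singleton] at hu <;>
      rcases hu with hu | rfl
    · exact (hmax u hu).trans hx.le
    · exact le_rfl
    · exact hmax u hu
    · omega
  rintro k1 s1 ⟨⟨⟨t, ht, hst1, hmax⟩, hmk1⟩, hF1, hk1⟩
  simp only [List.map_const', List.sum_replicate, Expr.cost, smul_eq_mul] at hk1
  have htn := hlt t
  have a0 : s1.arr 0 = st := by rw [hF1.arr _ (by decide), ← hs0]; rfl
  have a1 : s1.arr 1 = ad := by rw [hF1.arr _ (by decide), ← hs1]; rfl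
  have aW1 : s1.arr aWeight = s.arr aWeight := by rw [hF1.arr _ (by decide)]; rfl
  have aL1 : s1.arr aList = s.arr aList := by rw [hF1.arr _ (by decide)]; rfl
  have aD1 : s1.arr aDead = s.arr aDead := by rw [hF1.arr _ (by decide)]; rfl
  have hS1 : s1.var xSize = M.length := by rw [hF1.var _ (by decide)]; simpa using hsize
  have hL1 : HoldsLog s1 L := by
    refine HoldsLog.congr ?_ hF1 (by decide)
    exact ⟨by simpa using hL.length, hL.target, hL.source, hL.offset, hL.value⟩
  clear hF1
  -- the number of vertices of largest weight
  rw [wp_seq, wp_assign, wp_seq]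
  refine ⟨Nat.zero_le _, ?_⟩
  refine wp_mono (wp_forSeg M (fun u => (u : ℕ)) 0 (fun p s' =>
    s'.var xCount = p.countP fun u : Fin n => s.arr aWeight u = s.arr aWeight t)
    (fun _ => 10) rfl (by simp [Expr.eval, hS1]) (fun j x hj => by
      rw [zero_add, State.setVar_arr, aL1]; exact hlist j x hj) (by omega)
    (fun v _ => by have := hlt v; omega) (by decide) (by simp [Expr.eval]) ?_) ?_
  · intro p x q s' hl _ hF hp
    have e1 : s'.arr aWeight = s.arr aWeight := by rw [hF.arr _ (by decide)]; exact aW1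
    have e2 : s'.var xTop = t := by rw [hF.var _ (by decide)]; simpa using hst1
    have hlen := congrArg List.length hl
    simp only [List.length_append, List.length_cons] at hlen
    have hc1 := List.countP_le_length (l := p)
      (p := fun u : Fin n => s.arr aWeight u = s.arr aWeight t)
    simp only [wp_assign, Expr.eval, Expr.cost, State.setVar_var, State.setVar_arr,
      ↓reduceIte, Nat.reduceEqDiff, e1, e2, hp, List.countP_append, List.countP_singleton,
      decide_eq_true_eq]
    exact ⟨by split_ifs <;> omega, by norm_num, fun _ => trivial⟩
  rintro k2 s2 ⟨hcount, hF2, hk2⟩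
  simp only [List.map_const', List.sum_replicate, Expr.cost, smul_eq_mul] at hk2
  have hst2 : s2.var xTop = t := by rw [hF2.var _ (by decide)]; simpa using hst1
  have b0 : s2.arr 0 = st := by rw [hF2.arr _ (by decide), ← a0]; rfl
  have b1 : s2.arr 1 = ad := by rw [hF2.arr _ (by decide), ← a1]; rfl
  have aW2 : s2.arr aWeight = s.arr aWeight := by rw [hF2.arr _ (by decide)]; exact aW1
  have aL2 : s2.arr aList = s.arr aList := by rw [hF2.arr _ (by decide)]; exact aL1
  have aD2 : s2.arr aDead = s.arr aDead := by rw [hF2.arr _ (by decide)]; exact aD1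
  have aM2 : s2.arr aMark = s1.arr aMark := by rw [hF2.arr _ (by decide)]; rfl
  have hS2 : s2.var xSize = M.length := by rw [hF2.var _ (by decide)]; simpa using hS1
  have hL2 : HoldsLog s2 L := by
    refine HoldsLog.congr ?_ hF2 (by decide)
    exact ⟨by simpa using hL1.length, hL1.target, hL1.source, hL1.offset, hL1.value⟩
  clear hF2
  -- the entry of `t`
  rw [wp_seq, wp_assign, wp_seq]
  simp only [Expr.eval, Expr.cost, hL2.length]
  refine ⟨by omega, ?_⟩
  have hL2' : HoldsLog (s2.setVar xBase L.length) L :=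
    ⟨by simpa using hL2.length, hL2.target, hL2.source, hL2.offset, hL2.value⟩
  -- The value for `t` is known only after the other vertices have been scanned; a 0 reserves its
  -- place at index `xBase`.
  refine wp_mono (wp_record hL2' ⟨t, t, 0, 0⟩ (fun s' hv _ => ?_) (by omega) (by omega) (by simp)
    (by simp)) ?_
  · simp [Expr.eval, hv, hst2]
  rintro k3 s3 ⟨hL3, hF3, hk3⟩
  simp only [Expr.cost] at hk3
  have hst3 : s3.var xTop = t := by rw [hF3.var _ (by decide)]; simpa using hst2
  have hb3 : s3.var xBase = L.length := by rw [hF3.var _ (by decide)]; simp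
  have c0 : s3.arr 0 = st := by rw [hF3.arr _ (by decide), ← b0]; rfl
  have c1 : s3.arr 1 = ad := by rw [hF3.arr _ (by decide), ← b1]; rfl
  have aW3 : s3.arr aWeight = s.arr aWeight := by rw [hF3.arr _ (by decide)]; exact aW2
  have aL3 : s3.arr aList = s.arr aList := by rw [hF3.arr _ (by decide)]; exact aL2
  have aD3 : s3.arr aDead = s.arr aDead := by rw [hF3.arr _ (by decide)]; exact aD2
  have aM3 : s3.arr aMark = s1.arr aMark := by rw [hF3.arr _ (by decide)]; exact aM2
  have hS3 : s3.var xSize = M.length := by rw [hF3.var _ (by decide)]; simpa using hS2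
  have hC3 : s3.var xCount = M.countP fun u : Fin n => s.arr aWeight u = s.arr aWeight t := by
    rw [hF3.var _ (by decide)]; simpa using hcount
  clear hF3
  -- the other vertices
  rw [wp_seq, wp_assign, wp_seq]
  refine ⟨Nat.zero_le _, ?_⟩
  refine wp_mono (wp_forSeg M (fun u => (u : ℕ)) 0 (fun p s' =>
    s'.var xMax = G.weightedEccent p.toFinset (s.read aWeight) t ∧
    HoldsLog s' (L ++ ⟨t, t, 0, 0⟩ :: (p.filter (· ≠ t)).map fun u =>
      ⟨u, t, 0, G.weightedEccent M.toFinset (s.read aWeight) u⟩) ∧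
    ∀ v : Fin n, s'.arr aDead v = if v ∈ p ∧ v ≠ t then 1 else s.arr aDead v)
    (fun u => 140 + if u = t then 0 else 41 * (nb u).length) rfl (by simp [Expr.eval, hS3])
    (fun j x hj => by rw [zero_add, State.setVar_arr, aL3]; exact hlist j x hj) (by omega)
    (fun v _ => by have := hlt v; omega) (by decide) (fun _ _ => ⟨?_, ?_, ?_⟩) ?_) ?_
  · simp [Expr.eval, weightedEccent]
  · exact ⟨by simpa using hL3.length, hL3.target, hL3.source, hL3.offset, hL3.value⟩
  · simp [aD3]
  · rintro p x q s' hl - hF ⟨hmx, hLp, hdp⟩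
    have e1 : s'.arr aWeight = s.arr aWeight := by rw [hF.arr _ (by decide)]; exact aW3
    have e2 : s'.var xTop = t := by rw [hF.var _ (by decide)]; simpa using hst3
    have e3 : s'.var xBase = L.length := by rw [hF.var _ (by decide)]; simpa using hb3
    have e4 : s'.arr aMark = s1.arr aMark := by rw [hF.arr _ (by decide)]; exact aM3
    have e5 : s'.var xCount = M.countP fun u : Fin n => s.arr aWeight u = s.arr aWeight t := by
      rw [hF.var _ (by decide)]; simpa using hC3
    have e6 : s'.read aWeight = (s.read aWeight : Fin n → ℕ) := by
      ext v
      rw [State.read_apply, State.read_apply, e1]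
    rw [wp_branch]
    simp only [Expr.eval, Expr.cost, State.setVar_var, ↓reduceIte, Nat.reduceEqDiff, e2,
      Fin.val_inj]
    constructor
    · intro hxt
      have hxt : x = t := by simpa using hxt
      subst hxt
      rw [wp_skip]
      refine ⟨by omega, fun _ => ⟨?_, ?_, ?_⟩⟩
      · rw [weightedEccent_append_self]
        simpa using hmx
      · simp only [List.filter_append, ne_eq, not_true_eq_false, decide_false, Bool.false_eq_true,
          not_false_eq_true, List.filter_cons_of_neg, List.filter_nil, List.append_nil]
        exact ⟨by simpa using hLp.length, hLp.target, hLp.source, hLp.offset, hLp.value⟩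
      · intro v
        rw [State.setVar_arr, State.setVar_arr, hdp]
        simp only [List.mem_append, List.mem_singleton]
        split_ifs <;> tauto
    · intro hxt
      have hxt : x ≠ t := by simpa using hxt
      have hLp' : HoldsLog (s'.setVar xV x) (L ++ ⟨t, t, 0, 0⟩ :: (p.filter (· ≠ t)).map fun u =>
          ⟨u, t, 0, G.weightedEccent M.toFinset (s.read aWeight) u⟩) :=
        ⟨by simpa using hLp.length, hLp.target, hLp.source, hLp.offset, hLp.value⟩
      have hlen := congrArg List.length hl
      simp only [List.length_append, List.length_cons] at hlen
      have hfl := List.length_filter_le (fun u => decide (u ≠ t)) p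
      refine wp_mono (wp_remove hIn (t := t) (x := x) ?_ ?_ hM hLp' ht (by simp [hl]) hxt (by simp)
        (by simpa using e2) ?_ ?_ hd ?_ hW ?_ ?_ ?_) ?_
      · rw [State.setVar_arr, hF.arr _ (by decide), ← c0]; rfl
      · rw [State.setVar_arr, hF.arr _ (by decide), ← c1]; rfl
      · intro v
        have := hmark v
        simp only [State.setVar_arr, State.setVar_var, Nat.reduceEqDiff, ↓reduceIte, e3, e4, hmk1]
        split_ifs with h
        · simp [h]
        · simp only [h, iff_false]
          omega
      · intro u hu
        rw [State.setVar_arr, e1]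
        exact hmax u hu
      · rw [State.setVar_arr, e1]
        simpa using e5
      · simp only [List.length_append, List.length_cons, List.length_map]
        omega
      · rw [State.setVar_arr, e1]
        exact hwn t
      · rw [State.setVar_var, if_neg (by norm_num), e3]
        omega
      rintro k s'' ⟨-, hk, hL'', hD'', hX''⟩
      rw [State.read_setVar, e6] at hL''
      rw [State.setVar_var, if_neg (by norm_num), hmx, State.setVar_arr, e1] at hX''
      rw [State.setVar_arr] at hD''
      refine ⟨by rw [if_neg hxt]; omega, fun _ => ⟨?_, ?_, ?_⟩⟩
      · rw [weightedEccent_append_singleton _ _ _ hxt]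
        exact hX''
      · have : (p ++ [x]).filter (· ≠ t) = p.filter (· ≠ t) ++ [x] := by
          rw [List.filter_append, List.filter_cons_of_pos (by simpa using hxt), List.filter_nil]
        rw [this]
        simp only [List.map_append, List.map_cons, List.map_nil, List.append_assoc,
          List.cons_append] at hL'' ⊢
        exact ⟨by simpa using hL''.length, hL''.target, hL''.source, hL''.offset, hL''.value⟩
      · intro v
        simp only [State.setVar_arr, hD'', Function.update_apply, Fin.val_inj, hdp,
          List.mem_append, List.mem_singleton]
        split_ifs <;> grind
  rintro k4 s4 ⟨⟨hX4, hL4, hD4⟩, hF4, hk4⟩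
  have hst4 : s4.var xTop = t := by rw [hF4.var _ (by decide)]; simpa using hst3
  have hb4 : s4.var xBase = L.length := by rw [hF4.var _ (by decide)]; simpa using hb3
  have aM4 : s4.arr aMark = s1.arr aMark := by rw [hF4.arr _ (by decide)]; exact aM3
  have hXb : G.weightedEccent M.toFinset (s.read aWeight) t ≤ W := by
    refine weightedEccent_le fun u hu hut => ?_
    have h1 := hwn u
    rw [State.read_apply]
    rcases hd t ht u (by simpa using hu) hut.symm with h | h <;> omega
  have hsum : (M.map fun u => 140 + (if u = t then 0 else 41 * (nb u).length) + 11).sum =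
      151 * M.length + ∑ u ∈ M.toFinset.erase t, 41 * (nb u).length := by
    rw [← List.sum_toFinset _ hM]
    have : ∀ u ∈ M.toFinset, 140 + (if u = t then 0 else 41 * (nb u).length) + 11 =
        151 + if u = t then 0 else 41 * (nb u).length := fun u _ => by omega
    rw [Finset.sum_congr rfl this, Finset.sum_add_distrib, Finset.sum_const,
      List.toFinset_card_of_nodup hM, ← Finset.sum_erase_add _ _ (List.mem_toFinset.2 ht), if_pos rfl,
      add_zero, smul_eq_mul, mul_comm]
    congr 1
    exact Finset.sum_congr rfl fun u hu => if_neg (Finset.ne_of_mem_erase hu)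
  rw [hsum] at hk4
  simp only [Expr.cost] at hk4
  simp only [wp_store, Expr.eval, Expr.cost, State.setArr_var, hX4, hb4]
  refine ⟨by omega, hXb, t, ht, hst4, hmax, by omega, ⟨?_, ?_, ?_, ?_, ?_⟩, fun v => ?_, fun v => ?_⟩
  · simpa [contractEntries] using hL4.length
  · exact hL4.target.congr (by simp [contractEntries])
  · exact hL4.source.congr (by simp [contractEntries])
  · exact hL4.offset.congr (by simp [contractEntries])
  · exact hL4.value.replace ⟨t, t, 0, G.weightedEccent M.toFinset (s.read aWeight) t⟩
  · simp only [State.setArr_arr, Nat.reduceEqDiff, ↓reduceIte, aM4, hmk1]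
    have := hmark v
    split_ifs <;> omega
  · simpa using hD4 v

end

end RAM

namespace SimpleGraph

/-! ### Elimination of a class of vertices with the same down-neighbours -/

section

variable {V : Type*} [DecidableEq V] {G : SimpleGraph V} {r v y a : V} {U S A : Finset V}
  (hc : G.Connected) (hG : IsDistanceHereditary G) (hv : v ≠ r)
  (hlev : ∀ z ∈ U, G.dist r z ≤ G.dist r v)
  (hmin : ∀ z ∈ U, G.dist r z = G.dist r v → G.downNeighbors r z ⊆ G.downNeighbors r v →
    G.downNeighbors r z = G.downNeighbors r v)
  (hS : ∀ z, z ∈ S ↔ z ∈ U ∧ z ∈ G.downNeighbors r v)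
  (hA : ∀ z, z ∈ A ↔ z ∈ U ∧ G.dist r z = G.dist r v ∧ G.downNeighbors r z = G.downNeighbors r v)
  (hy : y ∈ S) (ha : a ∈ A)

include hc hG hv hlev hmin hS hA hy ha

/-- `A` is disjoint from `S`, being one level higher, so it is intact after the contraction of `S`.
After that contraction `y` is the only down-neighbour left, which makes the representative `a` of
`A` pendant at `y`. -/
theorem IsLog.eliminate [Fintype V] {L : List (Entry V)} {w : V → ℕ} (hL : G.IsLog L U w)
    (hwy : ∀ u ∈ S, w u ≤ w y) (hwa : ∀ u ∈ A, w u ≤ w a) {lS lA : List V}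
    (hlS : ∀ z, z ∈ lS ↔ z ∈ S.erase y) (hlA : ∀ z, z ∈ lA ↔ z ∈ A.erase a) :
    G.IsLog (((L ++ contractEntries G S w y lS) ++ contractEntries G A w a lA) ++
      [⟨y, y, 0, w a + 1⟩, ⟨a, y, 1, w y + 1⟩]) ((U \ S.erase y) \ A)
      (Function.update w y (max (w y) (w a + 1))) := by
  have hv0 : G.dist r v ≠ 0 := hc.dist_eq_zero_iff.not.2 hv.symm
  have hSA : ∀ {z}, z ∈ S → z ∉ A := fun {z} hz hz' => by
    have h1 := ((hS z).1 hz).2.2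
    have h2 := ((hA z).1 hz').2.1
    omega
  have h1 := hL.contract (M := S) (t := y) (l := lS) (fun z hz => ((hS z).1 hz).1) hy hwy
    (fun z hz u hu => by
      rw [Finset.mem_sdiff] at hz
      exact dist_eq_of_mem_downNeighbors_of_min hc hG hlev hmin hz.1
        (fun h => hz.2 ((hS z).2 ⟨hz.1, h⟩)) ((hS u).1 hu).2 ((hS y).1 hy).2) hlS
  have h2 := h1.contract (M := A) (t := a) (l := lA) (fun z hz => by
      rw [Finset.mem_sdiff]
      exact ⟨((hA z).1 hz).1, fun h => hSA (Finset.mem_of_mem_erase h) hz⟩) ha hwa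
    (fun z hz u hu => by
      rw [Finset.mem_sdiff, Finset.mem_sdiff] at hz
      exact dist_eq_of_min hc hG hlev hmin hz.1.1 (fun h => hz.2 ((hA z).2 ⟨hz.1.1, h⟩))
        ((hA u).1 hu).2.1 ((hA u).1 hu).2.2 ((hA a).1 ha).2.1 ((hA a).1 ha).2.2 hv0) hlA
  have hay : a ≠ y := by rintro rfl; exact hSA hy ha
  have h3 := h2.pendant (a := a) (y := y) (by
      have := hSA (z := a)
      have := ((hA a).1 ha).1
      simp only [Finset.mem_sdiff, Finset.mem_erase]
      tauto)
    (by
      have := hSA hy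
      have := ((hS y).1 hy).1
      simp only [Finset.mem_sdiff, Finset.mem_erase]
      tauto) hay (fun z hz hza => by
      simp only [Finset.mem_sdiff, Finset.mem_erase] at hz
      refine dist_eq_add_one_of_min hc hG hlev hmin hz.1.1 (fun h => hz.2 ⟨hza, (hA z).2
        ⟨hz.1.1, h⟩⟩) (fun h => ?_) ((hA a).1 ha).2.1 ((hA a).1 ha).2.2 ((hS y).1 hy).2
      have := (hS z).2 ⟨hz.1.1, h⟩
      tauto)
  have hU : ((U \ S.erase y) \ A.erase a).erase a = (U \ S.erase y) \ A := by
    ext z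
    simp only [Finset.mem_sdiff, Finset.mem_erase]
    by_cases hza : z = a
    · subst hza; tauto
    · tauto
  rwa [hU] at h3

-- This keeps later sets `S` non-empty. If the witness `s` for `z` is contracted to `y`, then `z`
-- and `v` share the down-neighbour `s`; by laminarity either `y` is a down-neighbour of `z` as
-- well, or minimality puts `z` into `A`.
omit hv ha in
theorem exists_mem_downNeighbors_of_eliminate
    (hdown : ∀ z ∈ U, z ≠ r → ∃ s ∈ U, s ∈ G.downNeighbors r z) {z : V}
    (hz : z ∈ (U \ S.erase y) \ A) (hzr : z ≠ r) :
    ∃ s ∈ (U \ S.erase y) \ A, s ∈ G.downNeighbors r z := by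
  simp only [Finset.mem_sdiff, Finset.mem_erase] at hz
  obtain ⟨s, hs, hsz⟩ := hdown z hz.1.1 hzr
  have h1 := hsz.2
  have h2 := hlev z hz.1.1
  have hsA : s ∉ A := fun h => by
    have := ((hA s).1 h).2.1
    omega
  by_cases hsS : s ∈ S.erase y
  · rw [Finset.mem_erase, hS] at hsS
    have h3 := hsS.2.2.2
    have hy' := (hS y).1 hy
    refine ⟨y, ?_, ?_⟩
    · simp only [Finset.mem_sdiff, Finset.mem_erase]
      refine ⟨⟨hy'.1, by tauto⟩, fun h => ?_⟩
      have := ((hA y).1 h).2.1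
      have := hy'.2.2
      omega
    · rcases downNeighbors_subset_or_subset hc hG (by omega) hsz hsS.2.2 with h | h
      · exact absurd ((hA z).2 ⟨hz.1.1, by omega, hmin z hz.1.1 (by omega) h⟩) hz.2
      · exact h hy'.2
  · exact ⟨s, by simp [hs, hsA]; simpa using hsS, hsz⟩

end

end SimpleGraph

namespace RAM

open Program SimpleGraph

/-! ### Collecting S and A from the adjacency lists and the buckets -/

section

variable {n : ℕ} {G : SimpleGraph (Fin n)} {st ad : ℕ → ℕ} {nb : Fin n → List (Fin n)}

/-- Collect the remaining down-neighbours of the vertex `xCur` in `aList`. -/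
def collectDown : Program :=
  .seq (.assign xSize (.const 0))
  (.scan xCur (.branch (.lt (.const 1) (.add
      (.eq (.add (.get aDepth (.var xU)) (.const 1)) (.get aDepth (.var xCur)))
      (.eq (.get aDead (.var xU)) (.const 0))))
    (.seq (.store aList (.var xSize) (.var xU))
    (.assign xSize (.add (.var xSize) (.const 1)))) .skip))

theorem wp_collectDown (hIn : Input G st ad nb) {r : Fin n} {W : ℕ} {s : State}
    (hs0 : s.arr 0 = st) (hs1 : s.arr 1 = ad)
    (hdep : ∀ v : Fin n, s.arr aDepth v = G.dist r v + 1) {U : Finset (Fin n)}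
    (hU : ∀ v : Fin n, s.arr aDead v = 0 ↔ v ∈ U) {v : Fin n} (hv : s.var xCur = v)
    (hW : 10 * n + 2 * G.edgeSet.ncard ≤ W) :
    wp W collectDown (fun k s' => Frame collectDown s s' ∧ k ≤ 40 * (nb v).length + 20 ∧
      ∃ S : List (Fin n), S.Nodup ∧ (∀ z, z ∈ S ↔ z ∈ U ∧ z ∈ G.downNeighbors r v) ∧
        S.length ≤ (nb v).length ∧
        s'.var xSize = S.length ∧ Holds (s'.arr aList) (fun u : Fin n => (u : ℕ)) S) s := by
  classical
  refine wp_mono (wp_frame (Q := fun k s' => k ≤ 40 * (nb v).length + 20 ∧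
      ∃ S : List (Fin n), S.Nodup ∧ (∀ z, z ∈ S ↔ z ∈ U ∧ z ∈ G.downNeighbors r v) ∧
        S.length ≤ (nb v).length ∧
        s'.var xSize = S.length ∧ Holds (s'.arr aList) (fun u : Fin n => (u : ℕ)) S) ?_)
    (fun k s' h => ⟨h.2, h.1⟩)
  have hdeg : (nb v).length ≤ n := by simpa using (hIn.nodup v).length_le_card
  simp only [collectDown, wp_seq, wp_assign, Expr.eval, Expr.cost]
  refine ⟨by omega, wp_mono (wp_scan hIn v (fun l s' =>
    s'.var xSize = (l.filter fun u => G.dist r u + 1 = G.dist r v ∧ u ∈ U).length ∧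
    Holds (s'.arr aList) (fun u : Fin n => (u : ℕ))
      (l.filter fun u => G.dist r u + 1 = G.dist r v ∧ u ∈ U)) 29 (by simpa using hs0)
    (by simpa using hs1) (by simpa using hv) (by decide) (by omega)
    (fun _ _ => ⟨by simp, Holds.nil⟩) ?_) ?_⟩
  · rintro p u q s' hl hF ⟨h1, h2⟩
    have e1 : s'.arr aDepth = s.arr aDepth := by rw [hF.arr _ (by decide)]; rfl
    have e2 : s'.arr aDead = s.arr aDead := by rw [hF.arr _ (by decide)]; rfl
    have e3 : s'.var xCur = v := by rw [hF.var _ (by decide)]; simpa using hv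
    have hlen := congrArg List.length hl
    simp only [List.length_append, List.length_cons] at hlen
    have hfl := List.length_filter_le
      (fun u : Fin n => decide (G.dist r u + 1 = G.dist r v ∧ u ∈ U)) p
    have hu := u.2
    simp only [wp_branch, wp_seq, wp_assign, wp_store, wp_skip, Expr.eval, Expr.cost,
      State.setVar_var, State.setVar_arr, State.setArr_var, State.setArr_arr,
      ↓reduceIte, Nat.reduceEqDiff, e1, e2, e3, hdep, hU, h1, List.filter_append]
    -- The test `1 < b + c` on two truth values is their conjunction.
    constructor
    · intro h
      have h' : G.dist r u + 1 = G.dist r v ∧ u ∈ U := by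
        by_contra hneg
        apply h
        rw [if_neg]
        split_ifs <;> first | omega | (exfalso; apply hneg; constructor <;> [omega; assumption])
      rw [List.filter_cons_of_pos (by simpa using h'), List.filter_nil]
      exact ⟨by omega, by omega, by omega, by norm_num, fun _ => ⟨by simp, h2.push u⟩⟩
    · intro h
      have h' : ¬ (G.dist r u + 1 = G.dist r v ∧ u ∈ U) := by
        rintro ⟨h3, h4⟩
        rw [if_pos (by simp [h3, h4])] at h
        omega
      rw [List.filter_cons_of_neg (by simpa using h'), List.filter_nil, List.append_nil]
      exact ⟨by norm_num, fun _ => ⟨rfl, h2⟩⟩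
  · rintro k s' ⟨⟨h1, h2⟩, -, hk⟩
    refine ⟨by omega, _, (hIn.nodup v).filter _, fun z => ?_, List.length_filter_le _ _, h1, h2⟩
    simp only [List.mem_filter, hIn.mem, decide_eq_true_eq, mem_downNeighbors, G.adj_comm v z]
    tauto

/-- Collect the remaining vertices at the start of the list `xCur` that have the same parent in
`aList`, and advance in the list. -/
def collectClass : Program :=
  .seq (.assign xSize (.const 0))
  (.seq (.assign xPar (.get aPar (.var xCur)))
  (.loop (.lt (.const 1) (.add (.lt (.const 0) (.var xCur))
      (.eq (.get aPar (.var xCur)) (.var xPar))))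
    (.seq (.branch (.eq (.get aDead (.var xCur)) (.const 0))
      (.seq (.store aList (.var xSize) (.var xCur))
      (.assign xSize (.add (.var xSize) (.const 1)))) .skip)
    (.assign xCur (.get aNext (.var xCur))))))

theorem IsChain.le {next : ℕ → ℕ} {x : ℕ} {l : List (Fin n)} (h : IsChain next x l) : x ≤ n := by
  cases l with
  | nil => rw [h]; omega
  | cons v l => rw [h.1]; exact v.2.le

/-- `p` is the longest initial block with the parent of `v`. It may contain vertices removed
earlier, which are passed over, so the time is measured by `p.length` and not by the number of
vertices collected. -/
theorem wp_collectClass {W : ℕ} {s : State} {U : Finset (Fin n)}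
    (hU : ∀ v : Fin n, s.arr aDead v = 0 ↔ v ∈ U) {v : Fin n} {c : List (Fin n)}
    (hcn : (v :: c).Nodup) (hc0 : ∀ u ∈ v :: c, (u : ℕ) ≠ 0)
    (hch : IsChain (s.arr aNext) (s.var xCur) (v :: c)) (hpar : s.arr aPar v ≤ n)
    (hW : 10 * n ≤ W) :
    wp W collectClass (fun k s' => Frame collectClass s s' ∧
      ∃ p rest : List (Fin n), v :: c = p ++ rest ∧ p ≠ [] ∧ k ≤ 60 * p.length + 30 ∧
        (∀ u ∈ p, s.arr aPar u = s.arr aPar v) ∧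
        (∀ u rest', rest = u :: rest' → s.arr aPar u ≠ s.arr aPar v) ∧
        IsChain (s.arr aNext) (s'.var xCur) rest ∧
        s'.var xSize = (p.filter (· ∈ U)).length ∧
        Holds (s'.arr aList) (fun u : Fin n => (u : ℕ)) (p.filter (· ∈ U))) s := by
  refine wp_mono (wp_frame (Q := fun k s' =>
      ∃ p rest : List (Fin n), v :: c = p ++ rest ∧ p ≠ [] ∧ k ≤ 60 * p.length + 30 ∧
        (∀ u ∈ p, s.arr aPar u = s.arr aPar v) ∧
        (∀ u rest', rest = u :: rest' → s.arr aPar u ≠ s.arr aPar v) ∧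
        IsChain (s.arr aNext) (s'.var xCur) rest ∧
        s'.var xSize = (p.filter (· ∈ U)).length ∧
        Holds (s'.arr aList) (fun u : Fin n => (u : ℕ)) (p.filter (· ∈ U))) ?_)
    (fun k s' h => ⟨h.2, h.1⟩)
  have hcur : s.var xCur = v := hch.1
  have hlen : (v :: c).length ≤ n := by simpa using hcn.length_le_card
  rw [collectClass, wp_seq, wp_assign, wp_seq, wp_assign]
  simp only [Expr.eval, Expr.cost, State.setVar_arr, State.setVar_var, ↓reduceIte,
    Nat.reduceEqDiff, hcur]
  refine ⟨by omega, by omega, wp_mono (wp_loop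
    (fun (a : List (Fin n) × List (Fin n)) s' => v :: c = a.1 ++ a.2 ∧
      (∀ u ∈ a.1, s.arr aPar u = s.arr aPar v) ∧ IsChain (s.arr aNext) (s'.var xCur) a.2 ∧
      s'.var xSize = (a.1.filter (· ∈ U)).length ∧
      Holds (s'.arr aList) (fun u : Fin n => (u : ℕ)) (a.1.filter (· ∈ U)))
    (fun a => 60 * a.2.length) ([], v :: c) ⟨rfl, by simp, by simpa using hch, by simp, Holds.nil⟩
    ?_) ?_⟩
  · rintro ⟨p, rest⟩ s' ⟨h1, h2, h3, h4, h5⟩ hF hb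
    simp only at h1 h2 h3 h4 h5
    have e1 : s'.arr aPar = s.arr aPar := by rw [hF.arr _ (by decide)]; rfl
    have e2 : s'.var xPar = s.arr aPar v := by rw [hF.var _ (by decide)]; simp
    have e3 : s'.arr aDead = s.arr aDead := by rw [hF.arr _ (by decide)]; rfl
    have e4 : s'.arr aNext = s.arr aNext := by rw [hF.arr _ (by decide)]; rfl
    cases rest with
    | nil =>
      rw [IsChain] at h3
      simp only [Expr.eval, h3] at hb
      split_ifs at hb <;> omega
    | cons u rest =>
      have hl := congrArg List.length h1
      simp only [List.length_append, List.length_cons] at hl hlen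
      have hfl := List.length_filter_le (fun u : Fin n => decide (u ∈ U)) p
      have hun := u.2
      have hup : s.arr aPar u = s.arr aPar v := by
        by_contra hne
        simp only [Expr.eval, h3.1, e1, e2, if_neg hne] at hb
        split_ifs at hb <;> omega
      have h2' : ∀ z ∈ p ++ [u], s.arr aPar z = s.arr aPar v := by
        intro z hz
        rw [List.mem_append, List.mem_singleton] at hz
        rcases hz with hz | rfl
        · exact h2 z hz
        · exact hup
      have hnx := h3.2.le
      simp only [wp_branch, wp_seq, wp_assign, wp_store, wp_skip, Expr.eval, Expr.cost,
        State.setVar_var, State.setVar_arr, State.setArr_var, State.setArr_arr,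
        ↓reduceIte, Nat.reduceEqDiff, e3, e4, h3.1, hU, h4]
      constructor
      · intro h
        have h' : u ∈ U := by simpa using h
        refine ⟨by omega, by omega, by omega, by omega, (p ++ [u], rest), ⟨by simpa using h1, h2',
          h3.2, ?_, ?_⟩, ?_⟩
        · simp [List.filter_append, h']
        · rw [List.filter_append, List.filter_cons_of_pos (by simpa using h'), List.filter_nil]
          exact h5.push u
        · simp only [List.length_cons]
          omega
      · intro h
        have h' : u ∉ U := by simpa using h
        refine ⟨by omega, (p ++ [u], rest), ⟨by simpa using h1, h2', h3.2, ?_, ?_⟩, ?_⟩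
        · simp [List.filter_append, h']
        · rw [List.filter_append, List.filter_cons_of_neg (by simpa using h'), List.filter_nil,
            List.append_nil]
          exact h5
        · simp only [List.length_cons]
          omega
  · rintro k s' ⟨⟨p, rest⟩, ⟨h1, h2, h3, h4, h5⟩, hF, hb, hk⟩
    simp only at h1 h2 h3 h4 h5 hk
    have e1 : s'.arr aPar = s.arr aPar := by rw [hF.arr _ (by decide)]; rfl
    have e2 : s'.var xPar = s.arr aPar v := by rw [hF.var _ (by decide)]; simp
    have hrest : ∀ u rest', rest = u :: rest' → s.arr aPar u ≠ s.arr aPar v := by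
      rintro u rest' rfl hup
      have hu0 := hc0 u (h1 ▸ by simp)
      simp only [Expr.eval, h3.1, e1, e2, if_pos hup] at hb
      rw [if_pos (show 0 < (u : ℕ) by omega)] at hb
      simp at hb
    have hl := congrArg List.length h1
    rw [List.length_append] at hl
    refine ⟨p, rest, h1, ?_, ?_, h2, hrest, h3, h4, h5⟩
    · rintro rfl
      exact hrest v c (by simpa using h1.symm) rfl
    · simp only [Expr.cost] at hk
      omega

end

/-! ### Largest remaining key: highest level and minimal down-neighbours -/

section

variable {V : Type*} [Fintype V] {G : SimpleGraph V} {r v : V} {d : ℕ} {U : Finset V} {c : List V}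
  (hc : G.Connected) (hkey : ∀ z ∈ c, z ≠ r ∧ key G r z = d)
  (hlive : ∀ z ∈ U, z ≠ r → key G r z < d ∨ z ∈ c) (hv : v ∈ c)

include hc hkey hlive hv

theorem dist_le_of_key_le {z : V} (hz : z ∈ U) : G.dist r z ≤ G.dist r v := by
  have h1 := hkey v hv
  by_cases hzr : z = r
  · simp [hzr]
  by_contra! h
  have h2 := key_lt_key_of_dist_lt hc h1.1 h
  rcases hlive z hz hzr with h3 | h3
  · omega
  · have := (hkey z h3).2
    omega

theorem downNeighbors_eq_of_key_le {z : V} (hz : z ∈ U) (hd : G.dist r z = G.dist r v)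
    (hN : G.downNeighbors r z ⊆ G.downNeighbors r v) :
    G.downNeighbors r z = G.downNeighbors r v := by
  have h1 := hkey v hv
  have hzr : z ≠ r := by
    rintro rfl
    rw [dist_self] at hd
    exact h1.1 (hc.dist_eq_zero_iff.1 hd.symm).symm
  by_contra hne
  have h2 := key_lt_key_of_ssubset hc hd (hN.ssubset_of_ne hne)
  rcases hlive z hz hzr with h3 | h3
  · omega
  · have := (hkey z h3).2
    omega

end

section

variable {n : ℕ} {G : SimpleGraph (Fin n)} {st ad : ℕ → ℕ} {nb : Fin n → List (Fin n)}

/-- Vertices with the same key and the same parent in a breadth-first search have the same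
down-neighbours. -/
theorem IsBFS.mem_iff_of_par_eq {r v : Fin n} {q : List (Fin n)} {dep par : Fin n → ℕ}
    (hB : IsBFS G r q dep par q.length) (hc : G.Connected) (hG : IsDistanceHereditary G)
    {d : ℕ} {U : Finset (Fin n)} {c p rest : List (Fin n)}
    (hsuf : v :: c <:+ (q.tail.filter fun v => key G r v = d).reverse)
    (hkey : ∀ z ∈ v :: c, z ≠ r ∧ key G r z = d)
    (hlive : ∀ z ∈ U, z ≠ r → key G r z < d ∨ z ∈ v :: c) (hl : v :: c = p ++ rest) (hp0 : p ≠ [])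
    (hp : ∀ u ∈ p, par u = par v) (hrest : ∀ u rest', rest = u :: rest' → par u ≠ par v)
    {z : Fin n} (hz : z ∈ U) :
    z ∈ p ↔ G.dist r z = G.dist r v ∧ G.downNeighbors r z = G.downNeighbors r v := by
  have hv := hkey v (by simp)
  constructor
  · intro hzp
    have hz' := hkey z (by rw [hl]; simp [hzp])
    obtain ⟨x, hx, hxz⟩ := hB.exists_parent hc hz'.1
    obtain ⟨x', hx', hxv⟩ := hB.exists_parent hc hv.1
    rw [hp z hzp, hx'] at hx
    obtain rfl := Option.some.inj hx
    have hk := hz'.2.trans hv.2.symm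
    exact ⟨dist_eq_of_key_eq hc hz'.1 hv.1 hk, downNeighbors_eq_of_key_eq hc hG hz'.1 hv.1 hk hxz hxv⟩
  · rintro ⟨hd, hN⟩
    have hzr : z ≠ r := by
      rintro rfl
      rw [dist_self] at hd
      exact hv.1 (hc.dist_eq_zero_iff.1 hd.symm).symm
    have hk := key_eq_of_downNeighbors_eq hc hd hN
    have hzc : z ∈ v :: c := (hlive z hz hzr).resolve_left (by omega)
    have hpar := hB.par_eq hc hzr hv.1 hN
    rw [hl, List.mem_append] at hzc
    refine hzc.resolve_right fun hzrest => ?_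
    -- Along a bucket the positions of the parents decrease weakly; once the parent differs from
    -- that of `v`, it never returns.
    have hpw : (v :: c).Pairwise fun u w => par w ≤ par u :=
      List.Pairwise.sublist hsuf.sublist (List.pairwise_reverse.2 (hB.pairwise_par.filter _))
    obtain ⟨v', p', rfl⟩ := List.exists_cons_of_ne_nil hp0
    obtain rfl : v = v' := by simpa using congrArg List.head? hl
    cases rest with
    | nil => simp at hzrest
    | cons u rest =>
      rw [hl, List.pairwise_append] at hpw
      have h1 := hpw.2.2 v (by simp) u (by simp)
      refine hrest u rest rfl (le_antisymm h1 ?_)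
      rcases List.mem_cons.1 hzrest with rfl | h
      · exact hpar.ge
      · have := (List.pairwise_cons.1 hpw.2.1).1 z h
        omega

/-- Remove the vertex `xTop`, which is pendant at `xLow`. -/
def attach : Program :=
  .seq (record (.var xLow) (.var xLow) (.const 0) (.add (.get aWeight (.var xTop)) (.const 1)))
  (.seq (record (.var xTop) (.var xLow) (.const 1) (.add (.get aWeight (.var xLow)) (.const 1)))
  (.seq (.store aDead (.var xTop) (.const 1))
  (.branch (.lt (.get aWeight (.var xLow)) (.add (.get aWeight (.var xTop)) (.const 1)))
    (.store aWeight (.var xLow) (.add (.get aWeight (.var xTop)) (.const 1))) .skip)))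

theorem wp_attach {W : ℕ} {s : State} {L : List (Entry (Fin n))} (hL : HoldsLog s L) {a y : Fin n}
    (ha : s.var xTop = a) (hy : s.var xLow = y) (hW : 10 * n ≤ W) (hLn : L.length + 2 ≤ 5 * n)
    (hwn : ∀ v : Fin n, s.arr aWeight v ≤ n) :
    wp W attach (fun k s' => Frame attach s s' ∧ k ≤ 100 ∧
      HoldsLog s' (L ++ [⟨y, y, 0, s.read aWeight a + 1⟩, ⟨a, y, 1, s.read aWeight y + 1⟩]) ∧
      s'.arr aDead = Function.update (s.arr aDead) a 1 ∧
      (s'.read aWeight : Fin n → ℕ) = Function.update (s.read aWeight) y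
        (max (s.read aWeight y) (s.read aWeight a + 1))) s := by
  have hn := a.2
  have hn' := y.2
  have hwa := hwn a
  have hwy := hwn y
  refine wp_mono (wp_frame (Q := fun k s' => k ≤ 100 ∧
      HoldsLog s' (L ++ [⟨y, y, 0, s.read aWeight a + 1⟩, ⟨a, y, 1, s.read aWeight y + 1⟩]) ∧
      s'.arr aDead = Function.update (s.arr aDead) a 1 ∧
      (s'.read aWeight : Fin n → ℕ) = Function.update (s.read aWeight) y
        (max (s.read aWeight y) (s.read aWeight a + 1))) ?_) (fun k s' h => ⟨h.2, h.1⟩)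
  rw [attach, wp_seq]
  refine wp_mono (wp_record hL ⟨y, y, 0, s.read aWeight a + 1⟩ (fun s' hv h => by
    simp [Expr.eval, hv, h, ha, hy, State.read_apply]) (by omega) (by omega) (by simp)
    (by simp only [State.read_apply]; omega)) ?_
  rintro k1 s1 ⟨hL1, hF1, hk1⟩
  have ha1 : s1.var xTop = a := by rw [hF1.var _ (by decide)]; exact ha
  have hy1 : s1.var xLow = y := by rw [hF1.var _ (by decide)]; exact hy
  have hw1 : s1.arr aWeight = s.arr aWeight := hF1.arr _ (by decide)
  have hd1 : s1.arr aDead = s.arr aDead := hF1.arr _ (by decide)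
  rw [wp_seq]
  refine wp_mono (wp_record hL1 ⟨a, y, 1, s.read aWeight y + 1⟩ (fun s' hv h => by
    simp [Expr.eval, hv, h, ha1, hy1, hw1, State.read_apply]) (by omega)
    (by simp only [List.length_append, List.length_singleton]; omega) (by simp; omega)
    (by simp only [State.read_apply]; omega)) ?_
  rintro k2 s2 ⟨hL2, hF2, hk2⟩
  have ha2 : s2.var xTop = a := by rw [hF2.var _ (by decide)]; exact ha1
  have hy2 : s2.var xLow = y := by rw [hF2.var _ (by decide)]; exact hy1
  have hw2 : s2.arr aWeight = s.arr aWeight := (hF2.arr _ (by decide)).trans hw1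
  have hd2 : s2.arr aDead = s.arr aDead := (hF2.arr _ (by decide)).trans hd1
  rw [List.append_assoc] at hL2
  simp only [Expr.cost] at hk1 hk2
  simp only [wp_seq, wp_store, wp_branch, wp_skip, Expr.eval, Expr.cost, State.setArr_var,
    State.setArr_arr, ha2, hy2, hw2, hd2, ↓reduceIte, Nat.reduceEqDiff]
  have hr : (s2.read aWeight : Fin n → ℕ) = s.read aWeight := by
    ext v
    rw [State.read_apply, State.read_apply, hw2]
  refine ⟨by omega, by omega, fun h => ⟨by omega, by omega, by omega,
    ⟨hL2.length, hL2.target, hL2.source, hL2.offset, hL2.value⟩, trivial, ?_⟩,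
    fun h => ⟨by omega, ⟨hL2.length, hL2.target, hL2.source, hL2.offset, hL2.value⟩, trivial, ?_⟩⟩
  · have h' : s.arr aWeight y < s.arr aWeight a + 1 := by
      by_contra h'
      simp [h'] at h
    rw [State.read_setArr, if_pos rfl, State.read_setArr_of_ne _ _ _ _ _ (by norm_num), hr]
    congr 1
    simp only [State.read_apply]
    omega
  · have h' : s.read aWeight a + 1 ≤ s.read aWeight y := by
      simp only [State.read_apply]
      by_contra h'
      rw [if_pos (by omega)] at h
      omega
    rw [State.read_setArr_of_ne _ _ _ _ _ (by norm_num), hr, max_eq_left h',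
      Function.update_eq_self]

/-- Eliminate the remaining vertices with the same down-neighbours as `xCur`. -/
def step : Program :=
  .seq collectDown (.seq contract (.seq (.assign xLow (.var xTop))
  (.seq collectClass (.seq contract attach))))

theorem length_contractEntries {V : Type*} [DecidableEq V] (G : SimpleGraph V) {M : List V}
    (hM : M.Nodup) (w : V → ℕ) {t : V} (ht : t ∈ M) :
    (contractEntries G M.toFinset w t (M.filter (· ≠ t))).length = M.length := by
  have h1 := M.toFinset_card_of_nodup hM
  have h2 : M.filter (· ≠ t) = M.erase t := by
    rw [hM.erase_eq_filter]
    exact List.filter_congr fun x _ => by by_cases h : x = t <;> simp [h]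
  rw [contractEntries, List.length_cons, List.length_map, h2, List.length_erase_of_mem ht]
  have := List.length_pos_of_mem ht
  omega

/-- All scans are paid by removed vertices: `S` without `y`, and the whole of `A`. Stepping through
`p` is left to a separate charge, because `p` may consist largely of vertices removed before. -/
theorem wp_step (hIn : Input G st ad nb) {W : ℕ} {s : State} (hs0 : s.arr 0 = st)
    (hs1 : s.arr 1 = ad) (hc : G.Connected) {r v : Fin n}
    (hdep : ∀ v : Fin n, s.arr aDepth v = G.dist r v + 1) {U : Finset (Fin n)}
    (hU : ∀ v : Fin n, s.arr aDead v = 0 ↔ v ∈ U) {c : List (Fin n)} (hcn : (v :: c).Nodup)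
    (hc0 : ∀ u ∈ v :: c, (u : ℕ) ≠ 0) (hch : IsChain (s.arr aNext) (s.var xCur) (v :: c))
    (hpar : s.arr aPar v ≤ n) {L : List (Entry (Fin n))} (hL : HoldsLog s L)
    (hLn : L.length + 4 * U.card ≤ 4 * n) (hmark : ∀ v : Fin n, s.arr aMark v ≤ L.length)
    (hwn : ∀ v : Fin n, s.arr aWeight v ≤ n) (hW : 10 * n + 2 * G.edgeSet.ncard ≤ W)
    (hvU : v ∈ U) (hdown : ∃ u ∈ U, u ∈ G.downNeighbors r v)
    (hclass : ∀ p rest : List (Fin n), v :: c = p ++ rest → p ≠ [] →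
      (∀ u ∈ p, s.arr aPar u = s.arr aPar v) →
      (∀ u rest', rest = u :: rest' → s.arr aPar u ≠ s.arr aPar v) →
      ∀ z ∈ U, z ∈ p ↔ G.dist r z = G.dist r v ∧ G.downNeighbors r z = G.downNeighbors r v) :
    wp W step (fun k s' => ∃ (S A p rest : List (Fin n)) (y a : Fin n), v :: c = p ++ rest ∧
      S.Nodup ∧ A.Nodup ∧ y ∈ S ∧ a ∈ A ∧ p ≠ [] ∧ (∀ z ∈ U, z ∈ p → z ∈ A) ∧
      (∀ z, z ∈ S ↔ z ∈ U ∧ z ∈ G.downNeighbors r v) ∧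
      (∀ z, z ∈ A ↔ z ∈ U ∧ G.dist r z = G.dist r v ∧
        G.downNeighbors r z = G.downNeighbors r v) ∧
      (∀ u ∈ S, s.read aWeight u ≤ s.read aWeight y) ∧
      (∀ u ∈ A, s.read aWeight u ≤ s.read aWeight a) ∧
      (∀ x ∈ S, ∀ y ∈ S, x ≠ y → G.dist x y = 1 ∨ G.dist x y = 2) ∧
      (∀ x ∈ A, ∀ y ∈ A, x ≠ y → G.dist x y = 1 ∨ G.dist x y = 2) ∧
      (∀ z : Fin n, s'.arr aDead z = 0 ↔ z ∈ (U \ S.toFinset.erase y) \ A.toFinset) ∧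
      IsChain (s.arr aNext) (s'.var xCur) rest ∧
      HoldsLog s' (((L ++ contractEntries G S.toFinset (s.read aWeight) y (S.filter (· ≠ y))) ++
        contractEntries G A.toFinset (s.read aWeight) a (A.filter (· ≠ a))) ++
        [⟨y, y, 0, s.read aWeight a + 1⟩, ⟨a, y, 1, s.read aWeight y + 1⟩]) ∧
      (s'.read aWeight : Fin n → ℕ) = Function.update (s.read aWeight) y
        (max (s.read aWeight y) (s.read aWeight a + 1)) ∧
      (∀ z : Fin n, s'.arr aMark z ≤ L.length + S.length + 1) ∧
      k + (900 * ∑ u ∈ (U \ S.toFinset.erase y) \ A.toFinset, ((nb u).length + 1)) ≤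
        900 * (∑ u ∈ U, ((nb u).length + 1)) + 60 * p.length) s := by
  have hn : 0 < n := v.pos
  rw [step, wp_seq]
  refine wp_mono (wp_collectDown hIn hs0 hs1 hdep hU hch.1 hW) ?_
  rintro k1 s1 ⟨hF1, hk1, S, hSn, hS, hSlen, hsz1, hl1⟩
  obtain ⟨u0, hu0, hu0v⟩ := hdown
  have hS0 : S ≠ [] := List.ne_nil_of_mem ((hS u0).2 ⟨hu0, hu0v⟩)
  have hScard : S.length ≤ U.card := by
    rw [← List.toFinset_card_of_nodup hSn]
    exact Finset.card_le_card fun z hz => ((hS z).1 (List.mem_toFinset.1 hz)).1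
  have hUpos : 0 < U.card := Finset.card_pos.2 ⟨v, hvU⟩
  have hSd : ∀ x ∈ S, ∀ y ∈ S, x ≠ y → G.dist x y = 1 ∨ G.dist x y = 2 := by
    classical
    intro x hx y hy hxy
    have := dist_eq_ite_of_adj hc ((hS x).1 hx).2.1.symm ((hS y).1 hy).2.1.symm hxy
    split_ifs at this <;> tauto
  have hw1 : s1.arr aWeight = s.arr aWeight := hF1.arr _ (by decide)
  have hL1 : HoldsLog s1 L := hL.congr hF1 (by decide)
  rw [wp_seq]
  refine wp_mono (wp_contract hIn (by rw [hF1.arr _ (by decide), hs0])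
    (by rw [hF1.arr _ (by decide), hs1]) hSn hS0 hL1 hsz1 hl1
    (fun v => by rw [hF1.arr _ (by decide)]; exact hmark v) hSd hW (by omega)
    (fun v => by rw [hw1]; exact hwn v)) ?_
  rintro k2 s2 ⟨hF2, y, hyS, hy2, hymax, hk2, hL2, hm2, hd2⟩
  have hr1 : (s1.read aWeight : Fin n → ℕ) = s.read aWeight := by
    ext v
    rw [State.read_apply, State.read_apply, hw1]
  have hw2 : s2.arr aWeight = s.arr aWeight := (hF2.arr _ (by decide)).trans hw1
  have hp2 : s2.arr aPar = s.arr aPar :=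
    (hF2.arr _ (by decide)).trans (hF1.arr _ (by decide))
  have hn2 : s2.arr aNext = s.arr aNext :=
    (hF2.arr _ (by decide)).trans (hF1.arr _ (by decide))
  rw [hr1] at hL2
  rw [hw1] at hymax
  have hU2 : ∀ z : Fin n, s2.arr aDead z = 0 ↔ z ∈ U \ S.toFinset.erase y := by
    intro z
    rw [hd2, hF1.arr aDead (by decide)]
    simp only [Finset.mem_sdiff, Finset.mem_erase, List.mem_toFinset, ← hU]
    split_ifs <;> tauto
  rw [wp_seq, wp_assign]
  simp only [Expr.eval, Expr.cost, hy2]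
  refine ⟨by have := y.2; omega, ?_⟩
  rw [wp_seq]
  refine wp_mono (wp_collectClass (s := s2.setVar xLow y) hU2 hcn hc0 (c := c) (v := v) ?_ ?_
    (by omega)) ?_
  · rw [State.setVar_arr, hn2, State.setVar_var, if_neg (by norm_num), hF2.var _ (by decide),
      hF1.var _ (by decide)]
    exact hch
  · rw [State.setVar_arr, hp2]
    exact hpar
  rintro k3 s3 ⟨hF3, p, rest, hl, hp0, hk3, hpp, hprest, hch3, hsz3, hl3⟩
  rw [State.setVar_arr, hp2] at hpp hprest
  rw [State.setVar_arr, hn2] at hch3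
  have hcl := hclass p rest hl hp0 hpp hprest
  set A := p.filter (· ∈ U \ S.toFinset.erase y) with hAdef
  -- The contraction of `S` takes nothing away from the class, since `S` lies one level lower.
  have hA : ∀ z, z ∈ A ↔ z ∈ U ∧ G.dist r z = G.dist r v ∧
      G.downNeighbors r z = G.downNeighbors r v := by
    intro z
    simp only [hAdef, List.mem_filter, decide_eq_true_eq, Finset.mem_sdiff, Finset.mem_erase,
      List.mem_toFinset, hS]
    constructor
    · rintro ⟨h1, h2, -⟩
      exact ⟨h2, (hcl z h2).1 h1⟩
    · rintro ⟨h1, h2⟩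
      refine ⟨(hcl z h1).2 h2, h1, fun h => ?_⟩
      have := h.2.2.2
      omega
  have hpn : p.Nodup := (List.nodup_append.1 (hl ▸ hcn)).1
  have hAn : A.Nodup := hpn.filter _
  have hvA : v ∈ A := (hA v).2 ⟨hvU, rfl, rfl⟩
  have hAcard : S.length + A.length ≤ U.card := by
    rw [← List.toFinset_card_of_nodup hSn, ← List.toFinset_card_of_nodup hAn,
      ← Finset.card_union_of_disjoint]
    · refine Finset.card_le_card fun z hz => ?_
      rw [Finset.mem_union, List.mem_toFinset, List.mem_toFinset] at hz
      rcases hz with h | h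
      · exact ((hS z).1 h).1
      · exact ((hA z).1 h).1
    · rw [Finset.disjoint_left]
      intro z hz hz'
      have h1 := ((hS z).1 (List.mem_toFinset.1 hz)).2.2
      have h2 := ((hA z).1 (List.mem_toFinset.1 hz')).2.1
      omega
  have hAd : ∀ x ∈ A, ∀ y ∈ A, x ≠ y → G.dist x y = 1 ∨ G.dist x y = 2 := by
    classical
    intro x hx y hy hxy
    have hx' := ((hA x).1 hx).2.2 ▸ hu0v
    have hy' := ((hA y).1 hy).2.2 ▸ hu0v
    have := dist_eq_ite_of_adj hc hx'.1 hy'.1 hxy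
    split_ifs at this <;> tauto
  have hw3 : s3.arr aWeight = s.arr aWeight := by rw [hF3.arr _ (by decide)]; exact hw2
  have hr3 : (s3.read aWeight : Fin n → ℕ) = s.read aWeight := by
    ext v
    rw [State.read_apply, State.read_apply, hw3]
  have hL3 : HoldsLog s3
      (L ++ contractEntries G S.toFinset (s.read aWeight) y (S.filter (· ≠ y))) := by
    refine HoldsLog.congr (s := s2.setVar xLow y) ?_ hF3 (by decide)
    exact ⟨by simpa using hL2.length, hL2.target, hL2.source, hL2.offset, hL2.value⟩
  have hlen1 := length_contractEntries G hSn (s.read aWeight) hyS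
  have hSpos := List.length_pos_of_mem hyS
  have hApos := List.length_pos_of_mem hvA
  have e0 : s3.arr 0 = st := by
    rw [hF3.arr _ (by decide), State.setVar_arr, hF2.arr _ (by decide), hF1.arr _ (by decide), hs0]
  have e1 : s3.arr 1 = ad := by
    rw [hF3.arr _ (by decide), State.setVar_arr, hF2.arr _ (by decide), hF1.arr _ (by decide), hs1]
  rw [wp_seq]
  refine wp_mono (wp_contract hIn e0 e1 hAn (List.ne_nil_of_mem hvA) hL3 hsz3 hl3
    (fun v => ?_) hAd hW (by rw [List.length_append, hlen1]; omega)
    (fun v => by rw [hw3]; exact hwn v)) ?_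
  · rw [hF3.arr _ (by decide), State.setVar_arr, List.length_append, hlen1]
    have := hm2 v
    omega
  rintro k4 s4 ⟨hF4, a, haA, ha4, hamax, hk4, hL4, hm4, hd4⟩
  rw [hr3] at hL4
  rw [hw3] at hamax
  have hlen2 := length_contractEntries G hAn (s.read aWeight) haA
  have hw4 : s4.arr aWeight = s.arr aWeight := (hF4.arr _ (by decide)).trans hw3
  have hr4 : (s4.read aWeight : Fin n → ℕ) = s.read aWeight := by
    ext v
    rw [State.read_apply, State.read_apply, hw4]
  have hy4 : s4.var xLow = y := by
    rw [hF4.var _ (by decide), hF3.var _ (by decide)]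
    simp
  refine wp_mono (wp_attach hL4 ha4 hy4 (by omega)
    (by rw [List.length_append, List.length_append, hlen1, hlen2]; omega)
    (fun v => by rw [hw4]; exact hwn v)) ?_
  rintro k5 s5 ⟨hF5, hk5, hL5, hd5, hw5⟩
  rw [hr4] at hL5 hw5
  refine ⟨S, A, p, rest, y, a, hl, hSn, hAn, hyS, haA, hp0, fun z hzU hzp => (hA z).2
    ⟨hzU, (hcl z hzU).1 hzp⟩, hS, hA, hymax, hamax, hSd, hAd, fun z => ?_, ?_, hL5, hw5,
    fun z => ?_, ?_⟩
  · rw [hd5, Function.update_apply, hd4, hF3.arr aDead (by decide), State.setVar_arr,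
      Finset.mem_sdiff, ← hU2, List.mem_toFinset]
    simp only [Fin.val_inj]
    by_cases hza : z = a
    · simp [hza, haA]
    · split_ifs <;> tauto
  · rw [hF5.var _ (by decide), hF4.var _ (by decide)]
    exact hch3
  · have := hm4 z
    rw [List.length_append, hlen1] at this
    rw [hF5.arr _ (by decide)]
    exact this
  · have hsub1 : S.toFinset.erase y ⊆ U := fun z hz =>
      ((hS z).1 (List.mem_toFinset.1 (Finset.mem_of_mem_erase hz))).1
    have hsub2 : A.toFinset ⊆ U \ S.toFinset.erase y := fun z hz => by
      rw [List.mem_toFinset, hAdef, List.mem_filter] at hz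
      exact of_decide_eq_true hz.2
    have q1 := Finset.sum_sdiff (f := fun u => (nb u).length + 1) hsub1
    have q2 := Finset.sum_sdiff (f := fun u => (nb u).length + 1) hsub2
    have q3 : ∑ u ∈ S.toFinset.erase y, 41 * (nb u).length + 41 * (S.length - 1) =
        41 * ∑ u ∈ S.toFinset.erase y, ((nb u).length + 1) := by
      rw [Finset.sum_add_distrib, Finset.sum_const, Finset.card_erase_of_mem (by simpa using hyS),
        List.toFinset_card_of_nodup hSn, mul_add, Finset.mul_sum]
      simp
    have q4 : ∑ u ∈ A.toFinset.erase a, 41 * (nb u).length + 41 * A.length ≤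
        41 * ∑ u ∈ A.toFinset, ((nb u).length + 1) := by
      rw [Finset.sum_add_distrib, Finset.sum_const, List.toFinset_card_of_nodup hAn, mul_add,
        Finset.mul_sum, smul_eq_mul, mul_one]
      exact Nat.add_le_add_right (Finset.sum_le_sum_of_subset (Finset.erase_subset _ _)) _
    have q5 : (S.length - 1) ≤ ∑ u ∈ S.toFinset.erase y, ((nb u).length + 1) := by
      rw [Finset.sum_add_distrib, Finset.sum_const, Finset.card_erase_of_mem (by simpa using hyS),
        List.toFinset_card_of_nodup hSn]
      simp
    have q6 : A.length ≤ ∑ u ∈ A.toFinset, ((nb u).length + 1) := by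
      rw [Finset.sum_add_distrib, Finset.sum_const, List.toFinset_card_of_nodup hAn]
      simp
    -- `v` belongs to `A`, so its share pays for collecting `S` and for the constant costs.
    have q7 : (nb v).length + 1 ≤ ∑ u ∈ A.toFinset, ((nb u).length + 1) :=
      Finset.single_le_sum (f := fun u => (nb u).length + 1) (fun _ _ => Nat.zero_le _)
        (List.mem_toFinset.2 hvA)
    omega

/-- Eliminate all vertices other than the root, in the order of their keys. -/
def eliminate : Program :=
  .seq (.assign xKey (.var 0))
  (.loop (.lt (.const 0) (.add (.var xKey) (.var xCur)))
    (.branch (.eq (.var xCur) (.const 0))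
      (.seq (.assign xKey (.sub (.var xKey) (.const 1))) (.assign xCur (.get aBucket (.var xKey))))
      (.branch (.get aDead (.var xCur)) (.assign xCur (.get aNext (.var xCur))) step)))

/-- The state of the elimination: the vertices of keys `< d` and those in `c` have to be visited,
and `U` is the set of the remaining vertices. -/
structure IsElim (G : SimpleGraph (Fin n)) (r : Fin n) (bk : ℕ → List (Fin n)) (next : ℕ → ℕ)
    (d : ℕ) (c : List (Fin n)) (U : Finset (Fin n)) (L : List (Entry (Fin n))) (s : State) :
    Prop where
  var_key : s.var xKey = d
  key_le : d ≤ n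
  chain : IsChain next (s.var xCur) c
  suffix : c <:+ bk d
  dead : ∀ v : Fin n, s.arr aDead v = 0 ↔ v ∈ U
  live : ∀ z ∈ U, z ≠ r → key G r z < d ∨ z ∈ c
  log : HoldsLog s L
  isLog : G.IsLog L U (s.read aWeight)
  length_le : L.length + 4 * U.card ≤ 4 * n
  mark_le : ∀ v : Fin n, s.arr aMark v ≤ L.length
  weight_le : ∀ v : Fin n, s.arr aWeight v + G.dist r v ≤ n
  down : ∀ z ∈ U, z ≠ r → ∃ u ∈ U, u ∈ G.downNeighbors r z
  entry_le : ∀ e ∈ L, e.offset ≤ 1 ∧ e.value ≤ n + 2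

theorem weightedEccent_toFinset_le {M : List (Fin n)} {w : Fin n → ℕ} {k : ℕ} {u : Fin n}
    (hu : u ∈ M) (hd : ∀ x ∈ M, ∀ y ∈ M, x ≠ y → G.dist x y = 1 ∨ G.dist x y = 2)
    (hw : ∀ v, w v ≤ k) : G.weightedEccent M.toFinset w u ≤ k + 2 := by
  refine weightedEccent_le fun x hx hxu => ?_
  have h1 := hw x
  rcases hd u hu x (List.mem_toFinset.1 hx) hxu.symm with h | h <;> omega

/-- These bounds keep the values in the replay linear in `n`. -/
theorem entry_le_of_mem_contractEntries {M : List (Fin n)} {w : Fin n → ℕ} {k : ℕ} {t : Fin n}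
    (ht : t ∈ M) (hd : ∀ x ∈ M, ∀ y ∈ M, x ≠ y → G.dist x y = 1 ∨ G.dist x y = 2)
    (hw : ∀ v, w v ≤ k) {e : Entry (Fin n)}
    (he : e ∈ contractEntries G M.toFinset w t (M.filter (· ≠ t))) :
    e.offset ≤ 1 ∧ e.value ≤ k + 2 := by
  rw [contractEntries, List.mem_cons, List.mem_map] at he
  rcases he with rfl | ⟨u, hu, rfl⟩
  · exact ⟨Nat.zero_le _, weightedEccent_toFinset_le ht hd hw⟩
  · exact ⟨Nat.zero_le _, weightedEccent_toFinset_le (List.mem_of_mem_filter hu) hd hw⟩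

theorem IsElim.step {r v y a : Fin n} {bk : ℕ → List (Fin n)} {next : ℕ → ℕ} {d : ℕ}
    {c p rest S A : List (Fin n)} {U : Finset (Fin n)} {L : List (Entry (Fin n))} {s s' : State}
    (h : IsElim G r bk next d (v :: c) U L s) (hc : G.Connected) (hG : IsDistanceHereditary G)
    (hkey : ∀ z ∈ v :: c, z ≠ r ∧ key G r z = d)
    (hl : v :: c = p ++ rest) (hSn : S.Nodup) (hAn : A.Nodup) (hy : y ∈ S) (ha : a ∈ A)
    (hpA : ∀ z ∈ U, z ∈ p → z ∈ A)
    (hS : ∀ z, z ∈ S ↔ z ∈ U ∧ z ∈ G.downNeighbors r v)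
    (hA : ∀ z, z ∈ A ↔ z ∈ U ∧ G.dist r z = G.dist r v ∧
      G.downNeighbors r z = G.downNeighbors r v)
    (hwy : ∀ u ∈ S, s.read aWeight u ≤ s.read aWeight y)
    (hwa : ∀ u ∈ A, s.read aWeight u ≤ s.read aWeight a)
    (hSd : ∀ x ∈ S, ∀ y ∈ S, x ≠ y → G.dist x y = 1 ∨ G.dist x y = 2)
    (hAd : ∀ x ∈ A, ∀ y ∈ A, x ≠ y → G.dist x y = 1 ∨ G.dist x y = 2)
    (hdead : ∀ z : Fin n, s'.arr aDead z = 0 ↔ z ∈ (U \ S.toFinset.erase y) \ A.toFinset)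
    (hch : IsChain next (s'.var xCur) rest)
    (hL : HoldsLog s' (((L ++ contractEntries G S.toFinset (s.read aWeight) y (S.filter (· ≠ y))) ++
      contractEntries G A.toFinset (s.read aWeight) a (A.filter (· ≠ a))) ++
      [⟨y, y, 0, s.read aWeight a + 1⟩, ⟨a, y, 1, s.read aWeight y + 1⟩]))
    (hw : (s'.read aWeight : Fin n → ℕ) = Function.update (s.read aWeight) y
      (max (s.read aWeight y) (s.read aWeight a + 1)))
    (hm : ∀ z : Fin n, s'.arr aMark z ≤ L.length + S.length + 1) (hk : s'.var xKey = s.var xKey) :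
    IsElim G r bk next d rest ((U \ S.toFinset.erase y) \ A.toFinset)
      (((L ++ contractEntries G S.toFinset (s.read aWeight) y (S.filter (· ≠ y))) ++
        contractEntries G A.toFinset (s.read aWeight) a (A.filter (· ≠ a))) ++
        [⟨y, y, 0, s.read aWeight a + 1⟩, ⟨a, y, 1, s.read aWeight y + 1⟩]) s' := by
  have hv : v ∈ v :: c := by simp
  have hlev : ∀ z ∈ U, G.dist r z ≤ G.dist r v := fun z hz => dist_le_of_key_le hc hkey h.live hv hz
  have hmin : ∀ z ∈ U, G.dist r z = G.dist r v → G.downNeighbors r z ⊆ G.downNeighbors r v →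
    G.downNeighbors r z = G.downNeighbors r v := fun z hz =>
      downNeighbors_eq_of_key_le hc hkey h.live hv hz
  have hlen1 := length_contractEntries G hSn (s.read aWeight) hy
  have hlen2 := length_contractEntries G hAn (s.read aWeight) ha
  have hS' : ∀ z, z ∈ S.toFinset ↔ z ∈ U ∧ z ∈ G.downNeighbors r v := by simpa using hS
  have hA' : ∀ z, z ∈ A.toFinset ↔ z ∈ U ∧ G.dist r z = G.dist r v ∧
      G.downNeighbors r z = G.downNeighbors r v := by simpa using hA
  have hwle : ∀ z : Fin n, s.read aWeight z ≤ n := fun z =>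
    (Nat.le_add_right _ _).trans (h.weight_le z)
  have hSpos := List.length_pos_of_mem hy
  have hApos := List.length_pos_of_mem ha
  refine ⟨hk.trans h.var_key, h.key_le, hch,
    (List.suffix_append p rest).trans (hl ▸ h.suffix), hdead, fun z hz hzr => ?_, hL, ?_, ?_,
    fun z => ?_, fun z => ?_, fun z hz hzr => ?_, fun e he => ?_⟩
  · rw [Finset.mem_sdiff, Finset.mem_sdiff, List.mem_toFinset] at hz
    refine (h.live z hz.1.1 hzr).imp_right fun hzc => ?_
    rw [hl, List.mem_append] at hzc
    exact hzc.resolve_left fun hzp => hz.2 (hpA z hz.1.1 hzp)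
  · rw [hw]
    refine IsLog.eliminate hc hG (hkey v hv).1 hlev hmin hS' hA' (by simpa using hy)
      (by simpa using ha) h.isLog (by simpa using hwy) (by simpa using hwa) (fun z => ?_) fun z => ?_
    · simp [and_comm]
    · simp [and_comm]
  -- |S| + |A| + 2 entries are written and |S| + |A| - 1 vertices removed, where both sets are
  -- non-empty: at most 4 entries per vertex.
  · have hsub1 : S.toFinset.erase y ⊆ U := fun z hz =>
      ((hS' z).1 (Finset.mem_of_mem_erase hz)).1
    have hsub2 : A.toFinset ⊆ U \ S.toFinset.erase y := fun z hz => by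
      rw [hA'] at hz
      rw [Finset.mem_sdiff]
      refine ⟨hz.1, fun h => ?_⟩
      have h1 := ((hS' z).1 (Finset.mem_of_mem_erase h)).2.2
      have h2 := hz.2.1
      omega
    have c1 := Finset.card_sdiff_of_subset hsub1
    have c2 := Finset.card_sdiff_of_subset hsub2
    have c3 := Finset.card_le_card hsub1
    have c4 := Finset.card_le_card hsub2
    rw [Finset.card_erase_of_mem (List.mem_toFinset.2 hy), List.toFinset_card_of_nodup hSn] at c1 c3
    rw [List.toFinset_card_of_nodup hAn] at c2 c4
    have := h.length_le
    simp only [List.length_append, hlen1, hlen2, List.length_cons, List.length_nil]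
    omega
  · have := hm z
    simp only [List.length_append, hlen1, hlen2, List.length_cons, List.length_nil]
    omega
  · rw [← State.read_apply, hw]
    -- The weight `w a + 1` moves from `a` to a vertex one level lower, so weight plus level does
    -- not grow beyond the bound `n`.
    by_cases hzy : z = y
    · subst hzy
      have h1 := h.weight_le z
      have h2 := h.weight_le a
      have h3 := ((hS z).1 hy).2.2
      have h4 := ((hA a).1 ha).2.1
      simp only [Function.update_self, State.read_apply]
      omega
    · rw [Function.update_of_ne hzy]
      exact h.weight_le z
  · exact exists_mem_downNeighbors_of_eliminate hc hG hlev hmin hS' hA' (by simpa using hy) h.down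
      hz hzr
  · simp only [List.mem_append, List.mem_cons, List.not_mem_nil, or_false] at he
    have h1 := hwle a
    have h2 := hwle y
    rcases he with ((he | he) | he) | rfl | rfl
    · exact h.entry_le e he
    · exact entry_le_of_mem_contractEntries hy hSd hwle he
    · exact entry_le_of_mem_contractEntries ha hAd hwle he
    · exact ⟨Nat.zero_le _, by simp only; omega⟩
    · exact ⟨le_rfl, by simp only; omega⟩

theorem wp_eliminate (hIn : Input G st ad nb) {W : ℕ} {s : State} (hs0 : s.arr 0 = st)
    (hs1 : s.arr 1 = ad) (hn0 : s.var 0 = n) (hc : G.Connected) (hG : IsDistanceHereditary G)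
    {r : Fin n} (hr : (r : ℕ) = 0) {q : List (Fin n)}
    (hB : IsBFS G r q (s.read aDepth) (s.read aPar) q.length) (hq : q.length = n)
    (hbk : ∀ k, IsChain (s.arr aNext) (s.arr aBucket k)
      ((q.tail.filter fun v => key G r v = k).reverse : List (Fin n)))
    (hcur : s.var xCur = 0) (hlog : s.var xLog = 0) (hd : ∀ v : Fin n, s.arr aDead v = 0)
    (hm : ∀ v : Fin n, s.arr aMark v = 0) (hw : ∀ v : Fin n, s.arr aWeight v = 0)
    (hW : 10 * n + 2 * G.edgeSet.ncard ≤ W) :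
    wp W eliminate (fun k s' => Frame eliminate s s' ∧
      k ≤ 2000 * n + 2000 * G.edgeSet.ncard + 10 ∧ ∃ L : List (Entry (Fin n)), HoldsLog s' L ∧
        L.length ≤ 4 * n ∧ (∀ e ∈ L, e.offset ≤ 1 ∧ e.value ≤ n + 2) ∧
        G.IsEccentOn Finset.univ 0 (replay L 0)) s := by
  refine wp_mono (wp_frame (Q := fun k s' => k ≤ 2000 * n + 2000 * G.edgeSet.ncard + 10 ∧
      ∃ L : List (Entry (Fin n)), HoldsLog s' L ∧
        L.length ≤ 4 * n ∧ (∀ e ∈ L, e.offset ≤ 1 ∧ e.value ≤ n + 2) ∧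
        G.IsEccentOn Finset.univ 0 (replay L 0)) ?_) (fun k s' h => ⟨h.2, h.1⟩)
  have hdep : ∀ v : Fin n, s.arr aDepth v = G.dist r v + 1 := hB.dep_eq hc
  have hmem := hB.mem_of_length hc
  have hqt : q = r :: q.tail := by
    have := hB.zero
    cases q with
    | nil => simp at this
    | cons x l => simpa using this
  have hnd : (r :: q.tail).Nodup := hqt ▸ hB.nodup
  have hdn : ∀ v : Fin n, G.dist r v ≤ n := fun v => by
    obtain ⟨i, hi⟩ := List.mem_iff_getElem?.1 (hmem v)
    have h1 := hB.dep_le hi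
    have h2 := (List.getElem?_eq_some_iff.1 hi).1
    rw [hB.dep_eq hc] at h1
    omega
  set bk : ℕ → List (Fin n) := fun k => (q.tail.filter fun v => key G r v = k).reverse with hbkdef
  have hkey : ∀ {d : ℕ} {c : List (Fin n)}, c <:+ bk d → ∀ z ∈ c, z ≠ r ∧ key G r z = d := by
    intro d c hcd z hz
    have := hcd.subset hz
    simp only [hbkdef, List.mem_reverse, List.mem_filter, decide_eq_true_eq] at this
    refine ⟨?_, this.2⟩
    rintro rfl
    exact (List.nodup_cons.1 hnd).1 this.1
  have hz0 : ∀ {z : Fin n}, z ≠ r → (z : ℕ) ≠ 0 := fun hz h => hz (Fin.ext (h.trans hr.symm))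
  have hparn : ∀ v : Fin n, v ≠ r → s.arr aPar v ≤ n := by
    intro v hv
    obtain ⟨p, hp, -⟩ := hB.exists_parent hc hv
    have := (List.getElem?_eq_some_iff.1 hp).1
    rw [State.read_apply] at this
    omega
  rw [eliminate, wp_seq, wp_assign]
  simp only [Expr.eval, Expr.cost, hn0]
  refine ⟨by omega, ?_⟩
  refine wp_mono (wp_loop (fun (x : ℕ × List (Fin n) × Finset (Fin n) × List (Entry (Fin n))) s' =>
    IsElim G r bk (s.arr aNext) x.1 x.2.1 x.2.2.1 x.2.2.2 s')
    -- Remaining vertices pay for their elimination, unvisited list nodes for moving along the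
    -- buckets, and the key for opening the next bucket.
    (fun x => 1000 * (∑ u ∈ x.2.2.1, ((nb u).length + 1)) +
      100 * (x.2.1.length + ∑ k ∈ Finset.range x.1, (bk k).length) + 100 * x.1)
    (n, [], Finset.univ, []) ?_ ?_) ?_
  · refine ⟨by simp, le_rfl, by simpa [IsChain] using hcur, List.nil_suffix, by simpa using hd,
      fun z _ _ => .inl (by simpa using key_lt_card (G := G) (r := r) z),
      ⟨by simpa using hlog, .nil, .nil, .nil, .nil⟩, fun E hE => ?_, by simp, by simpa using hm,
      fun v => by rw [State.setVar_arr, hw]; simpa using hdn v, fun z _ hzr => ?_, by simp⟩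
    · have : ((s.setVar xKey n).read aWeight : Fin n → ℕ) = 0 := funext hw
      rw [this] at hE
      exact hE
    · obtain ⟨u, hu⟩ := hc.exists_mem_downNeighbors
        (hc.dist_eq_zero_iff.not.2 (Ne.symm hzr) : G.dist r z ≠ 0)
      exact ⟨u, Finset.mem_univ _, hu⟩
  · rintro ⟨d, c, U, L⟩ s' hI hF hb
    simp only at hI ⊢
    have hk := hkey hI.suffix
    have e4 : s'.arr aDepth = s.arr aDepth := hF.arr _ (by decide)
    have e5 : s'.arr aPar = s.arr aPar := hF.arr _ (by decide)
    have e7 : s'.arr aBucket = s.arr aBucket := hF.arr _ (by decide)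
    have e8 : s'.arr aNext = s.arr aNext := hF.arr _ (by decide)
    have hch := hI.chain
    have hkv := hI.var_key
    have hdn' := hI.key_le
    rw [wp_branch]
    cases c with
    | nil =>
      rw [IsChain] at hch
      simp only [Expr.eval, hch, hkv] at hb
      obtain ⟨d, rfl⟩ : ∃ d', d = d' + 1 := ⟨d - 1, by split_ifs at hb <;> omega⟩
      simp only [wp_seq, wp_assign, Expr.eval, Expr.cost, State.setVar_arr, State.setVar_var,
        ↓reduceIte, hch, hkv, e7, Nat.add_sub_cancel]
      refine ⟨fun _ => ⟨by omega, ((hbk d).le.trans (by omega)), (d, bk d, U, L), ?_, ?_⟩,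
        fun h => absurd h (by norm_num)⟩
      · refine ⟨by simp, by omega, by simpa using hbk d, List.suffix_rfl, hI.dead, fun z hz hzr => ?_,
          ⟨by simpa using hI.log.length, hI.log.target, hI.log.source, hI.log.offset,
          hI.log.value⟩, hI.isLog, hI.length_le, hI.mark_le, hI.weight_le, hI.down, hI.entry_le⟩
        have h1 := (hI.live z hz hzr).resolve_right (by simp)
        by_cases h2 : key G r z = d
        · right
          have h3 := hmem z
          rw [hqt] at h3
          simp only [hbkdef, List.mem_reverse, List.mem_filter, decide_eq_true_eq]
          exact ⟨(List.mem_cons.1 h3).resolve_left hzr, h2⟩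
        · left; omega
      · simp only [Finset.sum_range_succ, List.length_nil]
        omega
    | cons v c =>
      have hvk := hk v (by simp)
      have hv0 := hz0 hvk.1
      simp only [Expr.eval, Expr.cost, hch.1]
      refine ⟨fun h => absurd h (by rw [if_neg hv0]; simp), fun _ => ?_⟩
      rw [wp_branch]
      simp only [Expr.eval, Expr.cost, hch.1]
      constructor
      · intro hdv
        have hvU : v ∉ U := fun h => hdv ((hI.dead v).2 h)
        simp only [wp_assign, Expr.eval, Expr.cost, hch.1, e8]
        refine ⟨hch.2.le.trans (by omega), (d, c, U, L), ?_, ?_⟩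
        · refine ⟨by simpa using hkv, hdn', by simpa using hch.2,
            (List.suffix_cons v c).trans hI.suffix, hI.dead, fun z hz hzr => ?_,
            ⟨by simpa using hI.log.length, hI.log.target, hI.log.source, hI.log.offset,
            hI.log.value⟩, hI.isLog, hI.length_le, hI.mark_le, hI.weight_le, hI.down, hI.entry_le⟩
          refine (hI.live z hz hzr).imp_right fun hzc => (List.mem_cons.1 hzc).resolve_left ?_
          rintro rfl
          exact hvU hz
        · simp only [List.length_cons]
          omega
      · intro hdv
        have hvU : v ∈ U := (hI.dead v).1 hdv
        have hcn : (v :: c).Nodup := by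
          refine hI.suffix.sublist.nodup ?_
          exact List.nodup_reverse.2 ((List.nodup_cons.1 hnd).2.filter _)
        refine wp_mono (wp_frame (wp_step hIn (by rw [hF.arr _ (by decide)]; exact hs0)
          (by rw [hF.arr _ (by decide)]; exact hs1) hc (by simpa [e4] using hdep) hI.dead hcn
          (fun u hu => hz0 (hk u hu).1) (by rw [e8]; exact hch) (by rw [e5]; exact hparn v hvk.1)
          hI.log hI.length_le hI.mark_le
          (fun v => (Nat.le_add_right _ _).trans (hI.weight_le v)) hW hvU (hI.down v hvU hvk.1)
          (fun p rest hl hp0 hp hrest z hz => ?_))) ?_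
        · rw [e5] at hp hrest
          exact hB.mem_iff_of_par_eq hc hG hI.suffix hk hI.live hl hp0 hp hrest hz
        rintro k s'' ⟨⟨S, A, p, rest, y, a, hl, hSn, hAn, hy, ha, hp0, hpA, hS, hA, hwy, hwa, hSd, hAd,
          hdead, hch', hL', hw', hm', hk'⟩, hF'⟩
        rw [e8] at hch'
        refine ⟨(d, rest, _, _), hI.step hc hG hk hl hSn hAn hy ha hpA hS hA hwy hwa hSd hAd hdead
          hch' hL' hw' hm' (hF'.var _ (by decide)), ?_⟩
        have hlen := congrArg List.length hl
        rw [List.length_append] at hlen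
        have hppos := List.length_pos_of_ne_nil hp0
        have hsum : ∑ u ∈ (U \ S.toFinset.erase y) \ A.toFinset, ((nb u).length + 1) ≤
            ∑ u ∈ U, ((nb u).length + 1) :=
          Finset.sum_le_sum_of_subset (Finset.sdiff_subset.trans Finset.sdiff_subset)
        simp only
        omega
  · rintro k s' ⟨⟨d, c, U, L⟩, hI, hF, hb, hk⟩
    simp only at hI hk
    have hcurd : s'.var xCur = 0 ∧ d = 0 := by
      have := hI.var_key
      have h : ¬ 0 < s'.var xKey + s'.var xCur := fun h =>
        one_ne_zero (α := ℕ) ((if_pos h).symm.trans hb)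
      omega
    have hc0 : c = [] := by
      cases c with
      | nil => rfl
      | cons v c =>
        exact absurd (hI.chain.1.symm.trans hcurd.1) (hz0 (hkey hI.suffix v (by simp)).1)
    have hU : ∀ z ∈ U, z = r := by
      intro z hz
      by_contra hzr
      rcases hI.live z hz hzr with h | h
      · omega
      · simp [hc0] at h
    -- Only the root can be left, and a weighted eccentricity ignores the vertex itself, so the
    -- replay may start from 0 everywhere.
    refine ⟨?_, L, hI.log, by have := hI.length_le; omega, hI.entry_le, hI.isLog 0 fun v hv => ?_⟩
    · have h1 : ∑ u : Fin n, ((nb u).length + 1) = 2 * G.edgeSet.ncard + n := by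
        rw [Finset.sum_add_distrib, hIn.sum]
        simp
      -- The buckets are the fibres of `key` on the queue without the root.
      have h2 : ∑ k ∈ Finset.range n, (bk k).length ≤ n := by
        have h3 : ∀ k, (bk k).length = (q.tail.toFinset.filter fun v => key G r v = k).card := by
          intro k
          rw [hbkdef]
          simp only [List.length_reverse]
          rw [← List.toFinset_card_of_nodup ((List.nodup_cons.1 hnd).2.filter _),
            List.toFinset_filter]
          simp
        have h4 : q.tail.toFinset.card ≤ n := by
          simpa using Finset.card_le_univ q.tail.toFinset
        simp only [h3]
        rw [← Finset.card_eq_sum_card_fiberwise (f := key G r)]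
        · exact h4
        · intro z _
          simpa using key_lt_card (G := G) (r := r) z
      simp only [h1, List.length_nil, Expr.cost] at hk
      omega
    · refine (Nat.le_zero.1 (weightedEccent_le fun u hu huv => ?_)).symm
      exact absurd ((hU u hu).trans (hU v hv).symm) huv

/-- Execute the entries of the log on the array `aOut`, the last one first. -/
def replayLog : Program :=
  .loop (.lt (.const 0) (.var xLog))
    (.seq (.assign xLog (.sub (.var xLog) (.const 1)))
    (.seq (.assign xVal
      (.add (.get aOut (.get aSource (.var xLog))) (.get aOffset (.var xLog))))
    (.seq (.branch (.lt (.var xVal) (.get aValue (.var xLog)))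
      (.assign xVal (.get aValue (.var xLog))) .skip)
    (.store aOut (.get aTarget (.var xLog)) (.var xVal)))))

/-- Offsets are at most 1, so each executed entry raises the bound on the outputs by at most 1; this
gives the word size `k + L.length`. -/
theorem wp_replayLog {W k : ℕ} {s : State} {L : List (Entry (Fin n))} (hL : HoldsLog s L)
    (hout : ∀ v : Fin n, s.arr aOut v = 0) (he : ∀ e ∈ L, e.offset ≤ 1 ∧ e.value ≤ k) (hn : n ≤ W)
    (hW : k + L.length ≤ W) :
    wp W replayLog (fun t s' => t ≤ 50 * L.length + 10 ∧
      (s'.read aOut : Fin n → ℕ) = replay L 0) s := by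
  have hlt : ∀ v : Fin n, (v : ℕ) < n := fun v => v.2
  refine wp_mono (wp_loop (fun (x : List (Entry (Fin n)) × List (Entry (Fin n))) s' =>
    L = x.1 ++ x.2 ∧ s'.var xLog = x.1.length ∧
    (s'.read aOut : Fin n → ℕ) = replay x.2 0 ∧ ∀ v : Fin n, s'.arr aOut v ≤ k + x.2.length)
    (fun x => 50 * x.1.length) (L, []) ⟨by simp, hL.length, funext hout, by simp [hout]⟩ ?_) ?_
  · rintro ⟨l, l'⟩ s' ⟨h1, h2, h3, h4⟩ hF hb
    simp only at h1 h2 h3 h4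
    have e1 : s'.arr aTarget = s.arr aTarget := hF.arr _ (by decide)
    have e2 : s'.arr aSource = s.arr aSource := hF.arr _ (by decide)
    have e3 : s'.arr aOffset = s.arr aOffset := hF.arr _ (by decide)
    have e4 : s'.arr aValue = s.arr aValue := hF.arr _ (by decide)
    obtain rfl | ⟨p, e, rfl⟩ := List.eq_nil_or_concat' l
    · simp [Expr.eval, h2] at hb
    have hget : L[p.length]? = some e := by simp [h1]
    have g1 := hL.target _ _ hget
    have g2 := hL.source _ _ hget
    have g3 := hL.offset _ _ hget
    have g4 := hL.value _ _ hget
    have heL := he e (by simp [h1])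
    have hlen := congrArg List.length h1
    simp only [List.length_append, List.length_singleton] at hlen h2
    have hs := h4 e.source
    have ht := hlt e.target
    simp only [wp_seq, wp_assign, wp_branch, wp_skip, wp_store, Expr.eval, Expr.cost,
      State.setVar_var, State.setVar_arr, State.setArr_var, State.setArr_arr, ↓reduceIte,
      Nat.reduceEqDiff, h2, Nat.add_sub_cancel, e1, e2, e3, e4, g1, g2, g3, g4]
    have key : ∀ (s'' : State) (x : ℕ), s''.arr = s'.arr →
        x = max (s'.arr aOut e.source + e.offset) e.value →
        ((s''.setArr aOut e.target x).read aOut : Fin n → ℕ) = replay (e :: l') 0 ∧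
        ∀ v : Fin n, Function.update (s'.arr aOut) e.target x v ≤ k + (e :: l').length := by
      rintro s'' x ha rfl
      have hr : (s''.read aOut : Fin n → ℕ) = replay l' 0 := by
        rw [← h3]
        ext v
        rw [State.read_apply, State.read_apply, ha]
      refine ⟨?_, fun v => ?_⟩
      · rw [State.read_setArr, if_pos rfl, hr, ← State.read_apply s', h3]
        rfl
      · have := h4 v
        simp only [Function.update_apply, List.length_cons]
        split_ifs <;> omega
    have h1' : L = p ++ (e :: l') := by simpa using h1
    refine ⟨by omega, by omega, fun h => ?_, fun h => ?_⟩
    · have h' : s'.arr aOut e.source + e.offset < e.value := by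
        by_contra h'
        simp [h'] at h
      refine ⟨by omega, by omega, by omega, (p, e :: l'), ⟨h1', rfl,
        key _ _ (by rfl) (by omega)⟩, ?_⟩
      simp only [List.length_append, List.length_singleton]
      omega
    · have h' : ¬ s'.arr aOut e.source + e.offset < e.value := by
        intro h'
        simp [h'] at h
      refine ⟨by omega, by omega, (p, e :: l'), ⟨h1', rfl,
        key _ _ (by rfl) (by omega)⟩, ?_⟩
      simp only [List.length_append, List.length_singleton]
      omega
  · rintro t s' ⟨⟨l, l'⟩, ⟨h1, h2, h3, h4⟩, hF, hb, ht⟩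
    simp only at h1 h2 h3 h4 ht
    have hl : l = [] := by
      rw [← List.length_eq_zero_iff, ← h2]
      by_contra h
      exact one_ne_zero (α := ℕ) ((if_pos (Nat.pos_of_ne_zero h)).symm.trans hb)
    rw [hl, List.nil_append] at h1
    simp only [Expr.cost] at ht
    exact ⟨by omega, h1 ▸ h3⟩

/-- The eccentricities of the vertices of a distance-hereditary graph. -/
def eccentricities : Program :=
  .seq bfs (.seq levels (.seq buckets (.seq eliminate replayLog)))

theorem wp_eccentricities {W : ℕ} {s : State} (hs : HoldsGraph G s) (hc : G.Connected)
    (hG : IsDistanceHereditary G) (hW : 10 * n + 2 * G.edgeSet.ncard ≤ W) :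
    wp W eccentricities (fun t s' => t ≤ 3000 * (n + G.edgeSet.ncard) + 200 ∧
      ∀ v : Fin n, (s'.arr aOut v : ℕ∞) = G.eccent v) s := by
  obtain ⟨nb, hIn⟩ := hs.exists_input
  obtain ⟨r0⟩ := hc.nonempty
  have hn : 0 < n := r0.pos
  have hv : ∀ x, x ≠ 0 → s.var x = 0 := hs.var_rest
  have ha : ∀ a, 2 ≤ a → ∀ i, s.arr a i = 0 := hs.arr_rest
  rw [eccentricities, wp_seq]
  refine wp_mono (wp_bfs hIn hc ⟨0, hn⟩ rfl rfl rfl hW (ha _ (by norm_num)) (ha _ (by norm_num))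
    (hv _ (by norm_num))) ?_
  rintro t1 s1 ⟨hF1, ht1, q, hB, hq, hqa⟩
  have hB1 : IsBFS G ⟨0, hn⟩ q (s1.read aDepth) (s1.read aPar) q.length := by rw [hq]; exact hB
  rw [wp_seq]
  refine wp_mono (wp_levels hc hB1 hq (by omega) (by rw [hF1.var _ (by decide)]; exact hs.var_zero)
    hqa) ?_
  rintro t2 s2 ⟨hF2, ht2, hst⟩
  have d2 : s2.arr aDepth = s1.arr aDepth := hF2.arr _ (by decide)
  have p2 : s2.arr aPar = s1.arr aPar := hF2.arr _ (by decide)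
  have q2 : s2.arr aQueue = s1.arr aQueue := hF2.arr _ (by decide)
  have hread : ∀ {s s' : State} {a : ℕ}, s'.arr a = s.arr a →
      (s'.read a : Fin n → ℕ) = s.read a := fun h => by
    ext v
    rw [State.read_apply, State.read_apply, h]
  have hB2 : IsBFS G ⟨0, hn⟩ q (s2.read aDepth) (s2.read aPar) q.length := by
    rw [hread d2, hread p2]
    exact hB1
  rw [wp_seq]
  refine wp_mono (wp_buckets hIn hc ((hF2.arr _ (by decide)).trans (hF1.arr _ (by decide)))
    ((hF2.arr _ (by decide)).trans (hF1.arr _ (by decide))) hB2 hq hW ?_ (q2 ▸ hqa)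
    (d2 ▸ hst) fun k => ?_) ?_
  · rw [hF2.var _ (by decide), hF1.var _ (by decide)]
    exact hs.var_zero
  · rw [hF2.arr _ (by decide), hF1.arr _ (by decide)]
    exact ha _ (by norm_num) _
  rintro t3 s3 ⟨hF3, ht3, hbk⟩
  have hB3 : IsBFS G ⟨0, hn⟩ q (s3.read aDepth) (s3.read aPar) q.length := by
    rw [hread (hF3.arr aDepth (by decide)), hread (hF3.arr aPar (by decide))]
    exact hB2
  rw [wp_seq]
  refine wp_mono (wp_eliminate hIn ?_ ?_ ?_ hc hG rfl hB3 hq hbk ?_ ?_ ?_ ?_ ?_ hW) ?_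
  · rw [hF3.arr _ (by decide), hF2.arr _ (by decide), hF1.arr _ (by decide)]
  · rw [hF3.arr _ (by decide), hF2.arr _ (by decide), hF1.arr _ (by decide)]
  · rw [hF3.var _ (by decide), hF2.var _ (by decide), hF1.var _ (by decide)]
    exact hs.var_zero
  · rw [hF3.var _ (by decide), hF2.var _ (by decide), hF1.var _ (by decide)]
    exact hv _ (by norm_num)
  · rw [hF3.var _ (by decide), hF2.var _ (by decide), hF1.var _ (by decide)]
    exact hv _ (by norm_num)
  · intro v
    rw [hF3.arr _ (by decide), hF2.arr _ (by decide), hF1.arr _ (by decide)]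
    exact ha _ (by norm_num) _
  · intro v
    rw [hF3.arr _ (by decide), hF2.arr _ (by decide), hF1.arr _ (by decide)]
    exact ha _ (by norm_num) _
  · intro v
    rw [hF3.arr _ (by decide), hF2.arr _ (by decide), hF1.arr _ (by decide)]
    exact ha _ (by norm_num) _
  rintro t4 s4 ⟨hF4, ht4, L, hL, hLn, he, hE⟩
  refine wp_mono (wp_replayLog hL (fun v => ?_) he (by omega) (by omega)) ?_
  · rw [hF4.arr _ (by decide), hF3.arr _ (by decide), hF2.arr _ (by decide), hF1.arr _ (by decide)]
    exact ha _ le_rfl _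
  rintro t5 s5 ⟨ht5, h5⟩
  refine ⟨by omega, fun v => ?_⟩
  rw [← State.read_apply, h5]
  exact hE.eq_eccent hc v

end

end RAM

/-- There are a fixed program and a constant `C` such that for every connected distance-hereditary
graph `G` with `n` vertices and `m` edges, given by adjacency lists, the program halts after at most
`C * (n + m)` steps, with memory words of value at most `C * (n + m)`, and leaves the eccentricity of
every vertex `v` in array `2` at index `v`. -/
theorem mainTheorem4 :
    ∃ (P : RAM.Program) (C : ℕ), ∀ (n : ℕ) (G : SimpleGraph (Fin n)),
      G.Connected → IsDistanceHereditary G →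
      ∀ s : RAM.State, RAM.HoldsGraph G s →
        ∃ (t : ℕ) (s' : RAM.State),
          RAM.Exec (C * (n + G.edgeSet.ncard)) P s t s' ∧
          t ≤ C * (n + G.edgeSet.ncard) ∧
          ∀ v : Fin n, (s'.arr 2 (v : ℕ) : ℕ∞) = G.eccent v := by
  -- As `n` is positive, the additive 200 is absorbed by the difference between 3000 and 4000.
  refine ⟨RAM.eccentricities, 4000, fun n G hc hG s hs => ?_⟩
  have hn : 0 < n := hc.nonempty.some.pos
  obtain ⟨t, s', he, ht, h⟩ := RAM.wp_eccentricities hs hc hG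
    (W := 4000 * (n + G.edgeSet.ncard)) (by omega)
  exact ⟨t, s', he, by omega, h⟩
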